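/- **Conventions.** Let $q\ge 2$, $\epsilon=(-1)^q$, and let $\Lambda$ be a weakly finite ring with $1$ and involution (weakly finite, also called stably finite: $\Lambda^n\oplus K\cong\Lambda^n$ implies $K=0$). Modules are left modules; $M^*=\mathrm{Hom}_\Lambda(M,\Lambda)$ is a left module via the involution, and $M^{**}=M$ for f.g. free $M$. For $\varepsilon'=\pm1$ put $Q_{\varepsilon'}(M)=\mathrm{coker}\,(1-T_{\varepsilon'})$, where $T_{\varepsilon'}\varphi=\varepsilon'\varphi^*$ on $\mathrm{Hom}_\Lambda(M,M^*)$. An $\varepsilon'$-quadratic form $(M,\psi)$ is a f.g. free $M$ with $\psi\in Q_{\varepsilon'}(M)$; it is non-singular if $\psi+\varepsilon'\psi^*:M\to M^*$ is an isomorphism. The hyperbolic form on $L\oplus L^*$, $L$ f.g. free, is $H_{\varepsilon'}(L)$ with matrix $\begin{pmatrix}0&1\\0&0\end{pmatrix}$ (up to the order of the summands). $L_{2q+2}(\Lambda)$ is the group of non-singular $(-\epsilon)$-quadratic forms up to isometry after adding hyperbolic forms. **Preformations.** A regular $\epsilon$-quadratic split preformation is $z=(F\xleftarrow{\gamma}G\xrightarrow{\mu}F^*,\bar\theta)$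 with $F,G$ f.g. free and $\bar\theta\in Q_{-\epsilon}(G)$ such that $\bar\theta-\epsilon\bar\theta^*=\gamma^*\mu$. A strong isomorphism $z\to z'$ is a pair of isomorphisms $\alpha:F\to F'$, $\beta:G\to G'$ with $\alpha\gamma=\gamma'\beta$, $\alpha^{-*}\mu=\mu'\beta$ and $\bar\theta=\beta^*\bar\theta'\beta$. The boundary of a $(-\epsilon)$-quadratic form $(K,\theta)$ is $(K\xleftarrow{1}K\xrightarrow{\theta-\epsilon\theta^*}K^*,\theta)$. Then $l_{2q+2}(\Lambda)$ is the set of classes $[z]$ of regular $\epsilon$-quadratic split preformations, where $[z]=[z']$ iff $z$ and $z'$ become strongly isomorphic after adding boundaries of hyperbolic forms. A preformation $z$ is elementary if there is a f.g. free submodule $j:U\hookrightarrow G$ with $j^*\gamma^*\mu j=0$, $j^*\bar\theta j=0\in Q_{-\epsilon}(U)$, with $\gamma j$ and $\mu j$ injective and their images $U_0\subset F$, $U_1\subset F^*$ direct summands, and with $F^*/U_1\to U_0^*$, $f\mapsto f|_{U_0}$, an isomorphism. A class in $l_{2q+2}(\Lambda)$ is elementary if it has an elementary representative. A flip-isomorphism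 of $z$ is $t=(\alpha,\beta,\bar\nu)$ with isomorphisms $\alpha:F\to F^*$, $\beta:G\to G$ and $\bar\nu\in Q_{-\epsilon}(F^*)$ such that $\alpha\gamma+\alpha(\bar\nu-\epsilon\bar\nu^*)^*\mu=\epsilon\mu\beta$, $\alpha^{-*}\mu=\gamma\beta$ and $\bar\theta+\mu^*\bar\nu\mu+\beta^*\bar\theta\beta=0\in Q_{-\epsilon}(G)$. **Quadratic structures.** For a complex $C$ of f.g. free modules let $C^p=(C_p)^*$ and $W_\%(C)_n=\{(\psi_s:C^{n-r-s}\to C_r)_{r\in\mathbb Z,\,s\ge0}\}$, with $T\psi_s=(-1)^{pr}\psi_s^*:C^p\to C_r$ and $$(d\psi)_s=d\psi_s+(-1)^r\psi_sd^*+(-1)^{n-s-1}\bigl(\psi_{s+1}+(-1)^{s+1}T\psi_{s+1}\bigr):C^{n-1-r-s}\to C_r .$$ If $\psi\in W_\%(C)_n$ and $f,f':C\to C'$ are chain maps, with $\chi,\chi'\in W_\%(C')_{n+1}$, then a homotopy $(\Delta,\eta):(f,\chi)\simeq(f',\chi')$ consists of maps $\Delta:C_{r}\to C'_{r+1}$ with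 $f'-f=d\Delta+\Delta d$ and of $\eta\in W_\%(C')_{n+2}$ with $\chi'-\chi=\Delta_\%\psi+d\eta$, where $$(\Delta_\%\psi)_s=-\Delta\psi_sf^*+(-1)^{r+1}\bigl(f'\psi_s+(-1)^n\Delta T\psi_{s+1}\bigr)\Delta^*:(C')^{n+1-r-s}\to C'_r .$$ Let $z$, $t$ be as above. Let $\theta:G\to G^*$ and $\nu:F^*\to F$ be representatives of $\bar\theta$, $\bar\nu$, and let $\kappa:G\to G^*$ satisfy $\beta^*\theta\beta+\theta+\mu^*\nu\mu=\kappa+\epsilon\kappa^*$. Define a complex $C$ by $C_{q+1}=G$, $C_q=F\oplus F^*$, $C_{q-1}=G^*$ (zero otherwise), $d_{q+1}=\begin{pmatrix}-\epsilon\gamma\\-\epsilon\mu\end{pmatrix}$, $d_q=(\mu^*\ \ \epsilon\gamma^*)$, and $\psi\in W_\%(C)_{2q}$ with non-zero components $\psi_0=1:C^{q-1}=G\to C_{q+1}=G$, $\psi_0=\begin{pmatrix}0&0\\1&0\end{pmatrix}:C^q=F^*\oplus F\to C_q=F\oplus F^*$, $\psi_1=(\epsilon\gamma^*\ \ 0):C^q\to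 C_{q-1}$, $\psi_2=-\epsilon\theta^*:C^{q-1}\to C_{q-1}$. Let $h_t:C\to C$ be the chain map given by $\beta$, $\begin{pmatrix}0&\alpha^{-*}\\\epsilon\alpha&\epsilon\alpha(\nu^*-\epsilon\nu)\end{pmatrix}$, $\beta^{-*}$ in degrees $q+1,q,q-1$, and let $\chi_t\in W_\%(C)_{2q+1}$ have non-zero components $\chi_{t,1}=\begin{pmatrix}0&0\\1&-\alpha\nu^*\alpha^*\end{pmatrix}:C^q\to C_q$, $\chi_{t,2}=\begin{pmatrix}0\\\epsilon\mu-\alpha\nu^*\alpha^*\gamma\end{pmatrix}:C^{q-1}\to C_q$, $\chi_{t,3}=-\theta+\beta^{-*}\kappa\beta^{-1}:C^{q-1}\to C_{q-1}$. The flip-isomorphism $t$ is a flip-isomorphism rel $\partial$ if $\theta,\nu,\kappa$ as above can be chosen so that there is a homotopy $(\Delta,\eta):(1,0)\simeq(h_t,\chi_t)$ of maps from $(C,\psi)$ to itself. For such choices write $\Delta=(R\ \ S):C_q=F\oplus F^*\to C_{q+1}=G$ and let $\eta_0:C^{q+1}=G^*\to C_{q+1}=G$ be the indicated component of $\eta$.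 The quadratic signature is the class $\rho^*(z,t,\nu,\theta,\kappa,\Delta,\eta)=[(M,\xi)]\in L_{2q+2}(\Lambda)$ of the (automatically non-singular) $(-\epsilon)$-quadratic form $$\xi=\begin{pmatrix}-\eta_0&\beta&0\\0&-\epsilon\theta^*&0\\R^*&\mu&0\end{pmatrix}:M=G^*\oplus G\oplus F\to M^* .$$ **Theorem.** Let $z'$ be a regular $\epsilon$-quadratic split preformation over $\Lambda$. Then $[z']\in l_{2q+2}(\Lambda)$ is elementary if and only if there are a regular $\epsilon$-quadratic split preformation $z$ with $[z]=[z']\in l_{2q+2}(\Lambda)$, a flip-isomorphism $t$ rel $\partial$ of $z$, and choices $\nu,\theta,\kappa,\Delta,\eta$ as above such that $$\rho^*(z,t,\nu,\theta,\kappa,\Delta,\eta)=0\in L_{2q+2}(\Lambda).$$ -/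

import Mathlib

open CategoryTheory

universe u

namespace AlgebraicSurgery

noncomputable section

section Duality

/-- The dual `M^* = Hom_Λ(M, Λ)` of a left `Λ`-module. -/
def Dual (Λ : Type u) [Ring Λ] (M : Type u) [AddCommGroup M] [Module Λ M] : Type u :=
  M →ₗ[Λ] Λ

variable {Λ : Type u} [Ring Λ]
variable {M N K : Type u} [AddCommGroup M] [Module Λ M] [AddCommGroup N] [Module Λ N]
  [AddCommGroup K] [Module Λ K]

instance : AddCommGroup (Dual Λ M) := inferInstanceAs (AddCommGroup (M →ₗ[Λ] Λ))

instance : FunLike (Dual Λ M) M Λ := inferInstanceAs (FunLike (M →ₗ[Λ] Λ) M Λ)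

instance : LinearMapClass (Dual Λ M) Λ M Λ :=
  inferInstanceAs (LinearMapClass (M →ₗ[Λ] Λ) Λ M Λ)

@[ext] theorem Dual.ext {φ ψ : Dual Λ M} (h : ∀ x, φ x = ψ x) : φ = ψ := LinearMap.ext h

@[simp] theorem Dual.add_apply (φ ψ : Dual Λ M) (x : M) : (φ + ψ) x = φ x + ψ x := rfl
@[simp] theorem Dual.sub_apply (φ ψ : Dual Λ M) (x : M) : (φ - ψ) x = φ x - ψ x := rfl
@[simp] theorem Dual.neg_apply (φ : Dual Λ M) (x : M) : (-φ) x = -φ x := rfl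
@[simp] theorem Dual.zero_apply (x : M) : (0 : Dual Λ M) x = 0 := rfl
@[simp] theorem Dual.units_smul_apply (e : ℤˣ) (φ : Dual Λ M) (x : M) : (e • φ) x = e • φ x := rfl

variable [StarRing Λ]

/-- The left module structure of the dual given by the involution: `(a • φ)(x) = φ(x) ā`. -/
instance : Module Λ (Dual Λ M) where
  smul a φ :=
    { toFun := fun x => φ x * star a
      map_add' := fun x y => by rw [map_add, add_mul]
      map_smul' := fun b x => by rw [map_smul, smul_eq_mul, smul_eq_mul, mul_assoc]; rfl }
  one_smul φ := Dual.ext fun x => show φ x * star 1 = φ x by simp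
  mul_smul a b φ := Dual.ext fun x =>
    show φ x * star (a * b) = φ x * star b * star a by simp [mul_assoc]
  smul_zero a := Dual.ext fun x => show (0 : Λ) * star a = 0 by simp
  smul_add a φ ψ := Dual.ext fun x =>
    show (φ x + ψ x) * star a = φ x * star a + ψ x * star a by rw [add_mul]
  add_smul a b φ := Dual.ext fun x =>
    show φ x * star (a + b) = φ x * star a + φ x * star b by rw [star_add, mul_add]
  zero_smul φ := Dual.ext fun x => show φ x * star (0 : Λ) = 0 by simp

@[simp] theorem Dual.smul_apply (a : Λ) (φ : Dual Λ M) (x : M) : (a • φ) x = φ x * star a := rfl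

/-- The dual map `f^* : N^* → M^*` of `f : M → N`. -/
def Dual.map (f : M →ₗ[Λ] N) : Dual Λ N →ₗ[Λ] Dual Λ M where
  toFun φ := LinearMap.comp (show N →ₗ[Λ] Λ from φ) f
  map_add' _ _ := rfl
  map_smul' _ _ := rfl

@[simp] theorem Dual.map_apply (f : M →ₗ[Λ] N) (φ : Dual Λ N) (x : M) :
    Dual.map f φ x = φ (f x) := rfl

/-- The canonical homomorphism `M → M^{**}`, `x ↦ (φ ↦ conjugate of φ(x))`. -/
def ev (M : Type u) [AddCommGroup M] [Module Λ M] : M →ₗ[Λ] Dual Λ (Dual Λ M) where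
  toFun x :=
    (show Dual Λ M →ₗ[Λ] Λ from
      { toFun := fun φ => star (φ x)
        map_add' := fun φ ψ => by simp
        map_smul' := fun a φ => by simp })
  map_add' x y := Dual.ext fun φ => show star (φ (x + y)) = star (φ x) + star (φ y) by simp
  map_smul' a x := Dual.ext fun φ => show star (φ (a • x)) = star (φ x) * star a by simp

@[simp] theorem ev_apply (x : M) (φ : Dual Λ M) : ev M x φ = star (φ x) := rfl

/-- The coordinates of the dual of a free module with respect to the dual basis. -/
def dualCoord {ι : Type*} (b : Module.Basis ι Λ M) : Dual Λ M ≃ₗ[Λ] (ι → Λ) where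
  toFun φ i := star (φ (b i))
  map_add' φ ψ := by ext i; simp
  map_smul' a φ := by ext i; simp
  invFun v := (show M →ₗ[Λ] Λ from b.constr ℤ fun i => star (v i))
  left_inv φ := by
    refine b.ext (f₁ := (_ : M →ₗ[Λ] Λ)) (f₂ := (φ : M →ₗ[Λ] Λ)) fun i => ?_
    rw [Module.Basis.constr_basis, star_star]; rfl
  right_inv v := by
    ext i
    change star ((b.constr ℤ fun i => star (v i)) (b i)) = v i
    rw [Module.Basis.constr_basis, star_star]

instance [Module.Free Λ M] [Module.Finite Λ M] : Module.Free Λ (Dual Λ M) :=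
  Module.Free.of_equiv (dualCoord (Module.Free.chooseBasis Λ M)).symm

instance [Module.Free Λ M] [Module.Finite Λ M] : Module.Finite Λ (Dual Λ M) :=
  Module.Finite.equiv (dualCoord (Module.Free.chooseBasis Λ M)).symm

theorem ev_bijective (M : Type u) [AddCommGroup M] [Module Λ M] [Module.Free Λ M]
    [Module.Finite Λ M] : Function.Bijective (ev (Λ := Λ) M) := by
  let b := Module.Free.chooseBasis Λ M
  let c : Module.Free.ChooseBasisIndex Λ M → Dual Λ M := fun i => (show M →ₗ[Λ] Λ from b.coord i)
  have hc : ∀ i x, c i x = b.repr x i := fun i x => rfl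
  constructor
  · intro x y h
    refine b.repr.injective (Finsupp.ext fun i => ?_)
    have := congrArg (fun Φ : Dual Λ (Dual Λ M) => Φ (c i)) h
    simpa [hc] using this
  · intro Φ
    refine ⟨∑ i, star (Φ (c i)) • b i, Dual.ext fun φ => ?_⟩
    have hφ : φ = ∑ i, star (φ (b i)) • c i := by
      refine b.ext (f₁ := (show M →ₗ[Λ] Λ from φ)) (f₂ := (show M →ₗ[Λ] Λ from _)) fun j => ?_
      have happ : ∀ (s : Finset (Module.Free.ChooseBasisIndex Λ M))
          (f : Module.Free.ChooseBasisIndex Λ M → Dual Λ M) (x : M),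
          (∑ i ∈ s, f i) x = ∑ i ∈ s, f i x := fun s f x => LinearMap.sum_apply s f x
      change φ (b j) = (∑ i, star (φ (b i)) • c i) (b j)
      rw [happ]
      simp [hc, Finsupp.single_apply]
    rw [ev_apply, map_sum, star_sum]
    conv_rhs => rw [hφ, map_sum]
    simp

/-- For f.g. free `M`, the canonical identification `M ≅ M^{**}`. -/
def evEquiv (M : Type u) [AddCommGroup M] [Module Λ M] [Module.Free Λ M] [Module.Finite Λ M] :
    M ≃ₗ[Λ] Dual Λ (Dual Λ M) :=
  LinearEquiv.ofBijective (ev M) (ev_bijective M)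

/-- The dual `φ^* : N → M^*` of `φ : M → N^*`, that is `φ^*(y)(x) = conjugate of φ(x)(y)`. -/
def transpose (φ : M →ₗ[Λ] Dual Λ N) : N →ₗ[Λ] Dual Λ M := Dual.map φ ∘ₗ ev N

@[simp] theorem transpose_apply (φ : M →ₗ[Λ] Dual Λ N) (y : N) (x : M) :
    transpose φ y x = star (φ x y) := rfl

/-- The dual `f^* : N^* → M` of `f : M^* → N`, where `M^{**}` is identified with `M`. -/
def cotranspose [Module.Free Λ M] [Module.Finite Λ M] (f : Dual Λ M →ₗ[Λ] N) :
    Dual Λ N →ₗ[Λ] M :=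
  (evEquiv M).symm.toLinearMap ∘ₗ Dual.map f

theorem apply_evEquiv_symm [Module.Free Λ M] [Module.Finite Λ M] (Φ : Dual Λ (Dual Λ M))
    (φ : Dual Λ M) : φ ((evEquiv M).symm Φ) = star (Φ φ) := by
  have h : ev M ((evEquiv M).symm Φ) = Φ := (evEquiv M).apply_symm_apply Φ
  rw [← h, ev_apply, star_star, h]

theorem apply_cotranspose [Module.Free Λ M] [Module.Finite Λ M] (f : Dual Λ M →ₗ[Λ] N)
    (ψ : Dual Λ N) (φ : Dual Λ M) : φ (cotranspose f ψ) = star (ψ (f φ)) :=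
  apply_evEquiv_symm (Dual.map f ψ) φ

theorem eq_of_dual_eq [Module.Free Λ M] [Module.Finite Λ M] {x y : M}
    (h : ∀ φ : Dual Λ M, φ x = φ y) : x = y :=
  (ev_bijective (Λ := Λ) M).1 (Dual.ext fun φ => congrArg star (h φ))

theorem star_units_smul (e : ℤˣ) (a : Λ) : star (e • a) = e • star a := by
  rcases Int.units_eq_one_or e with rfl | rfl <;> simp

theorem units_smul_smul {A : Type*} [AddCommGroup A] (e : ℤˣ) (a : A) : e • e • a = a := by
  rcases Int.units_eq_one_or e with rfl | rfl <;> simp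

theorem map_units_smul {A B X : Type*} [AddCommGroup A] [AddCommGroup B] [FunLike X A B]
    [AddMonoidHomClass X A B] (f : X) (e : ℤˣ) (a : A) : f (e • a) = e • f a := by
  rcases Int.units_eq_one_or e with rfl | rfl <;> simp

end Duality

section Forms

variable (Λ : Type u) [Ring Λ] [StarRing Λ]

/-- A finitely generated free left `Λ`-module. -/
structure FreeModule where
  carrier : Type u
  [addCommGroup : AddCommGroup carrier]
  [module : Module Λ carrier]
  [free : Module.Free Λ carrier]
  [finite : Module.Finite Λ carrier]

attribute [instance] FreeModule.addCommGroup FreeModule.module FreeModule.free FreeModule.finite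

instance : CoeSort (FreeModule Λ) (Type u) := ⟨FreeModule.carrier⟩

variable {Λ}
variable {M N K : Type u} [AddCommGroup M] [Module Λ M] [AddCommGroup N] [Module Λ N]
  [AddCommGroup K] [Module Λ K]

/-- The `ε`-duality involution `T_ε φ = ε φ^*` on `Hom_Λ(M, M^*)`. -/
def dualityInvolution (ε : ℤˣ) :
    (M →ₗ[Λ] Dual Λ M) →+ (M →ₗ[Λ] Dual Λ M) where
  toFun φ := ε • transpose φ
  map_zero' := by ext x y; simp
  map_add' φ ψ := by ext x y; simp

@[simp] theorem dualityInvolution_apply (ε : ℤˣ) (φ : M →ₗ[Λ] Dual Λ M) :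
    dualityInvolution ε φ = ε • transpose φ := rfl

variable (Λ M) in
/-- The image of `1 - T_ε` on `Hom_Λ(M, M^*)`. -/
def qRelations (ε : ℤˣ) : AddSubgroup (M →ₗ[Λ] Dual Λ M) :=
  (AddMonoidHom.id (M →ₗ[Λ] Dual Λ M) - dualityInvolution ε).range

variable (Λ M) in
/-- The group `Q_ε(M) = coker (1 - T_ε)`. -/
abbrev QGroup (ε : ℤˣ) : Type u := (M →ₗ[Λ] Dual Λ M) ⧸ qRelations Λ M ε

namespace QGroup

/-- The class in `Q_ε(M)` of a homomorphism `M → M^*`. -/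
def mk (ε : ℤˣ) : (M →ₗ[Λ] Dual Λ M) →+ QGroup Λ M ε := QuotientAddGroup.mk' (qRelations Λ M ε)

/-- The symmetrization `1 + T_ε : Q_ε(M) → Hom_Λ(M, M^*)`. -/
def symm {ε : ℤˣ} : QGroup Λ M ε →+ (M →ₗ[Λ] Dual Λ M) :=
  QuotientAddGroup.lift (qRelations Λ M ε) (AddMonoidHom.id (M →ₗ[Λ] Dual Λ M) + dualityInvolution ε) <| by
    rintro _ ⟨φ, rfl⟩
    ext x y
    rcases Int.units_eq_one_or ε with rfl | rfl <;> simp <;> abel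

theorem symm_mk (ε : ℤˣ) (φ : M →ₗ[Λ] Dual Λ M) : symm (mk ε φ) = φ + ε • transpose φ := rfl

/-- The homomorphism `Q_ε(N) → Q_ε(M)`, `[φ] ↦ [f^* φ f]`, of a linear map `f : M → N`. -/
def pullback {ε : ℤˣ} (f : M →ₗ[Λ] N) : QGroup Λ N ε →+ QGroup Λ M ε :=
  QuotientAddGroup.map (qRelations Λ N ε) (qRelations Λ M ε)
    { toFun := fun φ => Dual.map f ∘ₗ φ ∘ₗ f
      map_zero' := by ext x y; simp
      map_add' := fun φ ψ => by ext x y; simp } <| by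
    rintro _ ⟨φ, rfl⟩
    refine ⟨Dual.map f ∘ₗ φ ∘ₗ f, ?_⟩
    ext x y
    simp

theorem pullback_mk {ε : ℤˣ} (f : M →ₗ[Λ] N) (φ : N →ₗ[Λ] Dual Λ N) :
    pullback f (mk ε φ) = mk ε (Dual.map f ∘ₗ φ ∘ₗ f) := rfl

theorem symm_pullback {ε : ℤˣ} (f : M →ₗ[Λ] N) (ψ : QGroup Λ N ε) :
    symm (pullback f ψ) = Dual.map f ∘ₗ symm ψ ∘ₗ f := by
  obtain ⟨φ, rfl⟩ := QuotientAddGroup.mk_surjective ψ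
  change symm (mk ε (Dual.map f ∘ₗ φ ∘ₗ f)) = Dual.map f ∘ₗ symm (mk ε φ) ∘ₗ f
  ext x y
  simp [symm_mk]

end QGroup

variable (Λ) in
/-- An `ε`-quadratic form `(M, ψ ∈ Q_ε(M))` on a f.g. free `Λ`-module. -/
structure QuadForm (ε : ℤˣ) where
  M : FreeModule Λ
  ψ : QGroup Λ M ε

namespace QuadForm

variable {ε : ℤˣ}

/-- A form is non-singular if its symmetrization `(1 + T_ε) ψ : M → M^*` is an isomorphism. -/
def NonSingular (A : QuadForm Λ ε) : Prop := Function.Bijective (QGroup.symm A.ψ)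

/-- Isometry of quadratic forms. -/
def Isometric (A B : QuadForm Λ ε) : Prop :=
  ∃ f : A.M ≃ₗ[Λ] B.M, QGroup.pullback f.toLinearMap B.ψ = A.ψ

/-- The orthogonal sum of two forms. -/
def sum (A B : QuadForm Λ ε) : QuadForm Λ ε where
  M := ⟨A.M × B.M⟩
  ψ := QGroup.pullback (LinearMap.fst Λ A.M B.M) A.ψ + QGroup.pullback (LinearMap.snd Λ A.M B.M) B.ψ

variable (ε) in
/-- The hyperbolic form `H_ε(L)` on `L ⊕ L^*` with matrix `(0 1; 0 0)`, that is
`ψ(x, f)(y, g) = f(y)`. -/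
def hyperbolic (L : FreeModule Λ) : QuadForm Λ ε where
  M := ⟨L × Dual Λ L⟩
  ψ := QGroup.mk ε (Dual.map (LinearMap.fst Λ L (Dual Λ L)) ∘ₗ LinearMap.snd Λ L (Dual Λ L))

variable (Λ ε) in
/-- The zero form on the zero module. -/
def zero : QuadForm Λ ε where
  M := ⟨PUnit⟩
  ψ := 0

theorem nonSingular_zero : (zero Λ ε).NonSingular := by
  constructor
  · intro x y _
    exact Subsingleton.elim (α := PUnit) x y
  · intro φ
    refine ⟨(PUnit.unit : PUnit), Dual.ext fun x => ?_⟩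
    have hx : x = 0 := Subsingleton.elim (α := PUnit) x 0
    rw [hx, map_zero, map_zero]

end QuadForm

variable (Λ) in
/-- The even-dimensional quadratic `L`-group: for `ε = (-1)^k` this is `L_{2k}(Λ)`, the set of
non-singular `ε`-quadratic forms on f.g. free `Λ`-modules, where two forms are identified
if they become isometric after the addition of hyperbolic forms. -/
def LGroup (ε : ℤˣ) : Type (u + 1) :=
  Quot fun A B : {A : QuadForm Λ ε // A.NonSingular} =>
    ∃ L L' : FreeModule Λ,
      (A.1.sum (QuadForm.hyperbolic ε L)).Isometric (B.1.sum (QuadForm.hyperbolic ε L'))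

/-- The class of a non-singular form in the `L`-group. -/
def LGroup.mk {ε : ℤˣ} (A : QuadForm Λ ε) (h : A.NonSingular) : LGroup Λ ε := Quot.mk _ ⟨A, h⟩

/-- The zero of the `L`-group is the class of the zero form. -/
instance (ε : ℤˣ) : Zero (LGroup Λ ε) := ⟨LGroup.mk (QuadForm.zero Λ ε) QuadForm.nonSingular_zero⟩

end Forms

section Preformations

variable (Λ : Type u) [Ring Λ] [StarRing Λ]

/-- A regular `ε`-quadratic split preformation `(F ←γ- G -μ→ F^*, θ)`: f.g. free modules `F`, `G`,
maps `γ`, `μ` and a class `θ ∈ Q_{-ε}(G)` which refines the `(-ε)`-symmetric form `γ^* μ` on `G`. -/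
structure SplitPreformation (ε : ℤˣ) where
  F : FreeModule Λ
  G : FreeModule Λ
  γ : G →ₗ[Λ] F
  μ : G →ₗ[Λ] Dual Λ F
  θ : QGroup Λ G (-ε)
  symm_θ : QGroup.symm θ = Dual.map γ ∘ₗ μ

variable {Λ} {ε : ℤˣ}

namespace SplitPreformation

/-- The sum of two preformations; `(F ⊕ F')^*` is identified with `F^* ⊕ F'^*`. -/
def sum (x y : SplitPreformation Λ ε) : SplitPreformation Λ ε where
  F := ⟨x.F × y.F⟩
  G := ⟨x.G × y.G⟩
  γ := x.γ.prodMap y.γ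
  μ := Dual.map (LinearMap.fst Λ x.F y.F) ∘ₗ x.μ ∘ₗ LinearMap.fst Λ x.G y.G +
    Dual.map (LinearMap.snd Λ x.F y.F) ∘ₗ y.μ ∘ₗ LinearMap.snd Λ x.G y.G
  θ := QGroup.pullback (LinearMap.fst Λ x.G y.G) x.θ + QGroup.pullback (LinearMap.snd Λ x.G y.G) y.θ
  symm_θ := by
    have hx := fun a b => congrArg (fun φ : Dual Λ x.G => φ b) (LinearMap.congr_fun x.symm_θ a)
    have hy := fun a b => congrArg (fun φ : Dual Λ y.G => φ b) (LinearMap.congr_fun y.symm_θ a)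
    simp only [LinearMap.comp_apply, Dual.map_apply] at hx hy
    rw [map_add, QGroup.symm_pullback, QGroup.symm_pullback]
    refine LinearMap.ext fun a => Dual.ext fun b => ?_
    simp [hx, hy]

/-- The boundary `(K ←1- K -(1+T_{-ε})θ→ K^*, θ)` of a `(-ε)`-quadratic form `(K, θ)`. -/
def boundary (A : QuadForm Λ (-ε)) : SplitPreformation Λ ε where
  F := A.M
  G := A.M
  γ := LinearMap.id
  μ := QGroup.symm A.ψ
  θ := A.ψ
  symm_θ := rfl

/-- A strong isomorphism: isomorphisms `α : F ≅ F'`, `β : G ≅ G'` with `α γ = γ' β`,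
`α^{-*} μ = μ' β` and `θ = β^* θ' β`. -/
structure StrongIso (x y : SplitPreformation Λ ε) where
  α : x.F ≃ₗ[Λ] y.F
  β : x.G ≃ₗ[Λ] y.G
  comm_γ : α.toLinearMap ∘ₗ x.γ = y.γ ∘ₗ β.toLinearMap
  comm_μ : Dual.map α.symm.toLinearMap ∘ₗ x.μ = y.μ ∘ₗ β.toLinearMap
  comm_θ : x.θ = QGroup.pullback β.toLinearMap y.θ

/-- Stable strong isomorphism: strong isomorphism after the addition of boundaries of
hyperbolic forms. -/
def StablyStronglyIso (x y : SplitPreformation Λ ε) : Prop :=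
  ∃ L L' : FreeModule Λ,
    Nonempty (StrongIso (x.sum (boundary (QuadForm.hyperbolic (-ε) L)))
      (y.sum (boundary (QuadForm.hyperbolic (-ε) L'))))

/-- A preformation is elementary if it has an `h`-lagrangian, i.e. a f.g. free submodule
`j : U ↪ G` such that `j^* γ^* μ j = 0` and `θ` vanishes on `U`, such that `γ j` and `μ j` are
injective with images `U₀` and `U₁` that are direct summands of `F` and `F^*`, and such that
restriction to `U₀` induces an isomorphism `F^* / U₁ ≅ U₀^*`. -/
def Elementary (z : SplitPreformation Λ ε) : Prop :=
  ∃ U : Submodule Λ z.G, Module.Free Λ U ∧ Module.Finite Λ U ∧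
    Dual.map U.subtype ∘ₗ Dual.map z.γ ∘ₗ z.μ ∘ₗ U.subtype = 0 ∧
    QGroup.pullback U.subtype z.θ = 0 ∧
    Function.Injective (z.γ ∘ₗ U.subtype) ∧
    Function.Injective (z.μ ∘ₗ U.subtype) ∧
    IsComplemented (LinearMap.range (z.γ ∘ₗ U.subtype)) ∧
    IsComplemented (LinearMap.range (z.μ ∘ₗ U.subtype)) ∧
    ∃ e : (Dual Λ z.F ⧸ LinearMap.range (z.μ ∘ₗ U.subtype)) ≃ₗ[Λ]
        Dual Λ (LinearMap.range (z.γ ∘ₗ U.subtype)),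
      ∀ f : Dual Λ z.F, e (Submodule.Quotient.mk f) =
        Dual.map (LinearMap.range (z.γ ∘ₗ U.subtype)).subtype f

/-- A flip-isomorphism `(α, β, ν)` of `z`: a weak isomorphism of `z` with its flip
`(F^* ←εμ- G -γ→ F, -θ)`. The equations are
`α γ + α (ν - ε ν^*)^* μ = ε μ β`, `α^{-*} μ = γ β` and `θ + μ^* ν μ + β^* θ β = 0 ∈ Q_{-ε}(G)`. -/
structure FlipIso (z : SplitPreformation Λ ε) where
  α : z.F ≃ₗ[Λ] Dual Λ z.F
  β : z.G ≃ₗ[Λ] z.G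
  ν : QGroup Λ (Dual Λ z.F) (-ε)
  comm_γ : α.toLinearMap ∘ₗ z.γ +
      α.toLinearMap ∘ₗ (evEquiv z.F).symm.toLinearMap ∘ₗ transpose (QGroup.symm ν) ∘ₗ z.μ =
    ε • (z.μ ∘ₗ β.toLinearMap)
  comm_μ : cotranspose α.symm.toLinearMap ∘ₗ z.μ = z.γ ∘ₗ β.toLinearMap
  comm_θ : z.θ + QGroup.pullback z.μ ν + QGroup.pullback β.toLinearMap z.θ = 0

end SplitPreformation

variable (Λ ε) in
/-- The set of stable strong isomorphism classes of regular `ε`-quadratic split preformations;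
for `ε = (-1)^q` this is `l_{2q+2}(Λ)`. -/
def LMonoid : Type (u + 1) := Quot (SplitPreformation.StablyStronglyIso (Λ := Λ) (ε := ε))

/-- The class `[z]` of a preformation. -/
def LMonoid.mk (z : SplitPreformation Λ ε) : LMonoid Λ ε := Quot.mk _ z

/-- A class is elementary if it has an elementary representative. -/
def LMonoid.Elementary (c : LMonoid Λ ε) : Prop :=
  ∃ z : SplitPreformation Λ ε, LMonoid.mk z = c ∧ z.Elementary

end Preformations

section Complexes

variable {Λ : Type u} [Ring Λ] [StarRing Λ]

/-- An index of a component `ψ_s : C^p → C_r` of an element of `W_%(C)_n`, so `p = n - r - s`. -/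
structure WIndex (n : ℤ) where
  s : ℕ
  p : ℤ
  r : ℤ
  h : p + r + s = n

theorem WIndex.next {n m : ℤ} (hnm : m + 1 = n) (t : WIndex m) :
    t.p + t.r + ((t.s + 1 : ℕ) : ℤ) = n := by
  have := t.h
  omega

/-- The group `W_%(C)_n` of families `{ψ_s : C^{n-r-s} → C_r | r ∈ ℤ, s ≥ 0}`. -/
def W (C : ChainComplex (ModuleCat.{u} Λ) ℤ) (n : ℤ) : Type u :=
  ∀ t : WIndex n, Dual Λ (C.X t.p) →ₗ[Λ] C.X t.r

namespace W

variable {C D : ChainComplex (ModuleCat.{u} Λ) ℤ}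

instance (n : ℤ) : AddCommGroup (W C n) :=
  inferInstanceAs (AddCommGroup (∀ t : WIndex n, Dual Λ (C.X t.p) →ₗ[Λ] C.X t.r))

variable [∀ r, Module.Free Λ (C.X r)] [∀ r, Module.Finite Λ (C.X r)]

/-- The component `T ψ_s : C^p → C_r` with `T ψ_s = (-1)^{pr} ψ_s^*`. -/
def T {n : ℤ} (ψ : W C n) (t : WIndex n) : Dual Λ (C.X t.p) →ₗ[Λ] C.X t.r :=
  (t.p * t.r).negOnePow • cotranspose (ψ ⟨t.s, t.r, t.p, by have := t.h; omega⟩)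

/-- The differential `d_% : W_%(C)_n → W_%(C)_{n-1}`,
`(dψ)_s = d ψ_s + (-1)^r ψ_s d^* + (-1)^{n-s-1} (ψ_{s+1} + (-1)^{s+1} T ψ_{s+1})`. -/
def d (n m : ℤ) (hnm : m + 1 = n) (ψ : W C n) : W C m := fun t =>
  (C.d (t.r + 1) t.r).hom ∘ₗ ψ ⟨t.s, t.p, t.r + 1, by have := t.h; omega⟩ +
    t.r.negOnePow • (ψ ⟨t.s, t.p + 1, t.r, by have := t.h; omega⟩ ∘ₗ
      Dual.map (C.d (t.p + 1) t.p).hom) +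
    (n - t.s - 1).negOnePow • (ψ ⟨t.s + 1, t.p, t.r, t.next hnm⟩ +
      ((t.s : ℤ) + 1).negOnePow • T ψ ⟨t.s + 1, t.p, t.r, t.next hnm⟩)

/-- For a chain homotopy `Δ : f ≃ f' : C → D` (so `f' - f = d Δ + Δ d`) and `ψ ∈ W_%(C)_n`, the
element `Δ_% ψ ∈ W_%(D)_{n+1}` with
`(Δ_% ψ)_s = -Δ ψ_s f^* + (-1)^{r+1} (f' ψ_s + (-1)^n Δ T ψ_{s+1}) Δ^*`. -/
def homotopyOp {f f' : C ⟶ D} (Δ : Homotopy f' f) (n m : ℤ) (hnm : n + 1 = m) (ψ : W C n) :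
    W D m := fun t =>
  -((Δ.hom (t.r - 1) t.r).hom ∘ₗ ψ ⟨t.s, t.p, t.r - 1, by have := t.h; omega⟩ ∘ₗ
      Dual.map (f.f t.p).hom) +
    (t.r + 1).negOnePow •
      (((f'.f t.r).hom ∘ₗ ψ ⟨t.s, t.p - 1, t.r, by have := t.h; omega⟩ +
        n.negOnePow • ((Δ.hom (t.r - 1) t.r).hom ∘ₗ
          T ψ ⟨t.s + 1, t.p - 1, t.r - 1, by have := t.h; omega⟩)) ∘ₗ
        Dual.map (Δ.hom (t.p - 1) t.p).hom)

theorem d_apply {n m : ℤ} (hnm : m + 1 = n) (ψ : W C n) {s : ℕ} {p r p' r' : ℤ}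
    (h : p + r + s = m) (hp : p + 1 = p') (hr : r + 1 = r') :
    d n m hnm ψ ⟨s, p, r, h⟩ =
      (C.d r' r).hom ∘ₗ ψ ⟨s, p, r', by omega⟩ +
        r.negOnePow • (ψ ⟨s, p', r, by omega⟩ ∘ₗ Dual.map (C.d p' p).hom) +
        (n - s - 1).negOnePow • (ψ ⟨s + 1, p, r, by omega⟩ + ((s : ℤ) + 1).negOnePow •
          (p * r).negOnePow • cotranspose (ψ ⟨s + 1, r, p, by omega⟩)) := by
  subst hp hr
  rfl

theorem homotopyOp_apply {f f' : C ⟶ D} (Δ : Homotopy f' f) {n m : ℤ} (hnm : n + 1 = m)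
    (ψ : W C n) {s : ℕ} {p r p' r' : ℤ} (h : p + r + s = m) (hp : p - 1 = p') (hr : r - 1 = r') :
    homotopyOp Δ n m hnm ψ ⟨s, p, r, h⟩ =
      -((Δ.hom r' r).hom ∘ₗ ψ ⟨s, p, r', by omega⟩ ∘ₗ Dual.map (f.f p).hom) +
        (r + 1).negOnePow • (((f'.f r).hom ∘ₗ ψ ⟨s, p', r, by omega⟩ +
          n.negOnePow • ((Δ.hom r' r).hom ∘ₗ
            ((p' * r').negOnePow • cotranspose (ψ ⟨s + 1, r', p', by omega⟩)))) ∘ₗ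
          Dual.map (Δ.hom p' p).hom) := by
  subst hp hr
  rfl

end W

/-- A homotopy `(Δ, η) : (f, χ) ≃ (f', χ') : (C, ψ) → (D, ψ')` of morphisms of `n`-dimensional
quadratic complexes: a chain homotopy `Δ : f ≃ f'` and `η ∈ W_%(D)_{n+2}` such that
`χ' - χ = Δ_% ψ + dη ∈ W_%(D)_{n+1}`. -/
structure QuadraticHomotopy {C D : ChainComplex (ModuleCat.{u} Λ) ℤ}
    [∀ r, Module.Free Λ (C.X r)] [∀ r, Module.Finite Λ (C.X r)]
    [∀ r, Module.Free Λ (D.X r)] [∀ r, Module.Finite Λ (D.X r)]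
    (n : ℤ) (ψ : W C n) (f : C ⟶ D) (χ : W D (n + 1)) (f' : C ⟶ D) (χ' : W D (n + 1)) where
  Δ : Homotopy f' f
  η : W D (n + 2)
  eq : χ' - χ = W.homotopyOp Δ n (n + 1) rfl ψ + W.d (n + 2) (n + 1) (by omega) η

theorem QuadraticHomotopy.eq_apply {C : ChainComplex (ModuleCat.{u} Λ) ℤ}
    [∀ r, Module.Free Λ (C.X r)] [∀ r, Module.Finite Λ (C.X r)]
    {n : ℤ} {ψ : W C n} {f : C ⟶ C} {χ : W C (n + 1)} (H : QuadraticHomotopy n ψ (𝟙 C) 0 f χ)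
    {p r p' r' p'' r'' : ℤ} (h : p + r + (0 : ℕ) = n + 1)
    (hp : p - 1 = p') (hr : r - 1 = r') (hp' : p + 1 = p'') (hr' : r + 1 = r'')
    {e : ℤˣ} (hχ : χ ⟨0, p, r, h⟩ = 0) (he : r.negOnePow = e) (hn : Even n)
    (h1 : (p * r).negOnePow = 1) (h2 : (p' * r').negOnePow = 1) :
    0 = (-((H.Δ.hom r' r).hom ∘ₗ ψ ⟨0, p, r', by omega⟩) +
        (-e) • (((f.f r).hom ∘ₗ ψ ⟨0, p', r, by omega⟩ +
          (H.Δ.hom r' r).hom ∘ₗ cotranspose (ψ ⟨1, r', p', by omega⟩)) ∘ₗ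
          Dual.map (H.Δ.hom p' p).hom)) +
      ((C.d r'' r).hom ∘ₗ H.η ⟨0, p, r'', by omega⟩ +
        e • (H.η ⟨0, p'', r, by omega⟩ ∘ₗ Dual.map (C.d p'' p).hom) -
        (H.η ⟨1, p, r, by omega⟩ - cotranspose (H.η ⟨1, r, p, by omega⟩))) := by
  have k := (congrFun H.eq ⟨0, p, r, h⟩).trans (congrArg₂ (· + ·)
    (W.homotopyOp_apply H.Δ rfl ψ h hp hr) (W.d_apply _ H.η h hp' hr'))
  have k0 : (χ - 0) ⟨0, p, r, h⟩ = 0 := by rw [sub_zero, hχ]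
  have e1 : (n + 2 - (0 : ℕ) - 1).negOnePow = -1 := by
    obtain ⟨m, rfl⟩ := hn
    exact Int.negOnePow_odd _ ⟨m, by push_cast; ring⟩
  have e2 : (((0 : ℕ) : ℤ) + 1).negOnePow = -1 := Int.negOnePow_odd _ ⟨0, by simp⟩
  rw [k0, Int.negOnePow_succ, he, Int.negOnePow_even n hn, h1, h2, e1, e2] at k
  refine k.trans ?_
  simp only [one_smul, Units.neg_smul, ← sub_eq_add_neg]
  rfl

theorem QuadraticHomotopy.eq_apply_left {C : ChainComplex (ModuleCat.{u} Λ) ℤ}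
    [∀ r, Module.Free Λ (C.X r)] [∀ r, Module.Finite Λ (C.X r)]
    {n : ℤ} {ψ : W C n} {f : C ⟶ C} {χ : W C (n + 1)} (H : QuadraticHomotopy n ψ (𝟙 C) 0 f χ)
    {p r p' r' p'' r'' : ℤ} (h : p + r + (0 : ℕ) = n + 1)
    (hp : p - 1 = p') (hr : r - 1 = r') (hp' : p + 1 = p'') (hr' : r + 1 = r'')
    {e : ℤˣ} (hχ : χ ⟨0, p, r, h⟩ = 0) (he : r.negOnePow = -e) (hn : Even n)
    (h1 : (p * r).negOnePow = 1) (h2 : (p' * r').negOnePow = 1) (hd : ∀ x, (C.d r'' r).hom x = 0) :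
    0 = -((H.Δ.hom r' r).hom ∘ₗ ψ ⟨0, p, r', by omega⟩) +
        e • (((f.f r).hom ∘ₗ ψ ⟨0, p', r, by omega⟩ +
          (H.Δ.hom r' r).hom ∘ₗ cotranspose (ψ ⟨1, r', p', by omega⟩)) ∘ₗ
          Dual.map (H.Δ.hom p' p).hom) +
      ((-e) • (H.η ⟨0, p'', r, by omega⟩ ∘ₗ Dual.map (C.d p'' p).hom) -
        (H.η ⟨1, p, r, by omega⟩ - cotranspose (H.η ⟨1, r, p, by omega⟩))) := by
  have k := H.eq_apply h hp hr hp' hr' hχ he hn h1 h2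
  rw [(LinearMap.ext hd : (C.d r'' r).hom = 0), LinearMap.zero_comp, zero_add, neg_neg] at k
  exact k

theorem QuadraticHomotopy.eq_apply_right {C : ChainComplex (ModuleCat.{u} Λ) ℤ}
    [∀ r, Module.Free Λ (C.X r)] [∀ r, Module.Finite Λ (C.X r)]
    {n : ℤ} {ψ : W C n} {f : C ⟶ C} {χ : W C (n + 1)} (H : QuadraticHomotopy n ψ (𝟙 C) 0 f χ)
    {p r p' r' p'' r'' : ℤ} (h : p + r + (0 : ℕ) = n + 1)
    (hp : p - 1 = p') (hr : r - 1 = r') (hp' : p + 1 = p'') (hr' : r + 1 = r'')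
    {e : ℤˣ} (hχ : χ ⟨0, p, r, h⟩ = 0) (he : r.negOnePow = e) (hn : Even n)
    (h1 : (p * r).negOnePow = 1) (h2 : (p' * r').negOnePow = 1) (hd : ∀ x, (C.d p'' p).hom x = 0) :
    0 = -((H.Δ.hom r' r).hom ∘ₗ ψ ⟨0, p, r', by omega⟩) +
        (-e) • (((f.f r).hom ∘ₗ ψ ⟨0, p', r, by omega⟩ +
          (H.Δ.hom r' r).hom ∘ₗ cotranspose (ψ ⟨1, r', p', by omega⟩)) ∘ₗ
          Dual.map (H.Δ.hom p' p).hom) +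
      ((C.d r'' r).hom ∘ₗ H.η ⟨0, p, r'', by omega⟩ -
        (H.η ⟨1, p, r, by omega⟩ - cotranspose (H.η ⟨1, r, p, by omega⟩))) := by
  have k := H.eq_apply h hp hr hp' hr' hχ he hn h1 h2
  rw [(LinearMap.ext hd : (C.d p'' p).hom = 0),
    show Dual.map (0 : C.X p'' →ₗ[Λ] C.X p) = 0 from LinearMap.ext fun φ => Dual.ext fun x => map_zero φ,
    LinearMap.comp_zero, smul_zero, add_zero] at k
  exact k

end Complexes

section Translation

variable {Λ : Type u} [Ring Λ] [StarRing Λ]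

/-- The sign `ε = (-1)^q`. -/
def sgn (q : ℕ) : ℤˣ := (-1) ^ q

/-- The degrees `q + 1`, `q`, `q - 1` in which the complex of a preformation lives, and the
remaining degrees. -/
inductive Deg
  | upper
  | middle
  | lower
  | other

/-- The position of the degree `r` relative to `q`. -/
def deg (q : ℕ) (r : ℤ) : Deg :=
  if r = q + 1 then .upper else if r = q then .middle else if r = q - 1 then .lower else .other

theorem deg_upper (q : ℕ) : deg q (q + 1) = .upper := if_pos rfl

theorem deg_middle (q : ℕ) : deg q q = .middle := by simp [deg]

namespace SplitPreformation

variable {q : ℕ} (z : SplitPreformation Λ (sgn q))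

/-- `C_{q+1} = G`, `C_q = F ⊕ F^*`, `C_{q-1} = G^*`, and `C_r = 0` for all other `r`. -/
def term : Deg → ModuleCat.{u} Λ
  | .upper => ModuleCat.of Λ z.G
  | .middle => ModuleCat.of Λ (z.F × Dual Λ z.F)
  | .lower => ModuleCat.of Λ (Dual Λ z.G)
  | .other => ModuleCat.of Λ PUnit.{u + 1}

instance (i : Deg) : Module.Free Λ (z.term i) := by
  cases i
  · exact inferInstanceAs (Module.Free Λ z.G)
  · exact inferInstanceAs (Module.Free Λ (z.F × Dual Λ z.F))
  · exact inferInstanceAs (Module.Free Λ (Dual Λ z.G))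
  · exact inferInstanceAs (Module.Free Λ PUnit.{u + 1})

instance (i : Deg) : Module.Finite Λ (z.term i) := by
  cases i
  · exact inferInstanceAs (Module.Finite Λ z.G)
  · exact inferInstanceAs (Module.Finite Λ (z.F × Dual Λ z.F))
  · exact inferInstanceAs (Module.Finite Λ (Dual Λ z.G))
  · exact inferInstanceAs (Module.Finite Λ PUnit.{u + 1})

/-- The differentials `(-εγ, -εμ) : G → F ⊕ F^*` and `(μ^*, εγ^*) : F ⊕ F^* → G^*`. -/
def diff : ∀ i j : Deg, z.term i →ₗ[Λ] z.term j
  | .upper, .middle => (-sgn q) • z.γ.prod z.μ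
  | .middle, .lower => (transpose z.μ).coprod (sgn q • Dual.map z.γ)
  | _, _ => 0

theorem μ_apply_γ (a b : z.G) : z.μ a (z.γ b) = -sgn q • star (z.μ b (z.γ a)) := by
  obtain ⟨θ, hθ⟩ := QuotientAddGroup.mk_surjective z.θ
  have h : ∀ a b, z.μ a (z.γ b) = θ a b + (-sgn q) • star (θ b a) := fun a b => by
    have h1 := congrArg (fun φ : Dual Λ z.G => φ b) (LinearMap.congr_fun z.symm_θ a)
    rw [← hθ] at h1
    exact h1.symm
  rw [h a b, h b a, star_add, star_units_smul, star_star, smul_add, units_smul_smul, add_comm]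

theorem diff_comp (i j k : Deg) : z.diff j k ∘ₗ z.diff i j = 0 := by
  cases i <;> cases j <;> cases k <;> first | exact LinearMap.comp_zero _ | exact LinearMap.zero_comp _ | skip
  refine LinearMap.ext fun (a : z.G) => Dual.ext fun (b : z.G) => ?_
  change star (z.μ b ((-sgn q) • z.γ a)) + sgn q • ((-sgn q) • z.μ a : Dual Λ z.F) (z.γ b) = 0
  have h := z.μ_apply_γ b a
  rw [map_units_smul, star_units_smul, Dual.units_smul_apply, z.μ_apply_γ b a, star_units_smul,
    star_star, units_smul_smul, ← smul_assoc]
  simp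

theorem diff_eq_zero {r r' : ℤ} (h : ¬ r' + 1 = r) : z.diff (deg q r) (deg q r') = 0 := by
  have key : ∀ i j : Deg, ¬ (i = .upper ∧ j = .middle) → ¬ (i = .middle ∧ j = .lower) →
      z.diff i j = 0 := by
    intro i j h1 h2
    cases i <;> cases j <;> first | rfl | exact absurd ⟨rfl, rfl⟩ h1 | exact absurd ⟨rfl, rfl⟩ h2
  apply key <;> rintro ⟨h1, h2⟩ <;> unfold deg at h1 h2 <;> split_ifs at h1 h2 <;> omega

/-- The chain complex `C` of the `2q`-dimensional quadratic Poincaré complex `(C, ψ)`, the boundary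
of the `(2q+1)`-dimensional quadratic complex `(N, ζ)` with `d = μ^* : N_{q+1} = F → N_q = G^*`,
`ζ_0 = γ : N^q → N_{q+1}` and `ζ_1 = εθ : N^q → N_q`. -/
def complex : ChainComplex (ModuleCat.{u} Λ) ℤ where
  X r := z.term (deg q r)
  d r r' := ModuleCat.ofHom (z.diff (deg q r) (deg q r'))
  shape _ _ h := ModuleCat.hom_ext (z.diff_eq_zero h)
  d_comp_d' _ _ _ _ _ := ModuleCat.hom_ext (z.diff_comp _ _ _)

instance (r : ℤ) : Module.Free Λ (z.complex.X r) :=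
  inferInstanceAs (Module.Free Λ (z.term (deg q r)))

instance (r : ℤ) : Module.Finite Λ (z.complex.X r) :=
  inferInstanceAs (Module.Finite Λ (z.term (deg q r)))

/-- The components of `ψ`, for a representative `θ : G → G^*` of the quadratic refinement:
`ψ_0 = 1 : C^{q-1} = G → C_{q+1} = G`, `ψ_0 = (0 0; 1 0) : C^q = F^* ⊕ F → C_q = F ⊕ F^*`,
`ψ_1 = (εγ^* 0) : C^q → C_{q-1} = G^*` and `ψ_2 = -εθ^* : C^{q-1} → C_{q-1}`. -/
def psiTerm (θ : z.G →ₗ[Λ] Dual Λ z.G) :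
    ∀ (_ : ℕ) (p r : Deg), Dual Λ (z.term p) →ₗ[Λ] z.term r
  | 0, .lower, .upper => (evEquiv z.G).symm.toLinearMap
  | 0, .middle, .middle =>
      LinearMap.inr Λ z.F (Dual Λ z.F) ∘ₗ Dual.map (LinearMap.inl Λ z.F (Dual Λ z.F))
  | 1, .middle, .lower =>
      sgn q • (Dual.map z.γ ∘ₗ Dual.map (LinearMap.inl Λ z.F (Dual Λ z.F)))
  | 2, .lower, .lower => (-sgn q) • (transpose θ ∘ₗ (evEquiv z.G).symm.toLinearMap)
  | _, _, _ => 0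

/-- The quadratic structure `ψ ∈ W_%(C)_{2q}`. -/
def psi (θ : z.G →ₗ[Λ] Dual Λ z.G) : W z.complex (2 * q) := fun t =>
  z.psiTerm θ t.s (deg q t.p) (deg q t.r)

variable {z}

namespace FlipIso

variable (t : FlipIso z)

/-- `α^{-*} : F^* → F`. -/
def αInvDual : Dual Λ z.F →ₗ[Λ] z.F := cotranspose t.α.symm.toLinearMap

/-- The components of `h_t`: `β` on `G`, the matrix `(0 α^{-*}; εα εα(ν^* - εν))` on `F ⊕ F^*`, and
`β^{-*}` on `G^*`, for a representative `ν : F^* → F`. -/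
def hTerm (ν : Dual Λ z.F →ₗ[Λ] z.F) : ∀ i : Deg, z.term i →ₗ[Λ] z.term i
  | .upper => t.β.toLinearMap
  | .middle =>
      (LinearMap.prod (t.αInvDual ∘ₗ LinearMap.snd Λ z.F (Dual Λ z.F))
        (sgn q • (t.α.toLinearMap ∘ₗ LinearMap.fst Λ z.F (Dual Λ z.F)) +
          sgn q • (t.α.toLinearMap ∘ₗ (cotranspose ν - sgn q • ν) ∘ₗ
            LinearMap.snd Λ z.F (Dual Λ z.F))) :
        (z.F × Dual Λ z.F) →ₗ[Λ] (z.F × Dual Λ z.F))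
  | .lower => Dual.map t.β.symm.toLinearMap
  | .other => LinearMap.id

variable {t}
variable {ν : Dual Λ z.F →ₗ[Λ] z.F}

theorem μ_β (hν : QGroup.mk (-sgn q) (ev (z.F : Type u) ∘ₗ ν) = t.ν) (g : z.G) :
    z.μ (t.β g) = sgn q • t.α (z.γ g + (cotranspose ν - sgn q • ν) (z.μ g)) := by
  have h := LinearMap.congr_fun t.comm_γ g
  have h1 : (evEquiv (z.F : Type u)).symm (transpose (QGroup.symm t.ν) (z.μ g)) =
      (cotranspose ν - sgn q • ν) (z.μ g) := by
    refine eq_of_dual_eq (Λ := Λ) fun φ => ?_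
    rw [apply_evEquiv_symm (Λ := Λ), ← hν, QGroup.symm_mk, LinearMap.sub_apply, map_sub, apply_cotranspose,
      LinearMap.smul_apply, map_units_smul]
    simp [sub_eq_add_neg]
  have h2 : t.α (z.γ g) + t.α ((cotranspose ν - sgn q • ν) (z.μ g)) = sgn q • z.μ (t.β g) := by
    rw [← h1]; exact h
  rw [map_add, h2, units_smul_smul]

theorem apply_sigma (φ ψ : Dual Λ z.F) : sgn q • φ ((cotranspose ν - sgn q • ν) ψ) +
    star (ψ ((cotranspose ν - sgn q • ν) φ)) = 0 := by
  simp only [LinearMap.sub_apply, map_sub, apply_cotranspose, LinearMap.smul_apply, map_units_smul,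
    star_sub, star_star, star_units_smul, smul_sub, units_smul_smul]
  abel

theorem apply_αInvDual (φ ψ : Dual Λ z.F) : φ (t.αInvDual ψ) = star (ψ (t.α.symm φ)) :=
  apply_cotranspose t.α.symm.toLinearMap ψ φ

theorem hTerm_diff (hν : QGroup.mk (-sgn q) (ev (z.F : Type u) ∘ₗ ν) = t.ν) (i j : Deg) :
    z.diff i j ∘ₗ t.hTerm ν i = t.hTerm ν j ∘ₗ z.diff i j := by
  have zero : ∀ i j : Deg, z.diff i j = 0 →
      z.diff i j ∘ₗ t.hTerm ν i = t.hTerm ν j ∘ₗ z.diff i j := by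
    intro i j h
    rw [h, LinearMap.zero_comp, LinearMap.comp_zero]
  have hc : ∀ g, t.αInvDual (z.μ g) = z.γ (t.β g) := fun g => LinearMap.congr_fun t.comm_μ g
  cases i <;> cases j <;> first | exact zero _ _ rfl | skip
  · refine LinearMap.ext fun (g : z.G) => ?_
    have h := μ_β hν g
    change ((-sgn q) • (z.γ (t.β g), z.μ (t.β g)) : z.F × Dual Λ z.F) =
      (t.αInvDual ((-sgn q) • z.μ g), sgn q • t.α ((-sgn q) • z.γ g) +
        sgn q • t.α ((cotranspose ν - sgn q • ν) ((-sgn q) • z.μ g)))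
    rw [h, ← hc]
    simp only [map_units_smul, map_add, smul_add]
    refine Prod.ext rfl ?_
    simp only [Prod.smul_snd, smul_add]
    simp only [smul_comm (sgn q) (-sgn q)]
  · refine LinearMap.ext fun (x : z.F × Dual Λ z.F) => Dual.ext fun (g : z.G) => ?_
    obtain ⟨g, rfl⟩ := t.β.surjective g
    obtain ⟨x, φ⟩ := x
    have h := μ_β hν g
    change star (z.μ (t.β g) (t.αInvDual φ)) + sgn q • (sgn q • t.α x +
      sgn q • t.α ((cotranspose ν - sgn q • ν) φ) : Dual Λ z.F) (z.γ (t.β g)) =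
      star (z.μ (t.β.symm (t.β g)) x) + sgn q • φ (z.γ (t.β.symm (t.β g)))
    have hs := apply_sigma (ν := ν) φ (z.μ g)
    rw [t.β.symm_apply_apply, apply_αInvDual, star_star, h, ← hc, ← smul_add,
      Dual.units_smul_apply, units_smul_smul, Dual.add_apply, apply_αInvDual, apply_αInvDual]
    simp only [map_units_smul, LinearEquiv.symm_apply_apply, map_add, smul_add]
    rw [add_comm (star (z.μ g x)), ← add_assoc, add_assoc (sgn q • φ (z.γ g)), hs, add_zero,
      add_comm]

variable (t) in
/-- The chain map `h_t : C → C`. -/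
def h (ν : Dual Λ z.F →ₗ[Λ] z.F) (hν : QGroup.mk (-sgn q) (ev (z.F : Type u) ∘ₗ ν) = t.ν) :
    z.complex ⟶ z.complex where
  f r := ModuleCat.ofHom (t.hTerm ν (deg q r))
  comm' _ _ _ := ModuleCat.hom_ext (hTerm_diff hν _ _)

variable (t)

/-- The components of `χ_t`: `χ_{t,1} = (0 0; 1 -αν^*α^*) : C^q = F^* ⊕ F → C_q = F ⊕ F^*`,
`χ_{t,2} = (0; εμ - αν^*α^*γ) : C^{q-1} = G → C_q` and
`χ_{t,3} = -θ + β^{-*} κ β^{-1} : C^{q-1} = G → C_{q-1} = G^*`. -/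
def chiTerm (θ : z.G →ₗ[Λ] Dual Λ z.G) (ν : Dual Λ z.F →ₗ[Λ] z.F) (κ : z.G →ₗ[Λ] Dual Λ z.G) :
    ∀ (_ : ℕ) (p r : Deg), Dual Λ (z.term p) →ₗ[Λ] z.term r
  | 1, .middle, .middle =>
      LinearMap.inr Λ z.F (Dual Λ z.F) ∘ₗ
        (Dual.map (LinearMap.inl Λ z.F (Dual Λ z.F)) -
          t.α.toLinearMap ∘ₗ cotranspose ν ∘ₗ transpose t.α.toLinearMap ∘ₗ
            (evEquiv z.F).symm.toLinearMap ∘ₗ Dual.map (LinearMap.inr Λ z.F (Dual Λ z.F)))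
  | 2, .lower, .middle =>
      LinearMap.inr Λ z.F (Dual Λ z.F) ∘ₗ
        (sgn q • z.μ - t.α.toLinearMap ∘ₗ cotranspose ν ∘ₗ transpose t.α.toLinearMap ∘ₗ z.γ) ∘ₗ
          (evEquiv z.G).symm.toLinearMap
  | 3, .lower, .lower =>
      (-θ + Dual.map t.β.symm.toLinearMap ∘ₗ κ ∘ₗ t.β.symm.toLinearMap) ∘ₗ
        (evEquiv z.G).symm.toLinearMap
  | _, _, _ => 0

/-- The element `χ_t ∈ W_%(C)_{2q+1}` for which `(h_t, χ_t) : (C, ψ) → (C, ψ)` is an isomorphism of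
quadratic complexes. -/
def chi (θ : z.G →ₗ[Λ] Dual Λ z.G) (ν : Dual Λ z.F →ₗ[Λ] z.F) (κ : z.G →ₗ[Λ] Dual Λ z.G) :
    W z.complex (2 * q + 1) := fun i => t.chiTerm θ ν κ i.s (deg q i.p) (deg q i.r)

end FlipIso

/-- The choices `(ν, θ, κ, Δ, η)` for a flip-isomorphism `t`: representatives `θ` and `ν` of the
quadratic refinements, a map `κ` with `β^* θ β + θ + μ^* ν μ = κ + ε κ^*`, and a homotopy
`(Δ, η) : (1, 0) ≃ (h_t, χ_t) : (C, ψ) → (C, ψ)`. A flip-isomorphism is a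
flip-isomorphism rel `∂` if and only if such choices exist. -/
structure RelBoundaryChoices (t : FlipIso z) where
  θ : z.G →ₗ[Λ] Dual Λ z.G
  mk_θ : QGroup.mk (-sgn q) θ = z.θ
  ν : Dual Λ z.F →ₗ[Λ] z.F
  mk_ν : QGroup.mk (-sgn q) (ev (z.F : Type u) ∘ₗ ν) = t.ν
  κ : z.G →ₗ[Λ] Dual Λ z.G
  eq_κ : Dual.map t.β.toLinearMap ∘ₗ θ ∘ₗ t.β.toLinearMap + θ + transpose z.μ ∘ₗ ν ∘ₗ z.μ =
    κ + sgn q • transpose κ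
  homotopy : QuadraticHomotopy (2 * q) (z.psi θ) (𝟙 z.complex) 0 (t.h ν mk_ν) (t.chi θ ν κ)

section Signature

variable (z) in
/-- The homomorphism `ξ = (-η₀ β 0; 0 -εθ^* 0; R^* μ 0) : M → M^*` on `M = G^* ⊕ G ⊕ F`. -/
def xi (θ : z.G →ₗ[Λ] Dual Λ z.G) (β : z.G →ₗ[Λ] z.G) (R : z.F →ₗ[Λ] z.G)
    (η₀ : Dual Λ z.G →ₗ[Λ] z.G) :
    (Dual Λ z.G × z.G × z.F) →ₗ[Λ] Dual Λ (Dual Λ z.G × z.G × z.F) :=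
  let p₁ := LinearMap.fst Λ (Dual Λ z.G) (z.G × z.F)
  let p₂ := LinearMap.fst Λ z.G z.F ∘ₗ LinearMap.snd Λ (Dual Λ z.G) (z.G × z.F)
  let p₃ := LinearMap.snd Λ z.G z.F ∘ₗ LinearMap.snd Λ (Dual Λ z.G) (z.G × z.F)
  Dual.map p₁ ∘ₗ ev (z.G : Type u) ∘ₗ (-η₀ ∘ₗ p₁ + β ∘ₗ p₂) +
    Dual.map p₂ ∘ₗ ((-sgn q) • transpose θ) ∘ₗ p₂ +
    Dual.map p₃ ∘ₗ (Dual.map R ∘ₗ p₁ + z.μ ∘ₗ p₂)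

theorem symm_xi_bijective (t : FlipIso z) (θ : z.G →ₗ[Λ] Dual Λ z.G)
    (hθ : QGroup.mk (-sgn q) θ = z.θ) (R : z.F →ₗ[Λ] z.G) (S : Dual Λ z.F →ₗ[Λ] z.G)
    (U : Dual Λ z.G →ₗ[Λ] z.F) (η₀ : Dual Λ z.G →ₗ[Λ] z.G)
    (h1 : ∀ g, t.β g = g - sgn q • (R (z.γ g) + S (z.μ g)))
    (h2 : ∀ x, z.γ (R x) = sgn q • (x + U (transpose z.μ x)))
    (h3 : ∀ (a : Dual Λ z.G) (f : Dual Λ z.F), a (-S f + sgn q • cotranspose U f - S (z.μ (cotranspose U f)) -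
      sgn q • R (t.α.symm f)) + a (η₀ (Dual.map z.γ f)) - sgn q • star (f (z.γ (η₀ a))) = 0) :
    Function.Bijective (QGroup.symm (QGroup.mk (-sgn q) (z.xi θ t.β.toLinearMap R η₀))) := by
  set L := QGroup.symm (QGroup.mk (-sgn q) (z.xi θ t.β.toLinearMap R η₀)) with hLdef
  have hs : ∀ e : ℤˣ, ∀ x : Λ, (-e) • x = -(e • x) := fun e x => by
    rcases Int.units_eq_one_or e with rfl | rfl <;> simp
  have hsG : ∀ e : ℤˣ, ∀ x : z.G, (-e) • x = -(e • x) := fun e x => by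
    rcases Int.units_eq_one_or e with rfl | rfl <;> simp
  have hθ' : ∀ g g', θ g g' - sgn q • star (θ g' g) = z.μ g (z.γ g') := fun g g' => by
    have h1 := congrArg (fun φ : Dual Λ z.G => φ g') (LinearMap.congr_fun z.symm_θ g)
    rw [← hθ, QGroup.symm_mk] at h1
    simpa [sub_eq_add_neg, hs] using h1
  have hL : ∀ a g x a' g' x', L (a, g, x) (a', g', x') =
      star (a' (-η₀ a + sgn q • cotranspose η₀ a + t.β g - sgn q • R x)) +
      (-(sgn q • a (t.β g')) + z.μ g (z.γ g') - sgn q • star (z.μ g' x)) +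
      (a (R x') + z.μ g x') := by
    intro a g x a' g' x'
    rw [← hθ', hLdef, QGroup.symm_mk]
    simp [xi, apply_cotranspose, star_units_smul, units_smul_smul, -star_smul]
    abel
  have hγμ : ∀ g g', z.μ g (z.γ g') + sgn q • star (z.μ g' (z.γ g)) = 0 := fun g g' => by
    rw [z.μ_apply_γ g g', hs, neg_add_cancel]
  have hβγ : ∀ f g, f (z.γ (t.β g)) = star (z.μ g (t.α.symm f)) := fun f g => by
    rw [← FlipIso.apply_αInvDual]
    exact congrArg f (LinearMap.congr_fun t.comm_μ g).symm
  have hμU : ∀ f x, z.μ (cotranspose U f) x = f (U (transpose z.μ x)) := fun f x => by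
    have := apply_cotranspose U f (transpose z.μ x)
    rw [transpose_apply] at this
    exact star_injective this
  have hB : ∀ f : Dual Λ z.F, ∃ v, ∀ a' g' x', L v (a', g', x') = star (a' (-S f)) + sgn q • f x' := by
    intro f
    refine ⟨(Dual.map z.γ f, -(sgn q • cotranspose U f),
      -t.α.symm f + sgn q • z.γ (cotranspose U f)), fun a' g' x' => ?_⟩
    have e3 := congrArg star (h3 a' f)
    have e2 := h2 x'
    rw [hL, map_neg t.β, map_units_smul t.β, h1 (cotranspose U f)]
    have e4 := hμU f x'
    have e5 := congrArg (fun y => sgn q • y) (hγμ (cotranspose U f) g')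
    have e6 := hβγ f g'
    simp only [Dual.map_apply, map_neg, map_add, map_sub, map_units_smul, star_add, star_neg,
      star_sub, star_units_smul, star_star, smul_add, smul_neg, smul_sub, units_smul_smul,
      Dual.neg_apply, Dual.units_smul_apply, apply_cotranspose, star_zero, smul_zero,
      e2, e4, e6] at e3 e5 ⊢
    rw [← sub_eq_zero]
    refine Eq.trans ?_ ((congrArg₂ (fun x y => -x - y) e3 e5).trans (by simp))
    abel
  have hsurj : Function.Surjective L := by
    have hG : ∀ u : z.G, ∃ v, ∀ a' g' x', L v (a', g', x') = star (a' u) := by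
      intro u
      obtain ⟨v, hv⟩ := hB (z.μ u)
      refine ⟨(0, u, -z.γ u) - sgn q • v, fun a' g' x' => ?_⟩
      rw [map_sub, map_units_smul, Dual.sub_apply, Dual.units_smul_apply, hv, hL, h1 u]
      have e := hγμ u g'
      simp only [map_neg, map_add, map_sub, map_units_smul, star_add, star_neg, star_sub,
        star_units_smul, smul_add, smul_neg, units_smul_smul, map_zero, star_zero, Dual.zero_apply,
        smul_zero] at e ⊢
      rw [← sub_eq_zero]
      refine Eq.trans ?_ e
      abel
    have hF : ∀ f : Dual Λ z.F, ∃ v, ∀ a' g' x', L v (a', g', x') = f x' := by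
      intro f
      obtain ⟨v, hv⟩ := hB f
      obtain ⟨w, hw⟩ := hG (S f)
      refine ⟨sgn q • (v + w), fun a' g' x' => ?_⟩
      rw [map_units_smul, map_add, Dual.units_smul_apply, Dual.add_apply, hv, hw, map_neg, star_neg,
        neg_add_cancel_comm, units_smul_smul]
    have hD : ∀ b : Dual Λ z.G, ∃ v, ∀ a' g' x', L v (a', g', x') = b g' := by
      intro b
      obtain ⟨w, hw⟩ := hG ((-η₀ + sgn q • cotranspose η₀) (Dual.map t.β.symm.toLinearMap b))
      obtain ⟨x, hx⟩ := hF (Dual.map R (Dual.map t.β.symm.toLinearMap b))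
      refine ⟨-sgn q • ((Dual.map t.β.symm.toLinearMap b, 0, 0) - w - x), fun a' g' x' => ?_⟩
      rw [map_units_smul, map_sub, map_sub, Dual.units_smul_apply, Dual.sub_apply, Dual.sub_apply,
        hw, hx, hL]
      simp [hs, units_smul_smul, smul_add, smul_sub, star_units_smul, -star_smul]
      abel
    intro Φ
    obtain ⟨u, hu⟩ := (ev_bijective (Λ := Λ) z.G).2
      (Dual.map (LinearMap.inl Λ (Dual Λ z.G) (z.G × z.F)) Φ)
    obtain ⟨v₁, h₁⟩ := hG u
    obtain ⟨v₂, h₂⟩ := hD (Dual.map (LinearMap.inr Λ (Dual Λ z.G) (z.G × z.F) ∘ₗ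
      LinearMap.inl Λ z.G z.F) Φ)
    obtain ⟨v₃, h₃⟩ := hF (Dual.map (LinearMap.inr Λ (Dual Λ z.G) (z.G × z.F) ∘ₗ
      LinearMap.inr Λ z.G z.F) Φ)
    refine ⟨v₁ + (v₂ + v₃), Dual.ext fun w => ?_⟩
    obtain ⟨a', g', x'⟩ := w
    have hu' := congrArg (fun X : Dual Λ (Dual Λ z.G) => X a') hu
    simp only [ev_apply] at hu'
    rw [map_add, map_add, Dual.add_apply, Dual.add_apply, h₁, h₂, h₃, hu']
    simp only [Dual.map_apply, LinearMap.comp_apply, ← map_add]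
    simp
  refine ⟨fun v w hvw => ?_, hsurj⟩
  have hswap : ∀ v w, L v w = -(sgn q • star (L w v)) := fun v w => by
    rw [hLdef, QGroup.symm_mk]
    simp [star_units_smul, units_smul_smul, -star_smul]
  refine eq_of_dual_eq (Λ := Λ) fun φ => ?_
  obtain ⟨y, rfl⟩ := hsurj φ
  rw [hswap, hvw, ← hswap]

variable (z) in
/-- The identification of equal terms. -/
def castTerm {i j : Deg} (h : i = j) : z.term i ≃ₗ[Λ] z.term j := h ▸ LinearEquiv.refl Λ (z.term i)

variable (z) in
/-- The identification `C_{q+1} = G`. -/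
def upperEquiv : z.complex.X (q + 1) ≃ₗ[Λ] z.G := z.castTerm (deg_upper q)

variable (z) in
/-- The identification `C_q = F ⊕ F^*`. -/
def middleEquiv : z.complex.X q ≃ₗ[Λ] z.F × Dual Λ z.F := z.castTerm (deg_middle q)

theorem symm_xi_bijective_of_relations (t : FlipIso z) (θ : z.G →ₗ[Λ] Dual Λ z.G)
    (hθ : QGroup.mk (-sgn q) θ = z.θ) (ν : Dual Λ z.F →ₗ[Λ] z.F) {u m l : Deg}
    (hu : u = .upper) (hm : m = .middle) (hl : l = .lower)
    (D₁ : z.term m →ₗ[Λ] z.term u) (D₀ : z.term l →ₗ[Λ] z.term m)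
    (e₀ : Dual Λ (z.term u) →ₗ[Λ] z.term u) (e₁ : Dual Λ (z.term m) →ₗ[Λ] z.term u)
    (e₁' : Dual Λ (z.term u) →ₗ[Λ] z.term m)
    (h1 : t.hTerm ν u = D₁ ∘ₗ z.diff u m + LinearMap.id)
    (h2 : t.hTerm ν m = D₀ ∘ₗ z.diff m l + z.diff u m ∘ₗ D₁ + LinearMap.id)
    (h3 : 0 = -(D₁ ∘ₗ z.psiTerm θ 0 m m) + sgn q • ((t.hTerm ν u ∘ₗ z.psiTerm θ 0 l u +
      D₁ ∘ₗ cotranspose (z.psiTerm θ 1 m l)) ∘ₗ Dual.map D₀) +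
      ((-sgn q) • (e₀ ∘ₗ Dual.map (z.diff u m)) - (e₁ - cotranspose e₁')))
    (h4 : 0 = -(D₀ ∘ₗ z.psiTerm θ 0 u l) + (-sgn q) • ((t.hTerm ν m ∘ₗ z.psiTerm θ 0 m m +
      D₀ ∘ₗ cotranspose (z.psiTerm θ 1 l m)) ∘ₗ Dual.map D₁) +
      (z.diff u m ∘ₗ e₀ - (e₁' - cotranspose e₁))) :
    Function.Bijective (QGroup.symm (QGroup.mk (-sgn q) (z.xi θ t.β.toLinearMap
      ((z.castTerm hu).toLinearMap ∘ₗ D₁ ∘ₗ (z.castTerm hm).symm.toLinearMap ∘ₗ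
        LinearMap.inl Λ z.F (Dual Λ z.F))
      ((z.castTerm hu).toLinearMap ∘ₗ e₀ ∘ₗ Dual.map (z.castTerm hu).toLinearMap)))) := by
  subst hu hm hl
  let D1 : z.F × Dual Λ z.F →ₗ[Λ] z.G := D₁
  let D0 : Dual Λ z.G →ₗ[Λ] z.F × Dual Λ z.F := D₀
  let η₀ : Dual Λ z.G →ₗ[Λ] z.G := e₀
  let E1 : Dual Λ (z.F × Dual Λ z.F) →ₗ[Λ] z.G := e₁
  let E1' : Dual Λ z.G →ₗ[Λ] z.F × Dual Λ z.F := e₁'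
  have key : ∀ g, t.β g = g - sgn q • (D1 (z.γ g, 0) + D1 (0, z.μ g)) := by
    intro g
    have h : t.β g = D1 ((-sgn q) • (z.γ g, z.μ g)) + g := LinearMap.congr_fun h1 g
    have h' : D1 (z.γ g, z.μ g) = D1 (z.γ g, 0) + D1 (0, z.μ g) := by
      rw [← map_add, Prod.mk_add_mk, add_zero, zero_add]
    rw [h, map_units_smul, Units.neg_smul, h', add_comm, ← sub_eq_add_neg]
  refine symm_xi_bijective t θ hθ (D1 ∘ₗ LinearMap.inl Λ z.F (Dual Λ z.F))
    (D1 ∘ₗ LinearMap.inr Λ z.F (Dual Λ z.F)) (LinearMap.fst Λ z.F (Dual Λ z.F) ∘ₗ D0) η₀ key ?_ ?_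
  · intro x
    have h : ((t.αInvDual 0, sgn q • t.α x + sgn q • t.α ((cotranspose ν - sgn q • ν) 0)) :
        z.F × Dual Λ z.F) = D0 (transpose z.μ x + sgn q • Dual.map z.γ 0) +
        (-sgn q) • (z.γ (D1 (x, 0)), z.μ (D1 (x, 0))) + (x, 0) :=
      LinearMap.congr_fun h2 (show z.F × Dual Λ z.F from (x, 0))
    have h' := congrArg Prod.fst h
    simp only [map_zero, smul_zero, add_zero, Prod.fst_add, Units.neg_smul] at h'
    change z.γ (D1 (x, 0)) = sgn q • (x + (D0 (transpose z.μ x)).1)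
    rw [← units_smul_smul (sgn q) (z.γ (D1 (x, 0)))]
    congr 1
    rw [← sub_eq_zero, ← neg_eq_zero]
    refine Eq.trans ?_ h'.symm
    simp only [Prod.fst_neg, Prod.smul_fst]
    abel
  · intro a f
    let Φ := Dual.map (LinearMap.fst Λ z.F (Dual Λ z.F)) f
    let U := LinearMap.fst Λ z.F (Dual Λ z.F) ∘ₗ D0
    have hpsi : ∀ Ψ : Dual Λ (Dual Λ z.G), cotranspose (z.psiTerm θ 1 .middle .lower) Ψ =
        (show z.F × Dual Λ z.F from (sgn q • z.γ ((evEquiv z.G).symm Ψ), 0)) := by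
      intro Ψ
      refine eq_of_dual_eq (Λ := Λ) (M := z.F × Dual Λ z.F) fun φ => ?_
      let p : Dual Λ (z.F × Dual Λ z.F) →ₗ[Λ] Dual Λ z.G := z.psiTerm θ 1 .middle .lower
      have k := apply_cotranspose p Ψ φ
      refine Eq.trans k ?_
      change star (Ψ (sgn q • Dual.map z.γ (Dual.map (LinearMap.inl Λ z.F (Dual Λ z.F)) φ))) = _
      rw [map_units_smul, star_units_smul, ← apply_evEquiv_symm, ← map_units_smul]
      have e : ((sgn q • z.γ ((evEquiv z.G).symm Ψ), 0) : z.F × Dual Λ z.F) =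
          sgn q • (z.γ ((evEquiv z.G).symm Ψ), 0) := Prod.ext rfl (smul_zero _).symm
      refine Eq.trans ?_ (congrArg φ e.symm)
      rw [map_units_smul, map_units_smul]
      rfl
    have k3 : 0 = -(D1 (0, f)) + sgn q • (t.β (cotranspose U f) +
        D1 (sgn q • z.γ (cotranspose U f), 0)) +
        ((-sgn q) • η₀ (Dual.map z.γ ((-sgn q) • f)) - (E1 Φ - cotranspose E1' Φ)) := by
      have k := LinearMap.congr_fun h3 Φ
      have hpsi' := congrArg D1 (hpsi (Dual.map D0 Φ))
      have hd : Dual.map (z.diff .upper .middle) Φ = Dual.map z.γ ((-sgn q) • f) := by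
        refine Dual.ext fun (g : z.G) => ?_
        change f ((-sgn q) • z.γ g) = (-sgn q) • f (z.γ g)
        rw [map_units_smul]
      have hd' := congrArg η₀ hd
      change D1 (cotranspose (z.psiTerm θ 1 .middle .lower) (Dual.map D0 Φ)) =
        D1 (sgn q • z.γ (cotranspose U f), 0) at hpsi'
      rw [← hpsi', ← hd']
      exact k
    let H : z.F × Dual Λ z.F →ₗ[Λ] z.F × Dual Λ z.F := t.hTerm ν .middle
    have k4 : (0 : z.F × Dual Λ z.F) = -(D0 0) + (-sgn q) • (H
        (0, Dual.map (D1 ∘ₗ LinearMap.inl Λ z.F (Dual Λ z.F)) a) +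
        D0 (cotranspose (0 : Dual Λ (Dual Λ z.G) →ₗ[Λ] z.F × Dual Λ z.F) (Dual.map D1 a))) +
        ((-sgn q) • (z.γ (η₀ a), z.μ (η₀ a)) - (E1' a - cotranspose E1 a)) :=
      LinearMap.congr_fun h4 a
    have m3 := congrArg a k3
    have m4 := congrArg (fun y : z.F × Dual Λ z.F => f y.1) k4
    have hH : ∀ ψ, (H (0, ψ)).1 = t.αInvDual ψ := fun ψ => rfl
    have e1 : a (cotranspose E1' Φ) = star (f (E1' a).1) := apply_cotranspose E1' Φ a
    have e2 : f (cotranspose E1 a).1 = star (a (E1 Φ)) := apply_cotranspose E1 a Φ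
    have hc : cotranspose (0 : Dual Λ (Dual Λ z.G) →ₗ[Λ] z.F × Dual Λ z.F) = 0 := by
      refine LinearMap.ext fun x => eq_of_dual_eq (Λ := Λ) fun φ => ?_
      rw [apply_cotranspose]
      simp
    simp only [hc, LinearMap.zero_apply, map_zero, Prod.fst_add, Prod.fst_sub, Prod.fst_neg,
      Prod.smul_fst, Prod.fst_zero, hH, map_add, map_sub, map_neg, map_units_smul, e1, e2,
      Units.neg_smul, smul_neg, smul_add, units_smul_smul, neg_neg] at m3 m4
    have e3 : ∀ x : z.F, D1 (sgn q • x, 0) = sgn q • D1 (x, 0) := fun x => by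
      rw [← map_units_smul]
      exact congrArg D1 (Prod.ext rfl (smul_zero _).symm)
    rw [key, e3] at m3
    have e4 : Dual.map (D1 ∘ₗ LinearMap.inl Λ z.F (Dual Λ z.F)) a (t.α.symm f) =
        a (D1 (t.α.symm f, 0)) := rfl
    rw [FlipIso.apply_αInvDual, e4] at m4
    have m4' := congrArg star m4
    simp only [map_sub, map_add, map_units_smul, smul_add, smul_sub, units_smul_smul, star_zero,
      smul_zero, star_add, star_sub, star_neg, star_star, star_units_smul] at m3 m4'
    change a (-(D1 (0, f)) + sgn q • cotranspose U f - D1 (0, z.μ (cotranspose U f)) -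
      sgn q • D1 (t.α.symm f, 0)) + a (η₀ (Dual.map z.γ f)) - sgn q • star (f (z.γ (η₀ a))) = 0
    simp only [map_sub, map_add, map_neg, map_units_smul]
    refine Eq.trans ?_ ((congrArg₂ (fun x y => x + y) m3 m4').symm.trans (add_zero _))
    abel

namespace RelBoundaryChoices

variable {t : FlipIso z} (c : RelBoundaryChoices t)

/-- The component `R : F → G` of `Δ_{q+1} = (R S) : C_q = F ⊕ F^* → C_{q+1} = G`. -/
def R : z.F →ₗ[Λ] z.G :=
  z.upperEquiv.toLinearMap ∘ₗ (c.homotopy.Δ.hom q (q + 1)).hom ∘ₗ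
    z.middleEquiv.symm.toLinearMap ∘ₗ LinearMap.inl Λ z.F (Dual Λ z.F)

/-- The component `η₀ : C^{q+1} = G^* → C_{q+1} = G` of `η`. -/
def η₀ : Dual Λ z.G →ₗ[Λ] z.G :=
  z.upperEquiv.toLinearMap ∘ₗ c.homotopy.η ⟨0, q + 1, q + 1, by push_cast; ring⟩ ∘ₗ
    Dual.map z.upperEquiv.toLinearMap

/-- The `(-ε)`-quadratic form `(M, ξ)` on `M = G^* ⊕ G ⊕ F`. -/
def form : QuadForm Λ (-sgn q) where
  M := ⟨Dual Λ z.G × z.G × z.F⟩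
  ψ := QGroup.mk (-sgn q) (z.xi c.θ t.β.toLinearMap c.R c.η₀)

theorem negOnePow_q : (q : ℤ).negOnePow = sgn q := by
  simp [sgn, Int.negOnePow]

theorem form_nonSingular : c.form.NonSingular := by
  have hl : deg q (q - 1) = .lower := by simp [deg]; omega
  have hX : ∀ x : z.complex.X (q + 2), x = 0 := by
    have : deg q (q + 2) = .other := by simp [deg]; omega
    change ∀ x : z.term (deg q (q + 2)), x = 0
    rw [this]
    exact fun x => Subsingleton.elim (α := PUnit) x 0
  have e1 : ((q : ℤ) + 1).negOnePow = -sgn q := by rw [Int.negOnePow_succ, negOnePow_q]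
  have hd : ∀ x, (z.complex.d (q + 2) (q + 1)).hom x = 0 := fun x => by rw [hX x, map_zero]
  have e6 : ((q : ℤ) * (q + 1)).negOnePow = 1 := Int.negOnePow_even _ (Int.even_mul_succ_self _)
  have e7 : ((q + 1) * (q : ℤ)).negOnePow = 1 := by rw [mul_comm, e6]
  have e8 : ((q : ℤ) * (q - 1)).negOnePow = 1 := Int.negOnePow_even _ (Int.even_mul_pred_self _)
  have e9 : (((q : ℤ) - 1) * q).negOnePow = 1 := by rw [mul_comm, e8]
  have hchi : ∀ i j : Deg, t.chiTerm c.θ c.ν c.κ 0 i j = 0 := by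
    intro i j
    cases i <;> cases j <;> rfl
  refine symm_xi_bijective_of_relations t c.θ c.mk_θ c.ν (deg_upper q) (deg_middle q) hl
    (c.homotopy.Δ.hom q (q + 1)).hom (c.homotopy.Δ.hom (q - 1) q).hom
    (c.homotopy.η ⟨0, q + 1, q + 1, by push_cast; ring⟩)
    (c.homotopy.η ⟨1, q, q + 1, by push_cast; ring⟩)
    (c.homotopy.η ⟨1, q + 1, q, by push_cast; ring⟩) ?_ ?_ ?_ ?_
  · have h := c.homotopy.Δ.comm (q + 1)
    rw [dNext_eq c.homotopy.Δ.hom (show (ComplexShape.down ℤ).Rel (q + 1 : ℤ) q from rfl),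
      prevD_eq c.homotopy.Δ.hom (show (ComplexShape.down ℤ).Rel (q + 2 : ℤ) (q + 1) from by
        change (q + 1 + 1 : ℤ) = q + 2; ring)] at h
    have h0 : c.homotopy.Δ.hom (q + 1) (q + 2) ≫ z.complex.d (q + 2) (q + 1) = 0 :=
      ModuleCat.hom_ext (LinearMap.ext fun x => by
        change (z.complex.d (q + 2) (q + 1)).hom ((c.homotopy.Δ.hom (q + 1) (q + 2)).hom x) = 0
        rw [hX ((c.homotopy.Δ.hom (q + 1) (q + 2)).hom x), map_zero])
    rw [h0, add_zero] at h
    exact congrArg ModuleCat.Hom.hom h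
  · have h := c.homotopy.Δ.comm q
    rw [dNext_eq c.homotopy.Δ.hom (show (ComplexShape.down ℤ).Rel (q : ℤ) (q - 1) from by
        change (q - 1 + 1 : ℤ) = q; ring),
      prevD_eq c.homotopy.Δ.hom (show (ComplexShape.down ℤ).Rel (q + 1 : ℤ) q from rfl)] at h
    exact congrArg ModuleCat.Hom.hom h
  · exact c.homotopy.eq_apply_left (p := q) (r := q + 1) (p' := q - 1) (r' := q)
      (p'' := q + 1) (r'' := q + 2) (by push_cast; ring) rfl (by ring) rfl (by ring)
      (hchi _ _) e1 (even_two_mul _) e6 e9 hd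
  · exact c.homotopy.eq_apply_right (p := q + 1) (r := q) (p' := q) (r' := q - 1)
      (p'' := q + 2) (r'' := q + 1) (by push_cast; ring) (by ring) rfl (by ring) rfl
      (hchi _ _) negOnePow_q (even_two_mul _) e7 e8 hd

end RelBoundaryChoices

/-- The quadratic signature `ρ^*(z, t, ν, θ, κ, Δ, η) = [(M, ξ)] ∈ L_{2q+2}(Λ)`. -/
def quadraticSignature (t : FlipIso z) (c : RelBoundaryChoices t) : LGroup Λ (-sgn q) :=
  LGroup.mk c.form c.form_nonSingular

end Signature
end SplitPreformation
end Translation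

end
end AlgebraicSurgery

/-! Write ε = (-1)^q and, for a f.g. free P, ∂H(P) for the boundary of the hyperbolic form on P ⊕
P^*. Suppose the signature vanishes. Let U : G^* → F be the F-component of Δ in degree q - 1, and
let j : G ⊕ F^* → M = G^* ⊕ G ⊕ F be (g, f) ↦ (-γ^*f, g + εU^*f, α⁻¹f - εγU^*f). The homotopy
relations imply that ξ pulls back along j to θ on the summand G (`pullback_isotropicPart`,
`pullback_isotropicMap`). Hence (g, f) ↦ (g, j(g, f)) is isotropic in (G, θ) ⊕ (M, -ξ). If ξ ⊕ H(L)
is isometric to H(L'), then it is also isometric to -H(L'), because a hyperbolic form is isometric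
to its negative. This yields an isotropic map from G ⊕ F^* ⊕ L to the G-module of z ⊕ ∂H(L'). Its
composites with γ and μ are split injective (`exists_leftInverse_γ`, `exists_leftInverse_μ`), and
its source P has half the rank of the F-module. Over a stably finite ring the resulting surjection
F^* → P ⊕ P^* between modules of equal rank is an isomorphism. That gives the remaining condition
F^*/U₁ ≅ U₀^* on an h-lagrangian (`elementary_of_isotropic`, `elementary_of_isotropic_sum`).

Conversely, let z be elementary. Its h-lagrangian P is a direct summand of G, and the complement
becomes free after adding ∂H(P). In coordinates adapted to the enlarged lagrangian, again called U,
the preformation takes the normal form F = U ⊕ U^*, G = U ⊕ K, γ = (1 0; 0 b), μ = (0 -εb; 1 d)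
(`exists_strongIso_toPreformation`, `Elementary.exists_toPreformation`). For the normal form a
flip-isomorphism with ν = 0 and a homotopy (Δ, η) are written down as explicit matrices. Here η₀ = 0
and R takes values in U, so K^* ⊕ U ⊕ U^* is a lagrangian of ξ with an explicit free complement.
Such a form is hyperbolic (`exists_pullback_hyp_of_lagrangian`), and the signature is zero. -/

namespace AlgebraicSurgery

noncomputable section

/-! ### Quadratic forms, hyperbolic forms and vanishing in the L-group. -/

section Forms

variable {Λ : Type u} [Ring Λ] [StarRing Λ]
variable {M N K : Type u} [AddCommGroup M] [Module Λ M] [AddCommGroup N] [Module Λ N]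
  [AddCommGroup K] [Module Λ K]

variable (Λ M) in
/-- A f.g. free module is isomorphic to its dual, by a choice of basis. -/
theorem nonempty_equiv_dual [Module.Free Λ M] [Module.Finite Λ M] : Nonempty (M ≃ₗ[Λ] Dual Λ M) :=
  ⟨(Module.Free.chooseBasis Λ M).equivFun ≪≫ₗ (dualCoord (Module.Free.chooseBasis Λ M)).symm⟩

theorem evEquiv_symm_ev [Module.Free Λ M] [Module.Finite Λ M] (x : M) :
    (evEquiv M).symm (ev (Λ := Λ) M x) = x := (evEquiv M).symm_apply_apply x

theorem ev_evEquiv_symm [Module.Free Λ M] [Module.Finite Λ M] (Φ : Dual Λ (Dual Λ M)) :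
    ev M ((evEquiv M).symm Φ) = Φ := (evEquiv M).apply_symm_apply Φ

namespace QGroup

variable {ε : ℤˣ}

theorem mk_surjective : Function.Surjective (mk ε : (M →ₗ[Λ] Dual Λ M) →+ QGroup Λ M ε) :=
  QuotientAddGroup.mk_surjective

theorem mk_sub_eq_zero (φ : M →ₗ[Λ] Dual Λ M) : mk ε (φ - ε • transpose φ) = 0 :=
  (QuotientAddGroup.eq_zero_iff _).2 ⟨φ, rfl⟩

theorem mk_units_smul_transpose (φ : M →ₗ[Λ] Dual Λ M) : mk ε (ε • transpose φ) = mk ε φ := by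
  have h := mk_sub_eq_zero (ε := ε) φ
  rw [map_sub, sub_eq_zero] at h
  exact h.symm

theorem pullback_id (ψ : QGroup Λ M ε) : pullback LinearMap.id ψ = ψ := by
  obtain ⟨φ, rfl⟩ := mk_surjective ψ
  rfl

theorem pullback_pullback (f : M →ₗ[Λ] N) (g : N →ₗ[Λ] K) (ψ : QGroup Λ K ε) :
    pullback f (pullback g ψ) = pullback (g ∘ₗ f) ψ := by
  obtain ⟨φ, rfl⟩ := mk_surjective ψ
  rfl

theorem pullback_zero (ψ : QGroup Λ N ε) : pullback (0 : M →ₗ[Λ] N) ψ = 0 := by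
  obtain ⟨φ, rfl⟩ := mk_surjective ψ
  rw [pullback_mk, ← map_zero (mk ε)]
  congr 1
  ext x y
  simp

/-- The deviation of `Q_ε` from additivity is measured by the symmetrization. -/
theorem pullback_add (a b : M →ₗ[Λ] N) (ψ : QGroup Λ N ε) :
    pullback (a + b) ψ = pullback a ψ + pullback b ψ + mk ε (Dual.map b ∘ₗ symm ψ ∘ₗ a) := by
  obtain ⟨φ, rfl⟩ := mk_surjective ψ
  -- The cross term a^*φb of (a + b)^*φ(a + b) has the same class as its T_ε-image, which combines
  -- with b^*φa to the symmetrization.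
  have h := mk_units_smul_transpose (ε := ε) (Dual.map a ∘ₗ φ ∘ₗ b)
  have h2 : Dual.map b ∘ₗ symm (mk ε φ) ∘ₗ a =
      Dual.map b ∘ₗ φ ∘ₗ a + ε • transpose (Dual.map a ∘ₗ φ ∘ₗ b) := by
    ext x y
    simp [symm_mk]
  rw [h2, map_add, h, pullback_mk, pullback_mk, pullback_mk, ← map_add, ← map_add, ← map_add]
  congr 1
  ext x y
  simp
  abel

end QGroup

/-- The dual of a product, `M^* ⊕ N^* ≅ (M ⊕ N)^*`. -/
def dualProd : (Dual Λ M × Dual Λ N) ≃ₗ[Λ] Dual Λ (M × N) :=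
  LinearEquiv.ofLinearMap
    (Dual.map (LinearMap.fst Λ M N) ∘ₗ LinearMap.fst Λ _ _ +
      Dual.map (LinearMap.snd Λ M N) ∘ₗ LinearMap.snd Λ _ _)
    ((Dual.map (LinearMap.inl Λ M N)).prod (Dual.map (LinearMap.inr Λ M N)))
    (by
      refine LinearMap.ext fun φ => Dual.ext fun x => ?_
      change φ (x.1, 0) + φ (0, x.2) = φ x
      rw [← map_add]
      simp)
    (by
      refine LinearMap.ext fun x => Prod.ext (Dual.ext fun y => ?_) (Dual.ext fun y => ?_)
      · change x.1 y + x.2 0 = x.1 y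
        rw [map_zero, add_zero]
      · change x.1 0 + x.2 y = x.2 y
        rw [map_zero, zero_add])

@[simp] theorem dualProd_apply (φ : Dual Λ M) (ψ : Dual Λ N) (x : M) (y : N) :
    dualProd (φ, ψ) (x, y) = φ x + ψ y := rfl

namespace QGroup

variable {ε : ℤˣ}

/-- The orthogonal sum of quadratic forms. -/
def sum (ψ : QGroup Λ M ε) (ψ' : QGroup Λ N ε) : QGroup Λ (M × N) ε :=
  pullback (LinearMap.fst Λ M N) ψ + pullback (LinearMap.snd Λ M N) ψ'

theorem pullback_sum {M' N' : Type u} [AddCommGroup M'] [Module Λ M'] [AddCommGroup N']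
    [Module Λ N'] (f : M →ₗ[Λ] M') (g : N →ₗ[Λ] N') (ψ : QGroup Λ M' ε) (ψ' : QGroup Λ N' ε) :
    pullback (f.prodMap g) (sum ψ ψ') = sum (pullback f ψ) (pullback g ψ') := by
  simp only [sum, map_add, pullback_pullback]
  rfl

theorem pullback_prodAssoc (ψ : QGroup Λ M ε) (ψ' : QGroup Λ N ε) (ψ'' : QGroup Λ K ε) :
    pullback (LinearEquiv.prodAssoc Λ M N K).toLinearMap (sum ψ (sum ψ' ψ'')) =
      sum (sum ψ ψ') ψ'' := by
  simp only [sum, map_add, pullback_pullback, ← add_assoc]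
  rfl

theorem pullback_prodComm (ψ : QGroup Λ M ε) (ψ' : QGroup Λ N ε) :
    pullback (LinearEquiv.prodComm Λ M N).toLinearMap (sum ψ' ψ) = sum ψ ψ' := by
  simp only [sum, map_add, pullback_pullback]
  rw [add_comm]
  rfl

theorem pullback_inl_sum (ψ : QGroup Λ M ε) (ψ' : QGroup Λ N ε) :
    pullback (LinearMap.inl Λ M N) (sum ψ ψ') = ψ := by
  rw [sum, map_add, pullback_pullback, pullback_pullback, LinearMap.fst_comp_inl,
    LinearMap.snd_comp_inl, pullback_zero, pullback_id, add_zero]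

variable (Λ M ε) in
/-- The hyperbolic form on `M ⊕ M^*`. -/
def hyp : QGroup Λ (M × Dual Λ M) ε :=
  mk ε (Dual.map (LinearMap.fst Λ M (Dual Λ M)) ∘ₗ LinearMap.snd Λ M (Dual Λ M))

/-- Regrouping (M ⊕ M^*) ⊕ (N ⊕ N^*) as (M ⊕ N) ⊕ (M ⊕ N)^* matches the chosen representatives
exactly, so no correction in Q_ε is needed. -/
theorem pullback_hyp_prod :
    pullback (LinearEquiv.prodProdProdComm Λ M (Dual Λ M) N (Dual Λ N) ≪≫ₗ
      (LinearEquiv.refl Λ (M × N)).prodCongr dualProd).toLinearMap (hyp Λ (M × N) ε) =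
      sum (hyp Λ M ε) (hyp Λ N ε) := by
  rw [hyp, hyp, hyp, sum, pullback_mk, pullback_mk, pullback_mk, ← map_add]
  rfl

/-- The hyperbolic form is isometric to its negative. -/
theorem pullback_hyp_neg :
    pullback ((LinearEquiv.refl Λ M).prodCongr (LinearEquiv.neg Λ (M := Dual Λ M))).toLinearMap
      (hyp Λ M ε) = -hyp Λ M ε := by
  rw [hyp, pullback_mk, ← map_neg]
  rfl

theorem pullback_inl_hyp : pullback (LinearMap.inl Λ M (Dual Λ M)) (hyp Λ M ε) = 0 := by
  rw [hyp, pullback_mk, ← map_zero (mk ε)]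
  rfl

theorem symm_hyp_apply (x y : M) (φ ψ : Dual Λ M) :
    symm (hyp Λ M ε) (x, φ) (y, ψ) = φ y + ε • star (ψ x) := rfl

/-- Needed because the map μ of the boundary of a hyperbolic form is this symmetrization; its
inverse recovers an element from its image under μ. -/
theorem symm_hyp_bijective [Module.Free Λ M] [Module.Finite Λ M] :
    Function.Bijective (symm (hyp Λ M ε)) := by
  constructor
  · rw [injective_iff_map_eq_zero]
    rintro ⟨x, φ⟩ h
    have h' : ∀ (y : M) (ψ : Dual Λ M), φ y + ε • star (ψ x) = 0 := fun y ψ =>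
      congrArg (fun Φ : Dual Λ (M × Dual Λ M) => Φ (y, ψ)) h
    refine Prod.ext (eq_of_dual_eq (Λ := Λ) fun ψ => ?_) (Dual.ext fun y => ?_)
    · have := h' 0 ψ
      rw [map_zero, zero_add, ← star_units_smul, star_eq_zero] at this
      have h2 := congrArg (fun a => ε • a) this
      simpa [units_smul_smul] using h2
    · simpa using h' y 0
  · intro Φ
    refine ⟨(ε • (evEquiv M).symm (Dual.map (LinearMap.inr Λ M (Dual Λ M)) Φ),
      Dual.map (LinearMap.inl Λ M (Dual Λ M)) Φ), Dual.ext fun ⟨y, ψ⟩ => ?_⟩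
    rw [symm_hyp_apply, map_units_smul, star_units_smul, units_smul_smul, apply_evEquiv_symm,
      star_star, Dual.map_apply, Dual.map_apply, ← map_add]
    simp

/-- A quadratic form on `N ⊕ P` which vanishes on `N` and pairs `P` with `N` isomorphically
is hyperbolic. -/
theorem exists_pullback_hyp_of_lagrangian {P : Type u} [AddCommGroup P] [Module Λ P]
    [Module.Free Λ N] [Module.Finite Λ N]
    (φ : (N × P) →ₗ[Λ] Dual Λ (N × P)) (hN : ∀ n n', φ (n, 0) (n', 0) = 0)
    (e : P ≃ₗ[Λ] Dual Λ N) (he : ∀ n p, e p n = φ (0, p) (n, 0) + ε • star (φ (n, 0) (0, p))) :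
    ∃ f : (N × P) ≃ₗ[Λ] (N × Dual Λ N), pullback f.toLinearMap (hyp Λ N ε) = mk ε φ := by
  -- The shear (n, p) ↦ n + s p absorbs the form on P: e p (s p') is the T_ε-image of φ on P, which
  -- has the same class in Q_ε.
  let s : P →ₗ[Λ] N := ε • (cotranspose (Dual.map (LinearMap.inr Λ N P) ∘ₗ transpose φ ∘ₗ
    LinearMap.inr Λ N P ∘ₗ e.symm.toLinearMap) ∘ₗ ev (P : Type u))
  have hs : ∀ p p', e p' (s p) = ε • star (φ (0, p) (0, p')) := by
    intro p p'
    change e p' (ε • cotranspose _ (ev (P : Type u) p)) = _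
    rw [map_units_smul, apply_cotranspose]
    simp
  let f : (N × P) ≃ₗ[Λ] (N × Dual Λ N) :=
    { toFun := fun x => (x.1 + s x.2, e x.2)
      map_add' := fun x y => Prod.ext (by simp; abel) (by simp)
      map_smul' := fun a x => Prod.ext (by simp) (by simp)
      invFun := fun y => (y.1 - s (e.symm y.2), e.symm y.2)
      left_inv := fun x => Prod.ext (by simp) (by simp)
      right_inv := fun y => Prod.ext (by simp) (by simp) }
  -- χ(n, p)(n', p') = φ(n, p)(0, p'). Subtracting χ - T_ε χ moves every term to the side where the
  -- second variable lies in N and replaces φ on P by its T_ε-image.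
  let χ : (N × P) →ₗ[Λ] Dual Λ (N × P) := Dual.map (LinearMap.inr Λ N P ∘ₗ LinearMap.snd Λ N P) ∘ₗ φ
  refine ⟨f, ?_⟩
  rw [hyp, pullback_mk, ← sub_zero (mk ε φ), ← mk_sub_eq_zero (ε := ε) χ, ← map_sub]
  congr 1
  refine LinearMap.ext fun ⟨n, p⟩ => Dual.ext fun ⟨n', p'⟩ => ?_
  have h1 : φ (n, p) (n', p') = φ (0, p) (n', 0) + φ (n, p) (0, p') := by
    have := hN n n'
    rw [show (n, p) = (n, 0) + ((0 : N), p) by simp,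
      show (n', p') = (n', 0) + ((0 : N), p') by simp]
    simp only [map_add, Dual.add_apply, this]
    abel
  have h2 : φ (n', p') (0, p) = φ (n', 0) (0, p) + φ (0, p') (0, p) := by
    rw [← Dual.add_apply, ← map_add]
    simp
  change e p (n' + s p') = φ (n, p) (n', p') - (φ (n, p) (0, p') - ε • star (φ (n', p') (0, p)))
  rw [map_add, he, hs, h1, h2, star_add, smul_add]
  abel

end QGroup

namespace QuadForm

variable {ε : ℤˣ}

theorem Isometric.refl (A : QuadForm Λ ε) : A.Isometric A :=
  ⟨LinearEquiv.refl Λ A.M, QGroup.pullback_id A.ψ⟩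

theorem Isometric.symm {A B : QuadForm Λ ε} (h : A.Isometric B) : B.Isometric A := by
  obtain ⟨f, hf⟩ := h
  refine ⟨f.symm, ?_⟩
  rw [← hf, QGroup.pullback_pullback, LinearEquiv.comp_symm, QGroup.pullback_id]

theorem Isometric.trans {A B C : QuadForm Λ ε} (h : A.Isometric B) (h' : B.Isometric C) :
    A.Isometric C := by
  obtain ⟨f, hf⟩ := h
  obtain ⟨g, hg⟩ := h'
  refine ⟨f ≪≫ₗ g, ?_⟩
  rw [← hf, ← hg, QGroup.pullback_pullback]
  rfl

theorem Isometric.sum {A A' B B' : QuadForm Λ ε} (h : A.Isometric A') (h' : B.Isometric B') :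
    (A.sum B).Isometric (A'.sum B') := by
  obtain ⟨f, hf⟩ := h
  obtain ⟨g, hg⟩ := h'
  exact ⟨f.prodCongr g, (QGroup.pullback_sum f.toLinearMap g.toLinearMap A'.ψ B'.ψ).trans
    (congrArg₂ QGroup.sum hf hg)⟩

theorem isometric_sum_assoc (A B C : QuadForm Λ ε) :
    ((A.sum B).sum C).Isometric (A.sum (B.sum C)) :=
  ⟨LinearEquiv.prodAssoc Λ A.M B.M C.M, QGroup.pullback_prodAssoc A.ψ B.ψ C.ψ⟩

theorem isometric_sum_comm (A B : QuadForm Λ ε) : (A.sum B).Isometric (B.sum A) :=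
  ⟨LinearEquiv.prodComm Λ A.M B.M, QGroup.pullback_prodComm A.ψ B.ψ⟩

/-- The isomorphism `M ≅ M ⊕ 0`. -/
def _root_.AlgebraicSurgery.prodSubsingleton [Subsingleton N] : M ≃ₗ[Λ] M × N :=
  LinearEquiv.ofLinearMap (LinearMap.inl Λ M N) (LinearMap.fst Λ M N)
    (LinearMap.ext fun _ => Prod.ext rfl (Subsingleton.elim _ _)) (LinearMap.ext fun _ => rfl)

theorem isometric_sum_zero (A : QuadForm Λ ε) : (A.sum (zero Λ ε)).Isometric A :=
  Isometric.symm ⟨(prodSubsingleton : A.M ≃ₗ[Λ] A.M × PUnit.{u + 1}),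
    QGroup.pullback_inl_sum A.ψ (0 : QGroup Λ PUnit.{u + 1} ε)⟩

theorem hyperbolic_sum (L L' : FreeModule Λ) :
    ((hyperbolic ε L).sum (hyperbolic ε L')).Isometric (hyperbolic ε ⟨L × L'⟩) :=
  ⟨_, QGroup.pullback_hyp_prod (M := L) (N := L')⟩

/-- Stable isometry of forms. -/
def StablyIsometric (A B : QuadForm Λ ε) : Prop :=
  ∃ L L' : FreeModule Λ, (A.sum (hyperbolic ε L)).Isometric (B.sum (hyperbolic ε L'))

theorem StablyIsometric.refl (A : QuadForm Λ ε) : A.StablyIsometric A :=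
  ⟨⟨PUnit⟩, ⟨PUnit⟩, Isometric.refl _⟩

theorem StablyIsometric.symm {A B : QuadForm Λ ε} (h : A.StablyIsometric B) :
    B.StablyIsometric A := by
  obtain ⟨L, L', h⟩ := h
  exact ⟨L', L, h.symm⟩

/-- The hyperbolic summands of both stable isometries are added to the middle form, where they can
be interchanged. -/
theorem StablyIsometric.trans {A B C : QuadForm Λ ε} (h : A.StablyIsometric B)
    (h' : B.StablyIsometric C) : A.StablyIsometric C := by
  obtain ⟨L₁, L₂, h⟩ := h
  obtain ⟨L₃, L₄, h'⟩ := h'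
  have hyp : ∀ (D : QuadForm Λ ε) (P Q : FreeModule Λ),
      ((D.sum (hyperbolic ε P)).sum (hyperbolic ε Q)).Isometric
        (D.sum (hyperbolic ε ⟨P × Q⟩)) := fun D P Q =>
    (isometric_sum_assoc _ _ _).trans ((Isometric.refl D).sum (hyperbolic_sum P Q))
  have swap : ∀ (D P Q : QuadForm Λ ε), ((D.sum P).sum Q).Isometric ((D.sum Q).sum P) :=
    fun D P Q => (isometric_sum_assoc _ _ _).trans
      (((Isometric.refl D).sum (isometric_sum_comm P Q)).trans (isometric_sum_assoc _ _ _).symm)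
  refine ⟨⟨L₁ × L₃⟩, ⟨L₄ × L₂⟩, (hyp A L₁ L₃).symm.trans ?_⟩
  refine (h.sum (Isometric.refl _)).trans ((swap _ _ _).trans ?_)
  exact (h'.sum (Isometric.refl _)).trans (hyp C L₄ L₂)

end QuadForm

/-- Equality in a `Quot` gives only the generated equivalence relation; stable isometry is already
an equivalence relation, so nothing is lost. -/
theorem LGroup.mk_eq_mk_iff {ε : ℤˣ} {A B : QuadForm Λ ε} (hA : A.NonSingular)
    (hB : B.NonSingular) : LGroup.mk A hA = LGroup.mk B hB ↔ A.StablyIsometric B := by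
  have e : Equivalence fun A B : {A : QuadForm Λ ε // A.NonSingular} => A.1.StablyIsometric B.1 :=
    ⟨fun A => .refl A.1, fun h => h.symm, fun h h' => h.trans h'⟩
  exact ⟨fun h => (Quot.eqvGen_exact h |> e.eqvGen_iff.1), fun h => Quot.sound h⟩

theorem LGroup.mk_eq_zero_iff {ε : ℤˣ} {A : QuadForm Λ ε} (hA : A.NonSingular) :
    LGroup.mk A hA = 0 ↔ ∃ L L' : FreeModule Λ,
      (A.sum (QuadForm.hyperbolic ε L)).Isometric (QuadForm.hyperbolic ε L') := by
  have z : ∀ L : FreeModule Λ, ((QuadForm.zero Λ ε).sum (QuadForm.hyperbolic ε L)).Isometric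
      (QuadForm.hyperbolic ε L) := fun L =>
    (QuadForm.isometric_sum_comm _ _).trans (QuadForm.isometric_sum_zero _)
  refine (LGroup.mk_eq_mk_iff hA QuadForm.nonSingular_zero).trans
    ⟨fun ⟨L, L', h⟩ => ⟨L, L', h.trans (z L')⟩, fun ⟨L, L', h⟩ => ⟨L, L', h.trans (z L').symm⟩⟩

end Forms

/-- The range of a split injection is a direct summand. -/
theorem isComplemented_range_of_leftInverse {Λ : Type u} [Ring Λ] {M N : Type u} [AddCommGroup M]
    [Module Λ M]
    [AddCommGroup N] [Module Λ N] (f : M →ₗ[Λ] N) (r : N →ₗ[Λ] M) (h : ∀ x, r (f x) = x) :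
    IsComplemented (LinearMap.range f) := by
  refine ⟨LinearMap.ker (f.rangeRestrict ∘ₗ r), LinearMap.isCompl_of_proj ?_⟩
  rintro ⟨_, x, rfl⟩
  refine Subtype.ext ?_
  change f (r (f x)) = f x
  rw [h]

/-! ### Stabilization of preformations and a criterion for being elementary. -/

section Preformations

variable {Λ : Type u} [Ring Λ] [StarRing Λ] {ε : ℤˣ}

namespace SplitPreformation

/-- A strong isomorphism stabilizes. -/
def StrongIso.sumRight {x y : SplitPreformation Λ ε} (f : StrongIso x y)
    (w : SplitPreformation Λ ε) : StrongIso (x.sum w) (y.sum w) where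
  α := f.α.prodCongr (LinearEquiv.refl Λ w.F)
  β := f.β.prodCongr (LinearEquiv.refl Λ w.G)
  comm_γ := LinearMap.ext fun g => Prod.ext (LinearMap.congr_fun f.comm_γ g.1) rfl
  comm_μ := LinearMap.ext fun g => Dual.ext fun v => by
    have h := congrArg (fun φ : Dual Λ y.F => φ v.1) (LinearMap.congr_fun f.comm_μ g.1)
    exact congrArg (· + w.μ g.2 v.2) h
  comm_θ := by
    have h := QGroup.pullback_sum f.β.toLinearMap (LinearMap.id : w.G →ₗ[Λ] w.G) y.θ w.θ
    rw [← f.comm_θ, QGroup.pullback_id] at h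
    exact h.symm

instance : Subsingleton (Dual Λ PUnit.{u + 1}) :=
  ⟨fun φ ψ => Dual.ext fun x => by rw [Subsingleton.elim x 0, map_zero, map_zero]⟩

/-- The boundary of the hyperbolic form on the zero module is neutral. -/
def isoSumBoundaryZero (x : SplitPreformation Λ ε) :
    StrongIso x (x.sum (boundary (QuadForm.hyperbolic (-ε) ⟨PUnit⟩))) where
  α := (prodSubsingleton : x.F ≃ₗ[Λ] x.F × (PUnit.{u + 1} × Dual Λ PUnit.{u + 1}))
  β := (prodSubsingleton : x.G ≃ₗ[Λ] x.G × (PUnit.{u + 1} × Dual Λ PUnit.{u + 1}))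
  comm_γ := LinearMap.ext fun g => rfl
  comm_μ := LinearMap.ext fun g => Dual.ext
    fun (v : x.F × (PUnit.{u + 1} × Dual Λ PUnit.{u + 1})) => by
      have h := map_zero (QGroup.symm (QGroup.hyp Λ PUnit.{u + 1} (-ε)))
      have h' := congrArg (fun φ : Dual Λ (PUnit.{u + 1} × Dual Λ PUnit.{u + 1}) =>
        x.μ g v.1 + φ v.2) h
      exact (h'.trans (add_zero (x.μ g v.1))).symm
  comm_θ := (QGroup.pullback_inl_sum x.θ (QGroup.hyp Λ PUnit.{u + 1} (-ε))).symm

end SplitPreformation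

open SplitPreformation

theorem LMonoid.mk_eq_mk_of_strongIso {x y : SplitPreformation Λ ε} (f : StrongIso x y) :
    LMonoid.mk x = LMonoid.mk y :=
  Quot.sound ⟨⟨PUnit⟩, ⟨PUnit⟩, ⟨f.sumRight _⟩⟩

/-- Adding ∂H(L) to z and the neutral ∂H(0) to the left-hand preformation gives strongly isomorphic
preformations. -/
theorem LMonoid.mk_sum_boundary_hyperbolic (z : SplitPreformation Λ ε) (L : FreeModule Λ) :
    LMonoid.mk (z.sum (boundary (QuadForm.hyperbolic (-ε) L))) = LMonoid.mk z :=
  (Quot.sound ⟨L, ⟨PUnit⟩, ⟨isoSumBoundaryZero _⟩⟩ : LMonoid.mk z = _).symm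

namespace SplitPreformation

/-- Over a stably finite ring an isotropic map into `G` of half the rank of `F`, whose composites
with `γ` and `μ` are split injective, spans an `h`-lagrangian. -/
theorem elementary_of_isotropic [IsStablyFiniteRing Λ] (z : SplitPreformation Λ ε)
    {P : Type u} [AddCommGroup P] [Module Λ P] [Module.Free Λ P] [Module.Finite Λ P]
    (i : P →ₗ[Λ] z.G) (hθ : QGroup.pullback i z.θ = 0)
    (r : z.F →ₗ[Λ] P) (hr : ∀ x, r (z.γ (i x)) = x)
    (s : Dual Λ z.F →ₗ[Λ] P) (hs : ∀ x, s (z.μ (i x)) = x)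
    (e : z.F ≃ₗ[Λ] P × P) : z.Elementary := by
  have hi : Function.Injective i := fun x y h => by rw [← hr x, h, hr]
  let E : P ≃ₗ[Λ] LinearMap.range i := LinearEquiv.ofInjective i hi
  have hE : ∀ x, (E x : z.G) = i x := fun x => rfl
  have hEs : ∀ u : LinearMap.range i, i (E.symm u) = u := fun u => by
    rw [← hE, LinearEquiv.apply_symm_apply]
  -- Symmetrizing the vanishing of θ along i gives the vanishing of γ^*μ.
  have hiso : ∀ x y, z.μ (i x) (z.γ (i y)) = 0 := by
    intro x y
    have h := congrArg QGroup.symm hθ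
    rw [QGroup.symm_pullback, map_zero, z.symm_θ] at h
    exact congrArg (fun φ : Dual Λ P => φ y) (LinearMap.congr_fun h x)
  have hsub : (LinearMap.range i).subtype = i ∘ₗ E.symm.toLinearMap :=
    LinearMap.ext fun u => (hEs u).symm
  have hγ : LinearMap.range (z.γ ∘ₗ (LinearMap.range i).subtype) = LinearMap.range (z.γ ∘ₗ i) := by
    rw [LinearMap.range_comp, LinearMap.range_comp, Submodule.range_subtype]
  have hμ : LinearMap.range (z.μ ∘ₗ (LinearMap.range i).subtype) = LinearMap.range (z.μ ∘ₗ i) := by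
    rw [LinearMap.range_comp, LinearMap.range_comp, Submodule.range_subtype]
  refine ⟨LinearMap.range i, Module.Free.of_equiv E, Module.Finite.equiv E, ?_, ?_, ?_, ?_, ?_,
    ?_, ?_⟩
  · refine LinearMap.ext fun u => Dual.ext fun v => ?_
    change z.μ u (z.γ v) = 0
    rw [← hEs u, ← hEs v, hiso]
  · rw [hsub, ← QGroup.pullback_pullback, hθ, map_zero]
  · intro u v h
    change z.γ u = z.γ v at h
    rw [← hEs u, ← hEs v] at h
    have := congrArg r h
    rw [hr, hr] at this
    exact E.symm.injective this
  · intro u v h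
    change z.μ u = z.μ v at h
    rw [← hEs u, ← hEs v] at h
    have := congrArg s h
    rw [hs, hs] at this
    exact E.symm.injective this
  · rw [hγ]
    exact isComplemented_range_of_leftInverse (z.γ ∘ₗ i) r hr
  · rw [hμ]
    exact isComplemented_range_of_leftInverse (z.μ ∘ₗ i) s hs
  · rw [hγ, hμ]
    -- the pair of `s` and restriction along `γ i` is an isomorphism `F^* ≅ P ⊕ P^*`
    let T : Dual Λ z.F →ₗ[Λ] P × Dual Λ P := s.prod (Dual.map (z.γ ∘ₗ i))
    have hT : Function.Surjective T := by
      rintro ⟨p, φ⟩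
      -- r^*φ already restricts to φ along γi; adding a vector of μi corrects the P-coordinate and,
      -- by isotropy, leaves the restriction unchanged.
      refine ⟨Dual.map r φ + z.μ (i (p - s (Dual.map r φ))), Prod.ext ?_ (Dual.ext fun x => ?_)⟩
      · change s _ = p
        rw [map_add, hs, add_sub_cancel]
      · change φ (r (z.γ (i x))) + z.μ (i _) (z.γ (i x)) = φ x
        rw [hr, hiso, add_zero]
    have hTi : Function.Injective T := by
      -- A basis identifies P^* with P and F with F^*, so by e the target of T is isomorphic to its
      -- source. T becomes a surjective endomorphism of a f.g. free module, hence injective by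
      -- stable finiteness.
      obtain ⟨d⟩ := nonempty_equiv_dual Λ P
      obtain ⟨d'⟩ := nonempty_equiv_dual Λ z.F
      let c : (P × Dual Λ P) ≃ₗ[Λ] Dual Λ z.F :=
        (LinearEquiv.refl Λ P).prodCongr d.symm ≪≫ₗ e.symm ≪≫ₗ d'
      have h : Function.Injective (c.toLinearMap ∘ₗ T) :=
        Module.End.injective_of_surjective Λ _ (f := c.toLinearMap ∘ₗ T)
          (c.surjective.comp hT)
      exact Function.Injective.of_comp (f := c) h
    let ρ : Dual Λ z.F →ₗ[Λ] Dual Λ (LinearMap.range (z.γ ∘ₗ i)) :=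
      Dual.map (LinearMap.range (z.γ ∘ₗ i)).subtype
    have hle : LinearMap.range (z.μ ∘ₗ i) ≤ LinearMap.ker ρ := by
      rintro _ ⟨x, rfl⟩
      refine Dual.ext ?_
      rintro ⟨_, y, rfl⟩
      exact hiso x y
    let e' := (LinearMap.range (z.μ ∘ₗ i)).liftQ ρ hle
    refine ⟨LinearEquiv.ofBijective e' ⟨?_, ?_⟩, fun f => rfl⟩
    · rw [← LinearMap.ker_eq_bot]
      refine Submodule.ker_liftQ_eq_bot _ _ _ fun f hf => ?_
      -- If f vanishes on U₀, then f and μ(i(s f)) have the same image under T, so f lies in U₁.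
      refine ⟨s f, hTi (Prod.ext (hs _) (Dual.ext fun x => ?_))⟩
      have h := congrArg
        (fun φ : Dual Λ (LinearMap.range (z.γ ∘ₗ i)) => φ ⟨z.γ (i x), x, rfl⟩)
        (LinearMap.mem_ker.1 hf)
      exact (hiso _ _).trans h.symm
    · intro φ
      refine ⟨Submodule.Quotient.mk (Dual.map ((z.γ ∘ₗ i).rangeRestrict ∘ₗ r) φ), Dual.ext ?_⟩
      rintro ⟨_, x, rfl⟩
      refine congrArg φ (Subtype.ext ?_)
      exact congrArg (fun x => z.γ (i x)) (hr x)

/-- Stable version of `elementary_of_isotropic`: the isotropic map may take values in the sum of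
`z` and the negative of a form `ψ` which is stably hyperbolic. -/
theorem elementary_of_isotropic_sum [IsStablyFiniteRing Λ] (z : SplitPreformation Λ ε)
    (A : QuadForm Λ (-ε)) (L L' : FreeModule Λ)
    (hA : (A.sum (QuadForm.hyperbolic (-ε) L)).Isometric (QuadForm.hyperbolic (-ε) L'))
    {P : Type u} [AddCommGroup P] [Module Λ P] [Module.Free Λ P] [Module.Finite Λ P]
    (i : P →ₗ[Λ] z.G) (m : P →ₗ[Λ] A.M)
    (hθ : QGroup.pullback i z.θ = QGroup.pullback m A.ψ)
    (r : z.F × A.M →ₗ[Λ] P) (hr : ∀ x, r (z.γ (i x), m x) = x)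
    (s : Dual Λ z.F × A.M →ₗ[Λ] P) (hs : ∀ x, s (z.μ (i x), m x) = x)
    (e : (z.F × A.M) ≃ₗ[Λ] P × P) : (LMonoid.mk z).Elementary := by
  refine ⟨_, LMonoid.mk_sum_boundary_hyperbolic z L', ?_⟩
  obtain ⟨f, hf⟩ : ∃ f : (A.M × (L × Dual Λ L)) ≃ₗ[Λ] (L' × Dual Λ L'),
    QGroup.pullback f.toLinearMap (QGroup.hyp Λ L' (-ε)) =
      QGroup.sum A.ψ (QGroup.hyp Λ L (-ε)) := hA
  -- The sign on the factor L'^* turns the isometry into one with -H(L'), so that the contribution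
  -- of A will cancel that of θ.
  let f' : (A.M × (L × Dual Λ L)) ≃ₗ[Λ] (L' × Dual Λ L') :=
    f ≪≫ₗ (LinearEquiv.refl Λ L').prodCongr (LinearEquiv.neg Λ (M := Dual Λ L'))
  have hf' : QGroup.pullback f'.toLinearMap (QGroup.hyp Λ L' (-ε)) =
      -QGroup.sum A.ψ (QGroup.hyp Λ L (-ε)) := by
    have h : QGroup.pullback f'.toLinearMap (QGroup.hyp Λ L' (-ε)) =
      QGroup.pullback f.toLinearMap (QGroup.pullback ((LinearEquiv.refl Λ L').prodCongr
        (LinearEquiv.neg Λ (M := Dual Λ L'))).toLinearMap (QGroup.hyp Λ L' (-ε))) :=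
      (QGroup.pullback_pullback _ _ _).symm
    rw [h, QGroup.pullback_hyp_neg, map_neg, hf]
  let inc : P × L →ₗ[Λ] A.M × (L × Dual Λ L) := m.prodMap (LinearMap.inl Λ L (Dual Λ L))
  let j : P × L →ₗ[Λ] z.G × (L' × Dual Λ L') :=
    (i ∘ₗ LinearMap.fst Λ P L).prod (f'.toLinearMap ∘ₗ inc)
  -- In ∂H(L') the map γ is the identity but μ is the symmetrization; D undoes it, so that one left
  -- inverse construction serves both γ and μ.
  let D : Dual Λ (L' × Dual Λ L') ≃ₗ[Λ] (L' × Dual Λ L') :=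
    (LinearEquiv.ofBijective _ (QGroup.symm_hyp_bijective (Λ := Λ) (M := L') (ε := -ε))).symm
  have hD : ∀ v, D (QGroup.symm (QGroup.hyp Λ L' (-ε)) v) = v := fun v =>
    LinearEquiv.symm_apply_apply _ v
  -- recover `(p, l)` from its image in `A.M ⊕ L ⊕ L^*` and one further coordinate
  let c {Q : Type u} [AddCommGroup Q] [Module Λ Q] (r : Q × A.M →ₗ[Λ] P) :
      Q × (L' × Dual Λ L') →ₗ[Λ] P × L :=
    (r ∘ₗ LinearMap.id.prodMap (LinearMap.fst Λ A.M (L × Dual Λ L) ∘ₗ f'.symm.toLinearMap)).prod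
      (LinearMap.fst Λ L (Dual Λ L) ∘ₗ LinearMap.snd Λ A.M (L × Dual Λ L) ∘ₗ f'.symm.toLinearMap ∘ₗ
        LinearMap.snd Λ Q (L' × Dual Λ L'))
  have hc : ∀ {Q : Type u} [AddCommGroup Q] [Module Λ Q] (r : Q × A.M →ₗ[Λ] P) (v : Q) (x : P × L),
      r (v, m x.1) = x.1 → c r (v, f' (inc x)) = x := by
    intro Q _ _ r v x h
    refine Prod.ext ?_ ?_
    · change r (v, (f'.symm (f' (inc x))).1) = x.1
      rw [LinearEquiv.symm_apply_apply]
      exact h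
    · change (f'.symm (f' (inc x))).2.1 = x.2
      rw [LinearEquiv.symm_apply_apply]
      rfl
  obtain ⟨d⟩ := nonempty_equiv_dual Λ L
  refine elementary_of_isotropic (P := P × L) _ j ?_ (c r) ?_
    (c s ∘ₗ LinearMap.id.prodMap D.toLinearMap ∘ₗ dualProd.symm.toLinearMap) ?_ ?_
  · change QGroup.pullback j (QGroup.sum z.θ (QGroup.hyp Λ L' (-ε))) = 0
    have h1 : LinearMap.fst Λ z.G (L' × Dual Λ L') ∘ₗ j = i ∘ₗ LinearMap.fst Λ P L := rfl
    have h2 : LinearMap.snd Λ z.G (L' × Dual Λ L') ∘ₗ j = f'.toLinearMap ∘ₗ inc := rfl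
    rw [QGroup.sum, map_add, QGroup.pullback_pullback, QGroup.pullback_pullback, h1, h2,
      ← QGroup.pullback_pullback, ← QGroup.pullback_pullback, hf', map_neg, QGroup.pullback_sum,
      QGroup.pullback_inl_hyp, hθ, QGroup.sum, map_zero, add_zero, add_neg_cancel]
  · exact fun x => hc r (z.γ (i x.1)) x (hr x.1)
  · intro x
    have h := hc s (z.μ (i x.1)) x (hs x.1)
    rw [← hD (f' (inc x))] at h
    have h' : c s (LinearMap.id.prodMap D.toLinearMap
      (z.μ (i x.1), QGroup.symm (QGroup.hyp Λ L' (-ε)) (f' (inc x)))) = x := h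
    refine Eq.trans (congrArg (fun v => c s (LinearMap.id.prodMap D.toLinearMap v)) ?_) h'
    exact dualProd.symm_apply_apply
      (z.μ (i x.1), QGroup.symm (QGroup.hyp Λ L' (-ε)) (f' (inc x)))
  -- Rank count: F ⊕ H(L') ≅ F ⊕ A ⊕ L ⊕ L^*, which is (P ⊕ L) ⊕ (P ⊕ L) since L^* ≅ L.
  · exact (LinearEquiv.refl Λ z.F).prodCongr f'.symm ≪≫ₗ
      (LinearEquiv.prodAssoc Λ z.F A.M (L × Dual Λ L)).symm ≪≫ₗ
      e.prodCongr ((LinearEquiv.refl Λ L).prodCongr d.symm) ≪≫ₗ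
      LinearEquiv.prodProdProdComm Λ P P L L

end SplitPreformation

end Preformations

/-! ### The isotropic map defined by a homotopy and its left inverses. -/

section Isotropy

variable {Λ : Type u} [Ring Λ] [StarRing Λ]

theorem neg_units_smul {A : Type*} [AddCommGroup A] (e : ℤˣ) (a : A) : (-e) • a = -(e • a) := by
  rcases Int.units_eq_one_or e with rfl | rfl <;> simp

namespace SplitPreformation

variable {q : ℕ} {z : SplitPreformation Λ (sgn q)}

theorem xi_apply (θ : z.G →ₗ[Λ] Dual Λ z.G) (β : z.G →ₗ[Λ] z.G) (R : z.F →ₗ[Λ] z.G)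
    (η₀ : Dual Λ z.G →ₗ[Λ] z.G) (a a' : Dual Λ z.G) (g g' : z.G) (x x' : z.F) :
    z.xi θ β R η₀ (a, g, x) (a', g', x') =
      star (a' (-η₀ a + β g)) - sgn q • star (θ g' g) + (a (R x') + z.μ g x') := by
  rw [sub_eq_add_neg, ← neg_units_smul]
  rfl

theorem symm_θ_apply {θ : z.G →ₗ[Λ] Dual Λ z.G} (hθ : QGroup.mk (-sgn q) θ = z.θ) (g g' : z.G) :
    z.μ g (z.γ g') = θ g g' - sgn q • star (θ g' g) := by
  have h := congrArg (fun φ : Dual Λ z.G => φ g') (LinearMap.congr_fun z.symm_θ g)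
  rw [← hθ, QGroup.symm_mk] at h
  rw [sub_eq_add_neg, ← neg_units_smul]
  exact h.symm

namespace FlipIso

variable (t : FlipIso z)

theorem apply_γ_β (f : Dual Λ z.F) (g : z.G) : f (z.γ (t.β g)) = star (z.μ g (t.α.symm f)) := by
  rw [← apply_αInvDual]
  exact congrArg f (LinearMap.congr_fun t.comm_μ g).symm

/-- The part on `F^*` of the isotropic map `G ⊕ F^* → G^* ⊕ G ⊕ F` of a chain homotopy. -/
def isotropicPart (U : Dual Λ z.G →ₗ[Λ] z.F) : Dual Λ z.F →ₗ[Λ] Dual Λ z.G × z.G × z.F :=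
  (-Dual.map z.γ).prod ((sgn q • cotranspose U).prod
    (t.α.symm.toLinearMap - sgn q • (z.γ ∘ₗ cotranspose U)))

theorem isotropicPart_apply (U : Dual Λ z.G →ₗ[Λ] z.F) (f : Dual Λ z.F) :
    t.isotropicPart U f =
      (-Dual.map z.γ f, sgn q • cotranspose U f, t.α.symm f - sgn q • z.γ (cotranspose U f)) := rfl

/-- The map `G ⊕ F^* → G^* ⊕ G ⊕ F` of a chain homotopy. -/
def isotropicMap (U : Dual Λ z.G →ₗ[Λ] z.F) : z.G × Dual Λ z.F →ₗ[Λ] Dual Λ z.G × z.G × z.F :=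
  (LinearMap.inr Λ (Dual Λ z.G) (z.G × z.F) ∘ₗ LinearMap.inl Λ z.G z.F) ∘ₗ
      LinearMap.fst Λ z.G (Dual Λ z.F) +
    t.isotropicPart U ∘ₗ LinearMap.snd Λ z.G (Dual Λ z.F)

theorem isotropicMap_apply (U : Dual Λ z.G →ₗ[Λ] z.F) (g : z.G) (f : Dual Λ z.F) :
    t.isotropicMap U (g, f) = (-Dual.map z.γ f, g + sgn q • cotranspose U f,
      t.α.symm f - sgn q • z.γ (cotranspose U f)) := by
  change ((0 : Dual Λ z.G) + -Dual.map z.γ f, g + sgn q • cotranspose U f,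
    (0 : z.F) + (t.α.symm f - sgn q • z.γ (cotranspose U f))) = _
  rw [zero_add, zero_add]

/-- Isotropy on F^* is where the structure equation of the homotopy enters. `hR` and `hS` are the
F-components of h_t - 1 = dΔ + Δd in degree q; `hη₀` comes from the component s = 0, C^q → C_{q+1},
and `hH` from the component s = 1, C^q → C_q, both restricted to F^* ⊂ C^q. E and E' are parts of η₁
and H is a part of η₂; H occurs only as H + εH^*, which is zero in Q_{-ε}. -/
theorem pullback_isotropicPart (θ : z.G →ₗ[Λ] Dual Λ z.G)
    (hθ : QGroup.mk (-sgn q) θ = z.θ) (R : z.F →ₗ[Λ] z.G) (S : Dual Λ z.F →ₗ[Λ] z.G)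
    (U : Dual Λ z.G →ₗ[Λ] z.F) (η₀ : Dual Λ z.G →ₗ[Λ] z.G) (E : Dual Λ z.F →ₗ[Λ] z.G)
    (E' : Dual Λ z.G →ₗ[Λ] z.F) (H : Dual Λ z.F →ₗ[Λ] z.F)
    (hR : ∀ x, z.γ (R x) = sgn q • (x + U (transpose z.μ x)))
    (hS : ∀ f, z.γ (S f) = U (Dual.map z.γ f) - sgn q • t.αInvDual f)
    (hη₀ : ∀ f, η₀ (Dual.map z.γ f) = S f - sgn q • cotranspose U f + S (z.μ (cotranspose U f)) +
      (E f - cotranspose E' f))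
    (hH : ∀ f, E' (Dual.map z.γ f) = -(sgn q • U (Dual.map z.γ f)) -
      sgn q • U (θ (cotranspose U f)) - sgn q • z.γ (E f) + (H f + sgn q • cotranspose H f)) :
    QGroup.pullback (t.isotropicPart U)
      (QGroup.mk (-sgn q) (z.xi θ t.β.toLinearMap R η₀)) = 0 := by
  -- χ gathers the terms in θ, E and H that the relations leave over; the pulled back form is
  -- exactly χ - T_{-ε}χ = χ + εχ^*, while the remaining terms cancel.
  let χ : Dual Λ z.F →ₗ[Λ] Dual Λ (Dual Λ z.F) :=
    -(Dual.map (cotranspose U) ∘ₗ θ ∘ₗ cotranspose U) - ev (z.F : Type u) ∘ₗ z.γ ∘ₗ E +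
      sgn q • (ev (z.F : Type u) ∘ₗ H)
  have hχ : ∀ f f', χ f f' = -θ (cotranspose U f) (cotranspose U f') - star (f' (z.γ (E f))) +
      sgn q • star (f' (H f)) := fun _ _ => rfl
  rw [QGroup.pullback_mk, ← QGroup.mk_sub_eq_zero (ε := -sgn q) χ]
  congr 1
  refine LinearMap.ext fun f => Dual.ext fun f' => ?_
  rw [neg_units_smul, sub_neg_eq_add]
  change z.xi θ t.β.toLinearMap R η₀ (t.isotropicPart U f) (t.isotropicPart U f') =
    χ f f' + sgn q • star (χ f' f)
  rw [isotropicPart_apply, isotropicPart_apply, xi_apply, hχ, hχ]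
  set u := cotranspose U f with hu
  set u' := cotranspose U f' with hu'
  -- k1, k2 and k3 are `hη₀`, `hH` and `hR` evaluated on functionals; k2 is substituted into k1
  -- through the dual of E'.
  have hU : ∀ (φ : Dual Λ z.F) a, φ (U a) = star (a (cotranspose U φ)) := fun φ a => by
    rw [apply_cotranspose, star_star]
  have k3 : ∀ x, f (z.γ (R x)) = sgn q • (f x + z.μ u x) := fun x => by
    rw [hR, map_units_smul, map_add, hU, transpose_apply, star_star]
  have k5 := symm_θ_apply hθ u u'
  have hSγ : ∀ φ, f' (z.γ (S φ)) = star (φ (z.γ u')) - sgn q • star (φ (t.α.symm f')) := fun φ => by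
    rw [hS, map_sub, map_units_smul, hU, apply_αInvDual]
    rfl
  have k2 : f (E' (Dual.map z.γ f')) = -(sgn q • star (f' (z.γ u))) - sgn q • star (θ u' u) -
      sgn q • f (z.γ (E f')) + (f (H f') + sgn q • star (f' (H f))) := by
    rw [hH]
    simp only [map_add, map_sub, map_neg, map_units_smul, hU, apply_cotranspose H]
    rfl
  have k1 : f' (z.γ (η₀ (Dual.map z.γ f))) = star (f (z.γ u')) - sgn q • star (f (t.α.symm f')) -
      sgn q • f' (z.γ u) + (star (z.μ u (z.γ u')) - sgn q • star (z.μ u (t.α.symm f'))) +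
      (f' (z.γ (E f)) - star (f (E' (Dual.map z.γ f')))) := by
    have h : f' (z.γ (cotranspose E' f)) = star (f (E' (Dual.map z.γ f'))) :=
      apply_cotranspose E' f (Dual.map z.γ f')
    rw [hη₀]
    simp only [map_add, map_sub, map_units_smul, hSγ, h]
    rfl
  simp only [Dual.neg_apply, Dual.map_apply, map_neg, neg_neg, map_add, map_sub, map_units_smul,
    LinearEquiv.coe_coe, apply_γ_β, k1, k2, k3, Dual.units_smul_apply, star_add, star_sub,
    star_neg, star_units_smul, star_star, smul_add, smul_sub, smul_neg, units_smul_smul, k5]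
  abel

/-- The form splits because the images of G and F^* are orthogonal for the symmetrized ξ; this uses
γβ = α^{-*}μ and the symmetrization of θ, not the homotopy. Only θ on G remains. -/
theorem pullback_isotropicMap (θ : z.G →ₗ[Λ] Dual Λ z.G)
    (hθ : QGroup.mk (-sgn q) θ = z.θ) (R : z.F →ₗ[Λ] z.G)
    (U : Dual Λ z.G →ₗ[Λ] z.F) (η₀ : Dual Λ z.G →ₗ[Λ] z.G)
    (h : QGroup.pullback (t.isotropicPart U)
      (QGroup.mk (-sgn q) (z.xi θ t.β.toLinearMap R η₀)) = 0) :
    QGroup.pullback (t.isotropicMap U) (QGroup.mk (-sgn q) (z.xi θ t.β.toLinearMap R η₀)) =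
      QGroup.pullback (LinearMap.fst Λ z.G (Dual Λ z.F)) z.θ := by
  -- The block of ξ on G is -εθ^* = T_{-ε}θ, which has the class of θ.
  have h1 : QGroup.pullback (LinearMap.inr Λ (Dual Λ z.G) (z.G × z.F) ∘ₗ LinearMap.inl Λ z.G z.F)
      (QGroup.mk (-sgn q) (z.xi θ t.β.toLinearMap R η₀)) = z.θ := by
    rw [QGroup.pullback_mk, ← hθ, ← QGroup.mk_units_smul_transpose θ]
    congr 1
    refine LinearMap.ext fun g => Dual.ext fun g' => ?_
    change z.xi θ t.β.toLinearMap R η₀ (0, g, 0) (0, g', 0) = (-sgn q) • star (θ g' g)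
    rw [xi_apply, neg_units_smul]
    simp
  have h2 : Dual.map (t.isotropicPart U ∘ₗ LinearMap.snd Λ z.G (Dual Λ z.F)) ∘ₗ
      QGroup.symm (QGroup.mk (-sgn q) (z.xi θ t.β.toLinearMap R η₀)) ∘ₗ
      (LinearMap.inr Λ (Dual Λ z.G) (z.G × z.F) ∘ₗ LinearMap.inl Λ z.G z.F) ∘ₗ
        LinearMap.fst Λ z.G (Dual Λ z.F) = 0 := by
    refine LinearMap.ext fun ⟨g, _⟩ => Dual.ext fun ⟨_, f⟩ => ?_
    rw [QGroup.symm_mk, neg_units_smul, ← sub_eq_add_neg]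
    change z.xi θ t.β.toLinearMap R η₀ (0, g, 0) (t.isotropicPart U f) -
      sgn q • star (z.xi θ t.β.toLinearMap R η₀ (t.isotropicPart U f) (0, g, 0)) = 0
    rw [isotropicPart_apply, xi_apply, xi_apply]
    have h3 := symm_θ_apply hθ g (cotranspose U f)
    simp only [Dual.neg_apply, Dual.map_apply, map_neg, neg_neg, map_add, map_sub, map_units_smul,
      LinearEquiv.coe_coe, apply_γ_β, Dual.units_smul_apply, star_sub, map_zero,
      Dual.zero_apply, add_zero, zero_add, neg_zero, star_zero,
      star_neg, star_units_smul, star_star, smul_zero, smul_sub, units_smul_smul, h3]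
    abel
  rw [isotropicMap, QGroup.pullback_add, h2, map_zero, add_zero, ← QGroup.pullback_pullback, h1,
    ← QGroup.pullback_pullback, h, map_zero, add_zero]

/-- From (γg, j(g, f)) with last two coordinates k and y of j, the combination y + γk - γg equals
α⁻¹f. This gives f, and then g = k - εU^*f. -/
theorem exists_leftInverse_γ (U : Dual Λ z.G →ₗ[Λ] z.F) :
    ∃ r : z.F × (Dual Λ z.G × z.G × z.F) →ₗ[Λ] z.G × Dual Λ z.F,
      ∀ x, r (z.γ x.1, t.isotropicMap U x) = x := by
  let p : z.F × (Dual Λ z.G × z.G × z.F) →ₗ[Λ] z.G :=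
    LinearMap.fst Λ _ _ ∘ₗ LinearMap.snd Λ _ _ ∘ₗ LinearMap.snd Λ _ _
  let φ : z.F × (Dual Λ z.G × z.G × z.F) →ₗ[Λ] Dual Λ z.F := t.α.toLinearMap ∘ₗ
    (LinearMap.snd Λ _ _ ∘ₗ LinearMap.snd Λ _ _ ∘ₗ LinearMap.snd Λ _ _ + z.γ ∘ₗ p -
      LinearMap.fst Λ _ _)
  refine ⟨(p - sgn q • (cotranspose U ∘ₗ φ)).prod φ, fun ⟨g, f⟩ => ?_⟩
  rw [isotropicMap_apply]
  have h : t.α (t.α.symm f - sgn q • z.γ (cotranspose U f) +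
      z.γ (g + sgn q • cotranspose U f) - z.γ g) = f := by
    rw [map_add z.γ, map_units_smul z.γ,
      show t.α.symm f - sgn q • z.γ (cotranspose U f) + (z.γ g + sgn q • z.γ (cotranspose U f)) -
        z.γ g = t.α.symm f by abel, LinearEquiv.apply_symm_apply]
  refine Prod.ext ?_ h
  change g + sgn q • cotranspose U f - sgn q • cotranspose U (t.α (t.α.symm f -
    sgn q • z.γ (cotranspose U f) + z.γ (g + sgn q • cotranspose U f) - z.γ g)) = g
  rw [h, add_sub_cancel_right]

/-- Put u = U^*f. The known data μg, -γ^*f and k = g + εu determine w = μu and b = -S^*γ^*f. The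
duals of `hS` and `hV` then determine βu, hence u; finally f = εα(γu + b) and g = k - εu. -/
theorem exists_leftInverse_μ (ν : Dual Λ z.F →ₗ[Λ] z.F)
    (hν : QGroup.mk (-sgn q) (ev (z.F : Type u) ∘ₗ ν) = t.ν) (S : Dual Λ z.F →ₗ[Λ] z.G)
    (U : Dual Λ z.G →ₗ[Λ] z.F) (V : Dual Λ z.G →ₗ[Λ] Dual Λ z.F)
    (hS : ∀ f, z.γ (S f) = U (Dual.map z.γ f) - sgn q • t.αInvDual f)
    (hV : ∀ a, Dual.map t.β.symm.toLinearMap a =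
      a + transpose z.μ (U a) + sgn q • Dual.map z.γ (V a)) :
    ∃ r : Dual Λ z.F × (Dual Λ z.G × z.G × z.F) →ₗ[Λ] z.G × Dual Λ z.F,
      ∀ x, r (z.μ x.1, t.isotropicMap U x) = x := by
  let X := Dual Λ z.F × (Dual Λ z.G × z.G × z.F)
  let k : X →ₗ[Λ] z.G := LinearMap.fst Λ _ _ ∘ₗ LinearMap.snd Λ _ _ ∘ₗ LinearMap.snd Λ _ _
  let w : X →ₗ[Λ] Dual Λ z.F := sgn q • (z.μ ∘ₗ k - LinearMap.fst Λ _ _)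
  let b : X →ₗ[Λ] z.F := cotranspose S ∘ₗ LinearMap.fst Λ _ _ ∘ₗ LinearMap.snd Λ _ _
  let σ : Dual Λ z.F →ₗ[Λ] z.F := cotranspose ν - sgn q • ν
  let V' : z.F →ₗ[Λ] z.G := cotranspose V ∘ₗ ev (z.F : Type u)
  let v : X →ₗ[Λ] z.G := t.β.symm.toLinearMap ∘ₗ
    (-(sgn q • (cotranspose U ∘ₗ t.α.toLinearMap ∘ₗ (σ ∘ₗ w - b))) -
      sgn q • (V' ∘ₗ t.αInvDual ∘ₗ w))
  refine ⟨(k - sgn q • v).prod (sgn q • (t.α.toLinearMap ∘ₗ (z.γ ∘ₗ v + b))), fun ⟨g, f⟩ => ?_⟩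
  rw [isotropicMap_apply]
  set u := cotranspose U f with hu
  set x : X := (z.μ g, -Dual.map z.γ f, g + sgn q • u, t.α.symm f - sgn q • z.γ u)
  have hV' : ∀ (a : Dual Λ z.G) y, a (V' y) = V a y := fun a y => by
    change a (cotranspose V (ev (z.F : Type u) y)) = _
    rw [apply_cotranspose, ev_apply, star_star]
  have hw : w x = z.μ u := by
    change sgn q • (z.μ (g + sgn q • u) - z.μ g) = z.μ u
    rw [map_add, map_units_smul, add_sub_cancel_left, units_smul_smul]
  -- The dual of `hS`, tested on functionals.
  have hb : t.α.symm f = sgn q • (z.γ u + b x) := by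
    refine eq_of_dual_eq (Λ := Λ) fun f' => ?_
    change _ = f' (sgn q • (z.γ u + cotranspose S (-Dual.map z.γ f)))
    have h1 : f (z.γ (S f')) = star (f' (z.γ u)) - sgn q • star (f' (t.α.symm f)) := by
      rw [hS, map_sub, map_units_smul, apply_αInvDual, hu,
        show f' (z.γ (cotranspose U f)) = star (f (U (Dual.map z.γ f'))) from
          apply_cotranspose U f (Dual.map z.γ f'), star_star]
    rw [map_units_smul, map_add, map_neg (cotranspose S), map_neg f', apply_cotranspose,
      Dual.map_apply, h1, star_sub, star_units_smul, star_star, star_star, ← sub_eq_add_neg,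
      sub_sub_cancel, units_smul_smul]
  -- The flip relation expresses μβu through γu and μu; by `hb` the term in γu is f up to known
  -- data.
  have hμβ : z.μ (t.β u) = f + sgn q • t.α (σ (w x) - b x) := by
    have h1 : f = t.α (sgn q • (z.γ u + b x)) := by rw [← hb, LinearEquiv.apply_symm_apply]
    rw [μ_β hν, hw]
    conv_rhs => rw [h1]
    rw [map_units_smul t.α, ← smul_add, ← map_add]
    congr 2
    change z.γ u + σ (z.μ u) = _
    abel
  -- The dual of `hV`, evaluated at βu.
  have hβ : u = t.β u + cotranspose U (z.μ (t.β u)) + sgn q • V' (z.γ (t.β u)) := by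
    refine eq_of_dual_eq (Λ := Λ) fun a => ?_
    have h := congrArg (fun φ : Dual Λ z.G => φ (t.β u)) (hV a)
    simp only [Dual.map_apply, Dual.add_apply, Dual.units_smul_apply, transpose_apply,
      LinearEquiv.coe_coe, LinearEquiv.symm_apply_apply] at h
    rw [map_add, map_add, map_units_smul, hV', apply_cotranspose U (z.μ (t.β u)) a]
    exact h
  have hv : v x = u := by
    change t.β.symm (-(sgn q • cotranspose U (t.α (σ (w x) - b x))) -
      sgn q • V' (t.αInvDual (w x))) = u
    have h1 : t.αInvDual (z.μ u) = z.γ (t.β u) := LinearMap.congr_fun t.comm_μ u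
    rw [LinearEquiv.symm_apply_eq, hw, h1, ← hw]
    -- Since U^*f = u, the unknown u cancels on both sides, and βu is left as an expression in w and
    -- b.
    rw [hμβ, map_add, map_units_smul, ← hu] at hβ
    have h2 := sub_eq_zero.2 hβ
    rw [← sub_eq_zero, ← h2]
    abel
  refine Prod.ext ?_ ?_
  · change g + sgn q • u - sgn q • v x = g
    rw [hv, add_sub_cancel_right]
  · change sgn q • t.α (z.γ (v x) + b x) = f
    rw [hv, ← map_units_smul, ← hb, LinearEquiv.apply_symm_apply]

/-- α identifies F with F^* and a choice of basis identifies G^* with G; this is the half-rank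
condition of the elementarity criterion. -/
theorem nonempty_rank_equiv (t : FlipIso z) :
    Nonempty ((z.F × (Dual Λ z.G × z.G × z.F)) ≃ₗ[Λ]
      (z.G × Dual Λ z.F) × (z.G × Dual Λ z.F)) := by
  obtain ⟨d⟩ := nonempty_equiv_dual Λ z.G
  exact ⟨(LinearEquiv.prodAssoc Λ z.F (Dual Λ z.G) (z.G × z.F)).symm ≪≫ₗ
    (LinearEquiv.prodComm Λ z.F (Dual Λ z.G) ≪≫ₗ d.symm.prodCongr t.α).prodCongr
      ((LinearEquiv.refl Λ z.G).prodCongr t.α)⟩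

end FlipIso

end SplitPreformation

end Isotropy

/-! ### From a homotopy of quadratic complexes to an h-lagrangian. -/

section Relations

variable {Λ : Type u} [Ring Λ] [StarRing Λ]

namespace SplitPreformation

variable {q : ℕ} {z : SplitPreformation Λ (sgn q)}

/-- The criterion `elementary_of_isotropic_sum` applied to the projection G ⊕ F^* → G and the
isotropic map into (M, ξ): both pull back to the same class. -/
theorem elementary_of_form_stably_hyperbolic [IsStablyFiniteRing Λ] (t : FlipIso z)
    (θ : z.G →ₗ[Λ] Dual Λ z.G) (hθ : QGroup.mk (-sgn q) θ = z.θ)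
    (ν : Dual Λ z.F →ₗ[Λ] z.F) (hν : QGroup.mk (-sgn q) (ev (z.F : Type u) ∘ₗ ν) = t.ν)
    (R : z.F →ₗ[Λ] z.G) (S : Dual Λ z.F →ₗ[Λ] z.G)
    (U : Dual Λ z.G →ₗ[Λ] z.F) (V : Dual Λ z.G →ₗ[Λ] Dual Λ z.F)
    (η₀ : Dual Λ z.G →ₗ[Λ] z.G) (E : Dual Λ z.F →ₗ[Λ] z.G)
    (E' : Dual Λ z.G →ₗ[Λ] z.F) (H : Dual Λ z.F →ₗ[Λ] z.F)
    (hR : ∀ x, z.γ (R x) = sgn q • (x + U (transpose z.μ x)))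
    (hS : ∀ f, z.γ (S f) = U (Dual.map z.γ f) - sgn q • t.αInvDual f)
    (hV : ∀ a, Dual.map t.β.symm.toLinearMap a =
      a + transpose z.μ (U a) + sgn q • Dual.map z.γ (V a))
    (hη₀ : ∀ f, η₀ (Dual.map z.γ f) = S f - sgn q • cotranspose U f + S (z.μ (cotranspose U f)) +
      (E f - cotranspose E' f))
    (hH : ∀ f, E' (Dual.map z.γ f) = -(sgn q • U (Dual.map z.γ f)) -
      sgn q • U (θ (cotranspose U f)) - sgn q • z.γ (E f) + (H f + sgn q • cotranspose H f))
    (L L' : FreeModule Λ)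
    (hL : ((⟨⟨Dual Λ z.G × z.G × z.F⟩, QGroup.mk (-sgn q) (z.xi θ t.β.toLinearMap R η₀)⟩ :
      QuadForm Λ (-sgn q)).sum (QuadForm.hyperbolic (-sgn q) L)).Isometric
        (QuadForm.hyperbolic (-sgn q) L')) : (LMonoid.mk z).Elementary := by
  obtain ⟨r, hr⟩ := t.exists_leftInverse_γ U
  obtain ⟨s, hs⟩ := t.exists_leftInverse_μ ν hν S U V hS hV
  obtain ⟨e⟩ := t.nonempty_rank_equiv
  exact z.elementary_of_isotropic_sum _ L L' hL (LinearMap.fst Λ z.G (Dual Λ z.F))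
    (t.isotropicMap U) (t.pullback_isotropicMap θ hθ R U η₀
      (t.pullback_isotropicPart θ hθ R S U η₀ E E' H hR hS hη₀ hH)).symm r hr s hs e

theorem cotranspose_psiTerm_one (θ : z.G →ₗ[Λ] Dual Λ z.G) (Ψ : Dual Λ (Dual Λ z.G)) :
    cotranspose (z.psiTerm θ 1 .middle .lower) Ψ =
      (show z.F × Dual Λ z.F from (sgn q • z.γ ((evEquiv z.G).symm Ψ), 0)) := by
  refine eq_of_dual_eq (Λ := Λ) (M := z.F × Dual Λ z.F) fun φ => ?_
  let p : Dual Λ (z.F × Dual Λ z.F) →ₗ[Λ] Dual Λ z.G := z.psiTerm θ 1 .middle .lower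
  refine Eq.trans (apply_cotranspose p Ψ φ) ?_
  change star (Ψ (sgn q • Dual.map z.γ (Dual.map (LinearMap.inl Λ z.F (Dual Λ z.F)) φ))) = _
  rw [map_units_smul, star_units_smul, ← apply_evEquiv_symm, ← map_units_smul]
  have e : ((sgn q • z.γ ((evEquiv z.G).symm Ψ), 0) : z.F × Dual Λ z.F) =
      sgn q • (z.γ ((evEquiv z.G).symm Ψ), 0) := Prod.ext rfl (smul_zero _).symm
  refine Eq.trans ?_ (congrArg φ e.symm)
  rw [map_units_smul, map_units_smul]
  rfl

/-- The sign (-1)^{(q-1)(q-1)} = -ε in Tψ₂ cancels the sign of ψ₂ = -εθ^*, so that θ itself appears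
in the structure equation. -/
theorem cotranspose_psiTerm_two (θ : z.G →ₗ[Λ] Dual Λ z.G) (g : z.G) :
    (-sgn q) • cotranspose (z.psiTerm θ 2 .lower .lower) (ev (z.G : Type u) g) =
      (show Dual Λ z.G from θ g) := by
  refine Dual.ext fun (g' : z.G) => ?_
  let p : Dual Λ (Dual Λ z.G) →ₗ[Λ] Dual Λ z.G := z.psiTerm θ 2 .lower .lower
  have k := apply_cotranspose p (ev (z.G : Type u) g) (ev (z.G : Type u) g')
  have k' : p (ev (z.G : Type u) g') = (-sgn q) • transpose θ g' :=
    congrArg (fun x => (-sgn q) • transpose θ x) (evEquiv_symm_ev (Λ := Λ) g')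
  rw [k', ev_apply, ev_apply, Dual.units_smul_apply, star_units_smul, star_units_smul, star_star,
    transpose_apply] at k
  have k2 := star_injective (k.trans (star_units_smul _ _).symm)
  change (-sgn q) • cotranspose p (ev (z.G : Type u) g) g' = θ g g'
  rw [k2, units_smul_smul]

/-- Extracts the relations for R, S, U, V and the parts of η from the matrix equations. The
positions u, m, l are variables because `deg q (q + 1)` does not reduce to a constructor for
variable q; after substitution the terms are definitionally G, F ⊕ F^* and G^*. -/
theorem elementary_of_homotopy_relations [IsStablyFiniteRing Λ] (t : FlipIso z)
    (θ : z.G →ₗ[Λ] Dual Λ z.G) (hθ : QGroup.mk (-sgn q) θ = z.θ) (ν : Dual Λ z.F →ₗ[Λ] z.F)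
    (hν : QGroup.mk (-sgn q) (ev (z.F : Type u) ∘ₗ ν) = t.ν) (κ : z.G →ₗ[Λ] Dual Λ z.G) {u m l :
    Deg}
    (hu : u = .upper) (hm : m = .middle) (hl : l = .lower)
    (D₁ : z.term m →ₗ[Λ] z.term u) (D₀ : z.term l →ₗ[Λ] z.term m)
    (e₀ : Dual Λ (z.term u) →ₗ[Λ] z.term u) (e₁ : Dual Λ (z.term m) →ₗ[Λ] z.term u)
    (e₁' : Dual Λ (z.term u) →ₗ[Λ] z.term m) (e₂ : Dual Λ (z.term m) →ₗ[Λ] z.term m)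
    (h1 : t.hTerm ν u = D₁ ∘ₗ z.diff u m + LinearMap.id)
    (h2 : t.hTerm ν m = D₀ ∘ₗ z.diff m l + z.diff u m ∘ₗ D₁ + LinearMap.id)
    (h0 : t.hTerm ν l = z.diff m l ∘ₗ D₀ + LinearMap.id)
    (h3 : 0 = -(D₁ ∘ₗ z.psiTerm θ 0 m m) + sgn q • ((t.hTerm ν u ∘ₗ z.psiTerm θ 0 l u +
      D₁ ∘ₗ cotranspose (z.psiTerm θ 1 m l)) ∘ₗ Dual.map D₀) +
      ((-sgn q) • (e₀ ∘ₗ Dual.map (z.diff u m)) - (e₁ - cotranspose e₁')))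
    (h4 : t.chiTerm θ ν κ 1 m m = -(D₀ ∘ₗ z.psiTerm θ 1 m l) +
      (-sgn q) • ((t.hTerm ν m ∘ₗ z.psiTerm θ 1 l m +
        D₀ ∘ₗ ((-sgn q) • cotranspose (z.psiTerm θ 2 l l))) ∘ₗ Dual.map D₀) +
      (z.diff u m ∘ₗ e₁ + sgn q • (e₁' ∘ₗ Dual.map (z.diff u m)) +
        (e₂ + sgn q • cotranspose e₂)))
    (L L' : FreeModule Λ)
    (hL : ((⟨⟨Dual Λ z.G × z.G × z.F⟩, QGroup.mk (-sgn q) (z.xi θ t.β.toLinearMap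
      ((z.castTerm hu).toLinearMap ∘ₗ D₁ ∘ₗ (z.castTerm hm).symm.toLinearMap ∘ₗ
        LinearMap.inl Λ z.F (Dual Λ z.F))
      ((z.castTerm hu).toLinearMap ∘ₗ e₀ ∘ₗ Dual.map (z.castTerm hu).toLinearMap))⟩ :
      QuadForm Λ (-sgn q)).sum (QuadForm.hyperbolic (-sgn q) L)).Isometric
        (QuadForm.hyperbolic (-sgn q) L')) : (LMonoid.mk z).Elementary := by
  subst hu hm hl
  let D1 : z.F × Dual Λ z.F →ₗ[Λ] z.G := D₁
  let D0 : Dual Λ z.G →ₗ[Λ] z.F × Dual Λ z.F := D₀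
  let η₀ : Dual Λ z.G →ₗ[Λ] z.G := e₀
  let E1 : Dual Λ (z.F × Dual Λ z.F) →ₗ[Λ] z.G := e₁
  let E1' : Dual Λ z.G →ₗ[Λ] z.F × Dual Λ z.F := e₁'
  let E2 : Dual Λ (z.F × Dual Λ z.F) →ₗ[Λ] z.F × Dual Λ z.F := e₂
  let fst := LinearMap.fst Λ z.F (Dual Λ z.F)
  let U := fst ∘ₗ D0
  have key : ∀ g, t.β g = g - sgn q • (D1 (z.γ g, 0) + D1 (0, z.μ g)) := by
    intro g
    have h : t.β g = D1 ((-sgn q) • (z.γ g, z.μ g)) + g := LinearMap.congr_fun h1 g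
    have h' : D1 (z.γ g, z.μ g) = D1 (z.γ g, 0) + D1 (0, z.μ g) := by
      rw [← map_add, Prod.mk_add_mk, add_zero, zero_add]
    rw [h, map_units_smul, Units.neg_smul, h', add_comm, ← sub_eq_add_neg]
  have hmid : ∀ (x : z.F) (f : Dual Λ z.F), ((t.αInvDual f,
      sgn q • t.α x + sgn q • t.α ((cotranspose ν - sgn q • ν) f)) : z.F × Dual Λ z.F) =
      D0 (transpose z.μ x + sgn q • Dual.map z.γ f) +
        (-sgn q) • (z.γ (D1 (x, f)), z.μ (D1 (x, f))) + (x, f) := fun x f =>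
    LinearMap.congr_fun h2 (show z.F × Dual Λ z.F from (x, f))
  have hpsi := cotranspose_psiTerm_one (z := z) θ
  have hpsi₂ := cotranspose_psiTerm_two (z := z) θ
  have hdual : ∀ f : Dual Λ z.F, Dual.map (z.diff .upper .middle) (Dual.map fst f) =
      (-sgn q) • Dual.map z.γ f := by
    intro f
    refine Dual.ext fun (g : z.G) => ?_
    change f ((-sgn q) • z.γ g) = (-sgn q) • f (z.γ g)
    rw [map_units_smul]
  refine elementary_of_form_stably_hyperbolic t θ hθ ν hν
    (D1 ∘ₗ LinearMap.inl Λ z.F (Dual Λ z.F)) (D1 ∘ₗ LinearMap.inr Λ z.F (Dual Λ z.F)) U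
    (LinearMap.snd Λ z.F (Dual Λ z.F) ∘ₗ D0) η₀ (E1 ∘ₗ Dual.map fst) (fst ∘ₗ E1')
    (fst ∘ₗ E2 ∘ₗ Dual.map fst) ?_ ?_ ?_ ?_ ?_ L L' hL
  · intro x
    have h' := congrArg Prod.fst (hmid x 0)
    simp only [map_zero, smul_zero, add_zero, Prod.fst_add, Units.neg_smul] at h'
    change z.γ (D1 (x, 0)) = sgn q • (x + (D0 (transpose z.μ x)).1)
    rw [← units_smul_smul (sgn q) (z.γ (D1 (x, 0)))]
    congr 1
    rw [← sub_eq_zero, ← neg_eq_zero]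
    refine Eq.trans ?_ h'.symm
    simp only [Prod.fst_neg, Prod.smul_fst]
    abel
  · intro f
    have h' := congrArg Prod.fst (hmid 0 f)
    simp only [map_zero, zero_add, add_zero, Prod.fst_add, map_units_smul,
      Prod.smul_fst, Prod.fst_neg, neg_units_smul] at h'
    change z.γ (D1 (0, f)) = (D0 (Dual.map z.γ f)).1 - sgn q • t.αInvDual f
    rw [h', smul_add, smul_neg, units_smul_smul, units_smul_smul]
    abel
  · intro a
    have h : Dual.map t.β.symm.toLinearMap a =
      (transpose z.μ (U a) + sgn q • Dual.map z.γ (D0 a).2) + a := LinearMap.congr_fun h0 a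
    rw [h]
    change _ = a + transpose z.μ (U a) + sgn q • Dual.map z.γ (D0 a).2
    abel
  · intro f
    have k3 : 0 = -(D1 (0, f)) + sgn q • (t.β (cotranspose U f) +
        D1 (sgn q • z.γ (cotranspose U f), 0)) +
        ((-sgn q) • η₀ ((-sgn q) • Dual.map z.γ f) -
          (E1 (Dual.map fst f) - cotranspose E1' (Dual.map fst f))) := by
      have k := LinearMap.congr_fun h3 (Dual.map fst f)
      have hpsi' := congrArg D1 (hpsi (Dual.map D0 (Dual.map fst f)))
      have hd' := congrArg η₀ (hdual f)
      change D1 (cotranspose (z.psiTerm θ 1 .middle .lower) (Dual.map D0 (Dual.map fst f))) =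
        D1 (sgn q • z.γ (cotranspose U f), 0) at hpsi'
      rw [← hpsi', ← hd']
      exact k
    have e3 : ∀ x : z.F, D1 (sgn q • x, 0) = sgn q • D1 (x, 0) := fun x => by
      rw [← map_units_smul]
      exact congrArg D1 (Prod.ext rfl (smul_zero _).symm)
    have e4 : cotranspose (fst ∘ₗ E1') f = cotranspose E1' (Dual.map fst f) := rfl
    rw [key, e3, map_units_smul, units_smul_smul] at k3
    rw [e4]
    change η₀ (Dual.map z.γ f) = D1 (0, f) - sgn q • cotranspose U f + D1 (0,
    z.μ (cotranspose U f)) +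
      (E1 (Dual.map fst f) - cotranspose E1' (Dual.map fst f))
    simp only [smul_add, smul_sub, units_smul_smul] at k3
    rw [← sub_eq_zero]
    refine Eq.trans ?_ k3.symm
    abel
  · intro f
    let Φ := Dual.map fst f
    let H : z.F × Dual Λ z.F →ₗ[Λ] z.F × Dual Λ z.F := t.hTerm ν .middle
    let X : z.F × Dual Λ z.F := t.chiTerm θ ν κ 1 .middle .middle Φ
    -- χ_{t,1} takes values in the summand F^*, so the left side of the F-component vanishes.
    have hX : X.1 = 0 := rfl
    -- Under G^{**} = G, the dual of Δ in degree q - 1 sends f to U^*f.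
    have hΦ : Dual.map D0 Φ = ev (z.G : Type u) (cotranspose U f) :=
      (ev_evEquiv_symm (Λ := Λ) (Dual.map D0 Φ)).symm
    have hval : (-sgn q) • cotranspose (z.psiTerm θ 2 .lower .lower) (Dual.map D0 Φ) =
        (show Dual Λ z.G from θ (cotranspose U f)) := by
      rw [hΦ]
      exact hpsi₂ _
    have k : X = -(D0 (sgn q • Dual.map z.γ f)) +
        (-sgn q) • (H 0 + D0 ((-sgn q) • cotranspose (z.psiTerm θ 2 .lower .lower)
          (Dual.map D0 Φ))) +
        ((-sgn q) • (z.γ (E1 Φ), z.μ (E1 Φ)) + sgn q • E1' (Dual.map (z.diff .upper .middle) Φ) +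
          (E2 Φ + sgn q • cotranspose E2 Φ)) := LinearMap.congr_fun h4 Φ
    have hval' := congrArg D0 hval
    have hd' := congrArg E1' (hdual f)
    rw [hval', hd', map_zero, zero_add] at k
    have k' := congrArg Prod.fst k
    simp only [hX, Prod.fst_add, Prod.fst_neg, Prod.smul_fst, map_units_smul, map_neg,
      neg_units_smul, smul_neg, units_smul_smul] at k'
    have e4 : cotranspose (fst ∘ₗ E2 ∘ₗ Dual.map fst) f = (cotranspose E2 Φ).1 :=
      eq_of_dual_eq (Λ := Λ) fun φ => (apply_cotranspose (fst ∘ₗ E2 ∘ₗ Dual.map fst) f φ).trans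
        (apply_cotranspose E2 Φ (Dual.map fst φ)).symm
    rw [e4]
    change (E1' (Dual.map z.γ f)).1 = -(sgn q • (D0 (Dual.map z.γ f)).1) -
      sgn q • (D0 (θ (cotranspose U f))).1 - sgn q • z.γ (E1 Φ) +
        ((E2 Φ).1 + sgn q • (cotranspose E2 Φ).1)
    rw [← sub_eq_zero, ← neg_eq_zero]
    refine Eq.trans ?_ k'.symm
    abel

/-- The components of the structure equation of a homotopy `(1, 0) ≃ (f, χ)`. -/
theorem _root_.AlgebraicSurgery.QuadraticHomotopy.component {C : ChainComplex (ModuleCat.{u} Λ) ℤ}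
    [∀ r, Module.Free Λ (C.X r)] [∀ r, Module.Finite Λ (C.X r)]
    {n : ℤ} {ψ : W C n} {f : C ⟶ C} {χ : W C (n + 1)} (K : QuadraticHomotopy n ψ (𝟙 C) 0 f χ)
    {s : ℕ} {p r p' r' p'' r'' : ℤ} (h : p + r + s = n + 1)
    (hp : p - 1 = p') (hr : r - 1 = r') (hp' : p + 1 = p'') (hr' : r + 1 = r'')
    {e e₁ e₂ e₃ e₄ : ℤˣ} (he : r.negOnePow = e) (hn : Even n)
    (h₁ : (p' * r').negOnePow = e₁) (h₂ : (n + 2 - s - 1).negOnePow = e₂)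
    (h₃ : ((s : ℤ) + 1).negOnePow = e₃) (h₄ : (p * r).negOnePow = e₄) :
    χ ⟨s, p, r, h⟩ = (-((K.Δ.hom r' r).hom ∘ₗ ψ ⟨s, p, r', by omega⟩) +
        (-e) • (((f.f r).hom ∘ₗ ψ ⟨s, p', r, by omega⟩ +
          (K.Δ.hom r' r).hom ∘ₗ (e₁ • cotranspose (ψ ⟨s + 1, r', p', by omega⟩))) ∘ₗ
          Dual.map (K.Δ.hom p' p).hom)) +
      ((C.d r'' r).hom ∘ₗ K.η ⟨s, p, r'', by omega⟩ +
        e • (K.η ⟨s, p'', r, by omega⟩ ∘ₗ Dual.map (C.d p'' p).hom) +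
        e₂ • (K.η ⟨s + 1, p, r, by omega⟩ +
          e₃ • e₄ • cotranspose (K.η ⟨s + 1, r, p, by omega⟩))) := by
  have k := (congrFun K.eq ⟨s, p, r, h⟩).trans (congrArg₂ (· + ·)
    (W.homotopyOp_apply K.Δ rfl ψ h hp hr) (W.d_apply _ K.η h hp' hr'))
  rw [sub_zero, Int.negOnePow_succ, he, Int.negOnePow_even n hn, h₁, h₂, h₃, h₄, one_smul] at k
  exact k

/-- A vanishing signature means that ξ is stably hyperbolic; the chain homotopy in the three degrees
and two components of the structure equation supply everything else. -/
theorem elementary_of_quadraticSignature_eq_zero [IsStablyFiniteRing Λ] (t : FlipIso z)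
    (c : RelBoundaryChoices t) (hc : quadraticSignature t c = 0) : (LMonoid.mk z).Elementary := by
  obtain ⟨L, L', hL⟩ := (LGroup.mk_eq_zero_iff _).1 hc
  have hl : deg q (q - 1) = .lower := by simp [deg]; omega
  have hX : ∀ x : z.complex.X (q + 2), x = 0 := by
    have : deg q (q + 2) = .other := by simp [deg]; omega
    change ∀ x : z.term (deg q (q + 2)), x = 0
    rw [this]
    exact fun x => Subsingleton.elim (α := PUnit) x 0
  have hX' : ∀ x : z.complex.X (q - 2), x = 0 := by
    have : deg q (q - 2) = .other := by simp [deg]; omega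
    change ∀ x : z.term (deg q (q - 2)), x = 0
    rw [this]
    exact fun x => Subsingleton.elim (α := PUnit) x 0
  have hn : (q : ℤ).negOnePow = sgn q := RelBoundaryChoices.negOnePow_q
  have e1 : ((q : ℤ) + 1).negOnePow = -sgn q := by rw [Int.negOnePow_succ, hn]
  have hd : ∀ x, (z.complex.d (q + 2) (q + 1)).hom x = 0 := fun x => by rw [hX x, map_zero]
  have e6 : ((q : ℤ) * (q + 1)).negOnePow = 1 := Int.negOnePow_even _ (Int.even_mul_succ_self _)
  have e9 : (((q : ℤ) - 1) * q).negOnePow = 1 := by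
    rw [mul_comm, Int.negOnePow_even _ (Int.even_mul_pred_self _)]
  have hchi : ∀ i j : Deg, t.chiTerm c.θ c.ν c.κ 0 i j = 0 := by
    intro i j
    cases i <;> cases j <;> rfl
  refine elementary_of_homotopy_relations t c.θ c.mk_θ c.ν c.mk_ν c.κ (deg_upper q) (deg_middle q)
    hl
    (c.homotopy.Δ.hom q (q + 1)).hom (c.homotopy.Δ.hom (q - 1) q).hom
    (c.homotopy.η ⟨0, q + 1, q + 1, by push_cast; ring⟩)
    (c.homotopy.η ⟨1, q, q + 1, by push_cast; ring⟩)
    (c.homotopy.η ⟨1, q + 1, q, by push_cast; ring⟩)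
    (c.homotopy.η ⟨2, q, q, by push_cast; ring⟩) ?_ ?_ ?_ ?_ ?_ L L' hL
  · have h := c.homotopy.Δ.comm (q + 1)
    rw [dNext_eq c.homotopy.Δ.hom (show (ComplexShape.down ℤ).Rel (q + 1 : ℤ) q from rfl),
      prevD_eq c.homotopy.Δ.hom (show (ComplexShape.down ℤ).Rel (q + 2 : ℤ) (q + 1) from by
        change (q + 1 + 1 : ℤ) = q + 2; ring)] at h
    have h0 : c.homotopy.Δ.hom (q + 1) (q + 2) ≫ z.complex.d (q + 2) (q + 1) = 0 :=
      ModuleCat.hom_ext (LinearMap.ext fun x => hd _)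
    rw [h0, add_zero] at h
    exact congrArg ModuleCat.Hom.hom h
  · have h := c.homotopy.Δ.comm q
    rw [dNext_eq c.homotopy.Δ.hom (show (ComplexShape.down ℤ).Rel (q : ℤ) (q - 1) from by
        change (q - 1 + 1 : ℤ) = q; ring),
      prevD_eq c.homotopy.Δ.hom (show (ComplexShape.down ℤ).Rel (q + 1 : ℤ) q from rfl)] at h
    exact congrArg ModuleCat.Hom.hom h
  · have h := c.homotopy.Δ.comm (q - 1)
    rw [dNext_eq c.homotopy.Δ.hom (show (ComplexShape.down ℤ).Rel (q - 1 : ℤ) (q - 2) from by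
        change (q - 2 + 1 : ℤ) = q - 1; ring),
      prevD_eq c.homotopy.Δ.hom (show (ComplexShape.down ℤ).Rel (q : ℤ) (q - 1) from by
        change (q - 1 + 1 : ℤ) = q; ring)] at h
    have h0 : z.complex.d (q - 1) (q - 2) ≫ c.homotopy.Δ.hom (q - 2) (q - 1) = 0 :=
      ModuleCat.hom_ext (LinearMap.ext fun x => by
        change (c.homotopy.Δ.hom (q - 2) (q - 1)).hom ((z.complex.d (q - 1) (q - 2)).hom x) = 0
        rw [hX' ((z.complex.d (q - 1) (q - 2)).hom x), map_zero])
    rw [h0, zero_add] at h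
    exact congrArg ModuleCat.Hom.hom h
  · exact c.homotopy.eq_apply_left (p := q) (r := q + 1) (p' := q - 1) (r' := q)
      (p'' := q + 1) (r'' := q + 2) (by push_cast; ring) rfl (by ring) rfl (by ring)
      (hchi _ _) e1 (even_two_mul _) e6 e9 hd
  -- Signs for s = 1, p = r = q: (-1)^{(q-1)(q-1)} = -ε and (-1)^{q·q} = ε, while the exponents 2q
  -- and 2 are even.
  · have k := c.homotopy.component (s := 1) (p := q) (r := q) (p' := q - 1) (r' := q - 1)
      (p'' := q + 1) (r'' := q + 1) (e₁ := -sgn q) (e₂ := 1) (e₃ := 1) (e₄ := sgn q)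
      (by push_cast; ring) rfl rfl rfl rfl hn (even_two_mul _)
      (by
        have : (((q : ℤ) - 1) * (q - 1)) = q * (q - 1) - q + 1 := by ring
        rw [this, Int.negOnePow_succ, Int.negOnePow_sub, hn,
          Int.negOnePow_even _ (Int.even_mul_pred_self _), one_mul])
      (Int.negOnePow_even _ ⟨q, by push_cast; ring⟩) (Int.negOnePow_even _ ⟨1, by simp⟩)
      (by
        have : (q : ℤ) * q = q * (q - 1) + q := by ring
        rw [this, Int.negOnePow_add, hn, Int.negOnePow_even _ (Int.even_mul_pred_self _), one_mul])
    rw [one_smul, one_smul] at k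
    exact k

end SplitPreformation

end Relations

/-! ### The normal form of an elementary preformation and its flip-isomorphism. -/

section Double

variable {Λ : Type u} [Ring Λ] [StarRing Λ]
variable {M N : Type u} [AddCommGroup M] [Module Λ M] [AddCommGroup N] [Module Λ N]

/-- The identification `M^* ⊕ M ≅ (M ⊕ M^*)^*`. -/
def dualHyp [Module.Free Λ M] [Module.Finite Λ M] :
    (Dual Λ M × M) ≃ₗ[Λ] Dual Λ (M × Dual Λ M) :=
  (LinearEquiv.refl Λ (Dual Λ M)).prodCongr (evEquiv M) ≪≫ₗ dualProd

@[simp] theorem dualHyp_apply [Module.Free Λ M] [Module.Finite Λ M] (φ ψ : Dual Λ M) (u x : M) :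
    dualHyp (φ, u) (x, ψ) = φ x + star (ψ u) := rfl

variable (Λ) in
/-- The data of a preformation `(U^* ← K → U, θ)` from which an elementary preformation is built. -/
structure DoubleData (ε : ℤˣ) where
  U : FreeModule Λ
  K : FreeModule Λ
  b : K →ₗ[Λ] Dual Λ U
  d : K →ₗ[Λ] U
  θ : K →ₗ[Λ] Dual Λ K
  symm_θ : ∀ k k', θ k k' - ε • star (θ k' k) = star (b k' (d k))

namespace DoubleData

variable {ε : ℤˣ} (D : DoubleData Λ ε)

/-- The map `(1 0; 0 b) : U ⊕ K → U ⊕ U^*`. -/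
def γ : D.U × D.K →ₗ[Λ] D.U × Dual Λ D.U := LinearMap.id.prodMap D.b

/-- The map `(0 -εb; 1 d) : U ⊕ K → U^* ⊕ U`. -/
def μ : D.U × D.K →ₗ[Λ] Dual Λ (D.U × Dual Λ D.U) :=
  dualHyp.toLinearMap ∘ₗ ((-(ε • D.b)) ∘ₗ LinearMap.snd Λ D.U D.K).prod (LinearMap.id.coprod D.d)

/-- The quadratic refinement `(0 -εb; 0 θ)` on `U ⊕ K`. -/
def Θ : D.U × D.K →ₗ[Λ] Dual Λ (D.U × D.K) :=
  dualProd.toLinearMap ∘ₗ (-(ε • D.b)).prod D.θ ∘ₗ LinearMap.snd Λ D.U D.K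

theorem γ_apply (u : D.U) (k : D.K) : D.γ (u, k) = (u, D.b k) := rfl

theorem μ_apply (u : D.U) (k : D.K) : D.μ (u, k) = dualHyp (-(ε • D.b k), u + D.d k) := rfl

theorem Θ_apply (u : D.U) (k : D.K) : D.Θ (u, k) = dualProd (-(ε • D.b k), D.θ k) := rfl

/-- The preformation on `F = U ⊕ U^*` and `G = U ⊕ K`. -/
def toPreformation : SplitPreformation Λ ε where
  F := ⟨D.U × Dual Λ D.U⟩
  G := ⟨D.U × D.K⟩
  γ := D.γ
  μ := D.μ
  θ := QGroup.mk (-ε) D.Θ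
  symm_θ := by
    refine LinearMap.ext fun ⟨u, k⟩ => Dual.ext fun ⟨u', k'⟩ => ?_
    change D.Θ (u, k) (u', k') + (-ε) • star (D.Θ (u', k') (u, k)) = D.μ (u, k) (D.γ (u', k'))
    rw [Θ_apply, Θ_apply, μ_apply, γ_apply, dualProd_apply, dualProd_apply, dualHyp_apply]
    simp only [map_add, Dual.neg_apply, Dual.units_smul_apply, star_add, star_neg, star_units_smul,
      smul_add, smul_neg, neg_units_smul, units_smul_smul, neg_neg, ← D.symm_θ]
    abel

theorem map_γ (φ : Dual Λ D.U) (u : D.U) :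
    Dual.map D.γ (dualHyp (φ, u)) = dualProd (φ, transpose D.b u) := rfl

theorem transpose_μ (x : D.U) (ψ : Dual Λ D.U) :
    transpose D.μ (x, ψ) = dualProd (ψ, Dual.map D.d ψ - ε • transpose D.b x) := by
  refine Dual.ext fun ⟨u, k⟩ => ?_
  rw [transpose_apply, μ_apply, dualHyp_apply, dualProd_apply]
  simp only [Dual.neg_apply, Dual.units_smul_apply, star_add, star_neg, star_units_smul, star_star,
    map_add, Dual.sub_apply, Dual.map_apply, transpose_apply]
  abel

theorem transpose_Θ (u : D.U) (k : D.K) :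
    transpose D.Θ (u, k) = dualProd (0, -(ε • transpose D.b u) + transpose D.θ k) := by
  refine Dual.ext fun ⟨u', k'⟩ => ?_
  rw [transpose_apply, Θ_apply, dualProd_apply, dualProd_apply]
  simp only [Dual.neg_apply, Dual.units_smul_apply, star_add, star_neg, star_units_smul,
    Dual.zero_apply, zero_add, Dual.add_apply, transpose_apply]

/-- The isomorphism `α : U ⊕ U^* → U^* ⊕ U`, `(x, ψ) ↦ (-ψ, -εx)`. -/
def α : (D.U × Dual Λ D.U) ≃ₗ[Λ] Dual Λ (D.U × Dual Λ D.U) :=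
  LinearEquiv.ofLinearMap
    ((-LinearMap.snd Λ D.U (Dual Λ D.U)).prod (-(ε • LinearMap.fst Λ D.U (Dual Λ D.U))))
    ((-(ε • LinearMap.snd Λ (Dual Λ D.U) D.U)).prod (-LinearMap.fst Λ (Dual Λ D.U) D.U))
    (LinearMap.ext fun x => Prod.ext (neg_neg _) (by
      change -(ε • -(ε • x.2)) = x.2
      rw [smul_neg, units_smul_smul, neg_neg]))
    (LinearMap.ext fun x => Prod.ext (by
      change -(ε • -(ε • x.1)) = x.1
      rw [smul_neg, units_smul_smul, neg_neg]) (neg_neg _)) ≪≫ₗ dualHyp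

theorem α_apply (x : D.U) (ψ : Dual Λ D.U) : D.α (x, ψ) = dualHyp (-ψ, -(ε • x)) := rfl

theorem α_symm_apply (φ : Dual Λ D.U) (u : D.U) :
    D.α.symm (dualHyp (φ, u)) = (-(ε • u), -φ) := by
  rw [LinearEquiv.symm_apply_eq, α_apply]
  simp [units_smul_smul]

/-- The involution `β = (-1 -d; 0 1)` of `U ⊕ K`. -/
def β : (D.U × D.K) ≃ₗ[Λ] (D.U × D.K) :=
  LinearEquiv.ofInvolutive
    ((-(LinearMap.id.coprod D.d)).prod (LinearMap.snd Λ D.U D.K)) (fun ⟨u, k⟩ => Prod.ext (by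
      change -(-(u + D.d k) + D.d k) = u
      abel) rfl)

theorem β_apply (u : D.U) (k : D.K) : D.β (u, k) = (-(u + D.d k), k) := rfl

theorem cotranspose_α_symm (φ : Dual Λ D.U) (u : D.U) :
    cotranspose D.α.symm.toLinearMap (dualHyp (φ, u)) = (-u, -(ε • φ)) := by
  refine eq_of_dual_eq (Λ := Λ) fun f => ?_
  obtain ⟨⟨φ', u'⟩, rfl⟩ := dualHyp.surjective f
  rw [apply_cotranspose, LinearEquiv.coe_coe, α_symm_apply, dualHyp_apply, dualHyp_apply]
  simp only [map_neg, map_units_smul, star_add, star_neg, star_units_smul, Dual.neg_apply,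
    Dual.units_smul_apply, star_star]
  abel

theorem map_β (φ : Dual Λ D.U) (κ : Dual Λ D.K) :
    Dual.map D.β.symm.toLinearMap (dualProd (φ, κ)) = dualProd (-φ, κ - Dual.map D.d φ) := by
  refine Dual.ext fun ⟨u, k⟩ => ?_
  change dualProd (φ, κ) (D.β (u, k)) = _
  rw [β_apply, dualProd_apply, dualProd_apply]
  simp only [map_neg, map_add, Dual.neg_apply, Dual.sub_apply, Dual.map_apply]
  abel

/-- The map `θ` on `K`, extended by zero to `U ⊕ K`. -/
def κ : D.U × D.K →ₗ[Λ] Dual Λ (D.U × D.K) :=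
  Dual.map (LinearMap.snd Λ D.U D.K) ∘ₗ D.θ ∘ₗ LinearMap.snd Λ D.U D.K

theorem κ_apply (u : D.U) (k : D.K) : D.κ (u, k) = dualProd (0, D.θ k) := by
  refine Dual.ext fun ⟨u', k'⟩ => ?_
  rw [dualProd_apply, Dual.zero_apply, zero_add]
  rfl

/-- The terms b(k)(u') cancel and leave εb(k)(dk') + 2θ(k, k'); the relation between θ, b and d
rewrites this as θ + εθ^*. The identity proves both the flip condition on θ in Q_{-ε} and the
equation required of κ. -/
theorem map_β_Θ_β (v w : D.U × D.K) :
    D.Θ (D.β v) (D.β w) + D.Θ v w = D.κ v w + ε • star (D.κ w v) := by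
  obtain ⟨u, k⟩ := v
  obtain ⟨u', k'⟩ := w
  have h := congrArg (fun x => ε • star x) (D.symm_θ k' k)
  rw [β_apply, β_apply, Θ_apply, Θ_apply, κ_apply, κ_apply]
  simp only [dualProd_apply, Dual.zero_apply, zero_add, Dual.neg_apply, Dual.units_smul_apply,
    map_neg, map_add]
  simp only [star_star, star_sub, smul_sub, star_units_smul, units_smul_smul] at h
  rw [← h]
  abel

/-- The flip-isomorphism `(α, β, 0)`. -/
def flipIso : D.toPreformation.FlipIso where
  α := D.α
  β := D.β
  ν := 0
  comm_γ := by
    refine LinearMap.ext fun ⟨u, k⟩ => ?_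
    rw [map_zero]
    have h0 : D.α ((evEquiv (D.U × Dual Λ D.U)).symm (transpose
        (0 : Dual Λ (D.U × Dual Λ D.U) →ₗ[Λ] Dual Λ (Dual Λ (D.U × Dual Λ D.U)))
          (D.μ (u, k)))) = 0 := by
      have : ∀ y, transpose
        (0 : Dual Λ (D.U × Dual Λ D.U) →ₗ[Λ] Dual Λ (Dual Λ (D.U × Dual Λ D.U))) y = 0 := fun y =>
        by
          ext; simp
      rw [this, map_zero, map_zero]
    refine (congrArg (D.α (D.γ (u, k)) + ·) h0).trans ?_
    change D.α (D.γ (u, k)) + 0 = ε • D.μ (D.β (u, k))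
    rw [add_zero, γ_apply, α_apply, β_apply, μ_apply, ← map_units_smul]
    congr 1
    refine Prod.ext ?_ ?_
    · change -D.b k = ε • -(ε • D.b k)
      rw [smul_neg, units_smul_smul]
    · change -(ε • u) = ε • (-(u + D.d k) + D.d k)
      rw [neg_add, neg_add_cancel_right, smul_neg]
  comm_μ := by
    refine LinearMap.ext fun ⟨u, k⟩ => ?_
    change cotranspose D.α.symm.toLinearMap (D.μ (u, k)) = D.γ (D.β (u, k))
    rw [μ_apply, cotranspose_α_symm, β_apply, γ_apply, smul_neg, units_smul_smul, neg_neg]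
  comm_θ := by
    have h : QGroup.mk (-ε) D.Θ +
        QGroup.pullback D.μ (0 : QGroup Λ (Dual Λ (D.U × Dual Λ D.U)) (-ε)) +
        QGroup.pullback D.β.toLinearMap (QGroup.mk (-ε) D.Θ) = 0 := by
      rw [map_zero, add_zero, QGroup.pullback_mk, ← map_add, ← QGroup.mk_sub_eq_zero D.κ]
      congr 1
      refine LinearMap.ext fun v => Dual.ext fun w => ?_
      rw [neg_units_smul, sub_neg_eq_add, add_comm]
      exact D.map_β_Θ_β v w
    exact h

end DoubleData

end Double

/-! ### Explicit matrices for the homotopy (Δ, η). -/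

section DoubleHomotopy

variable {Λ : Type u} [Ring Λ] [StarRing Λ]

theorem cotranspose_zero {M N : Type u} [AddCommGroup M] [Module Λ M] [AddCommGroup N] [Module Λ N]
    [Module.Free Λ M] [Module.Finite Λ M] : cotranspose (0 : Dual Λ M →ₗ[Λ] N) = 0 := by
  refine LinearMap.ext fun x => eq_of_dual_eq (Λ := Λ) fun φ => ?_
  rw [apply_cotranspose]
  simp

namespace DoubleData

variable {ε : ℤˣ} (D : DoubleData Λ ε)

/-- The chain homotopy `U ⊕ U^* ⊕ U^* ⊕ U → U ⊕ K`. -/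
def Δ₁ : (D.U × Dual Λ D.U) × Dual Λ (D.U × Dual Λ D.U) →ₗ[Λ] D.U × D.K :=
  LinearMap.inl Λ D.U D.K ∘ₗ (ε • LinearMap.coprod (LinearMap.fst Λ D.U (Dual Λ D.U))
    (LinearMap.snd Λ (Dual Λ D.U) D.U ∘ₗ dualHyp.symm.toLinearMap))

/-- The chain homotopy `U^* ⊕ K^* → U ⊕ U^* ⊕ U^* ⊕ U`. -/
def Δ₀ : Dual Λ (D.U × D.K) →ₗ[Λ] (D.U × Dual Λ D.U) × Dual Λ (D.U × Dual Λ D.U) :=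
  ((-LinearMap.inr Λ D.U (Dual Λ D.U)).prod
    (-(ε • (dualHyp.toLinearMap ∘ₗ LinearMap.inl Λ (Dual Λ D.U) D.U)))) ∘ₗ
    Dual.map (LinearMap.inl Λ D.U D.K)

/-- The projection of `(U ⊕ U^*)^* ⊕ (U ⊕ U^*)` to `U`. -/
def toU : Dual Λ ((D.U × Dual Λ D.U) × Dual Λ (D.U × Dual Λ D.U)) →ₗ[Λ] D.U :=
  LinearMap.snd Λ (Dual Λ D.U) D.U ∘ₗ dualHyp.symm.toLinearMap ∘ₗ
    LinearMap.fst Λ (Dual Λ (D.U × Dual Λ D.U)) (D.U × Dual Λ D.U) ∘ₗ dualHyp.symm.toLinearMap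

/-- The component `η₁ : C^q → C_{q+1}`. -/
def η₁ : Dual Λ ((D.U × Dual Λ D.U) × Dual Λ (D.U × Dual Λ D.U)) →ₗ[Λ] D.U × D.K :=
  -(ε • (LinearMap.inl Λ D.U D.K ∘ₗ D.toU))

/-- The component `η₂ : C^q → C_q`. -/
def η₂ : Dual Λ ((D.U × Dual Λ D.U) × Dual Λ (D.U × Dual Λ D.U)) →ₗ[Λ]
    (D.U × Dual Λ D.U) × Dual Λ (D.U × Dual Λ D.U) :=
  -(LinearMap.inl Λ (D.U × Dual Λ D.U) (Dual Λ (D.U × Dual Λ D.U)) ∘ₗ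
    LinearMap.inl Λ D.U (Dual Λ D.U) ∘ₗ D.toU)

/-- The component `η₂ : C^{q-1} → C_{q+1}`. -/
def η₂' : Dual Λ (Dual Λ (D.U × D.K)) →ₗ[Λ] D.U × D.K :=
  -(LinearMap.inl Λ D.U D.K ∘ₗ LinearMap.id.coprod D.d ∘ₗ (evEquiv (D.U × D.K)).symm.toLinearMap)

/-- The component `η₃ : C^{q-1} → C_q`. -/
def η₃ : Dual Λ (Dual Λ (D.U × D.K)) →ₗ[Λ] (D.U × Dual Λ D.U) × Dual Λ (D.U × Dual Λ D.U) :=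
  LinearMap.inr Λ (D.U × Dual Λ D.U) (Dual Λ (D.U × Dual Λ D.U)) ∘ₗ dualHyp.toLinearMap ∘ₗ
    LinearMap.inl Λ (Dual Λ D.U) D.U ∘ₗ D.b ∘ₗ LinearMap.snd Λ D.U D.K ∘ₗ
      (evEquiv (D.U × D.K)).symm.toLinearMap

theorem Δ₁_apply (x : D.U) (ψ φ : Dual Λ D.U) (u : D.U) :
    D.Δ₁ ((x, ψ), dualHyp (φ, u)) = (ε • (x + u), 0) := by
  change (ε • (x + (dualHyp.symm (dualHyp (φ, u))).2), (0 : D.K)) = _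
  rw [LinearEquiv.symm_apply_apply]

theorem Δ₀_apply (φ : Dual Λ D.U) (κ : Dual Λ D.K) :
    D.Δ₀ (dualProd (φ, κ)) = ((0, -φ), dualHyp (-(ε • φ), 0)) := by
  have h : Dual.map (LinearMap.inl Λ D.U D.K) (dualProd (φ, κ)) = φ := by
    refine Dual.ext fun u => ?_
    change φ u + κ 0 = φ u
    rw [map_zero, add_zero]
  change ((-((0 : D.U), Dual.map (LinearMap.inl Λ D.U D.K) (dualProd (φ, κ)))),
    -(ε • dualHyp (Dual.map (LinearMap.inl Λ D.U D.K) (dualProd (φ, κ)), 0))) = _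
  rw [h, ← map_units_smul, ← map_neg]
  refine Prod.ext (Prod.ext neg_zero rfl) ?_
  change dualHyp (-(ε • (φ, (0 : D.U)))) = dualHyp (-(ε • φ), 0)
  congr 1
  refine Prod.ext rfl ?_
  change -(ε • (0 : D.U)) = 0
  rw [smul_zero, neg_zero]

theorem map_Δ₁ (φ : Dual Λ D.U) (κ : Dual Λ D.K) :
    Dual.map D.Δ₁ (dualProd (φ, κ)) = dualHyp (dualHyp (ε • φ, 0), (0, ε • φ)) := by
  refine Dual.ext fun ⟨⟨x, ψ⟩, f⟩ => ?_
  obtain ⟨⟨φ', u'⟩, rfl⟩ := dualHyp.surjective f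
  rw [Dual.map_apply, Δ₁_apply, dualProd_apply, dualHyp_apply, dualHyp_apply, dualHyp_apply]
  simp

theorem map_Δ₀ (φ : Dual Λ D.U) (u x : D.U) (ψ : Dual Λ D.U) :
    Dual.map D.Δ₀ (dualHyp (dualHyp (φ, u), (x, ψ))) = ev (D.U × D.K) (-u - ε • x, 0) := by
  refine Dual.ext fun a => ?_
  obtain ⟨⟨φ', κ'⟩, rfl⟩ := dualProd.surjective a
  rw [Dual.map_apply, Δ₀_apply, ev_apply, dualHyp_apply, dualHyp_apply, dualHyp_apply,
    dualProd_apply]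
  simp [sub_eq_add_neg]

theorem toU_apply (φ : Dual Λ D.U) (u : D.U) (x : D.U × Dual Λ D.U) :
    D.toU (dualHyp (dualHyp (φ, u), x)) = u := by
  change (dualHyp.symm (dualHyp.symm (dualHyp (dualHyp (φ, u), x))).1).2 = u
  rw [LinearEquiv.symm_apply_apply, LinearEquiv.symm_apply_apply]

theorem η₁_apply (φ : Dual Λ D.U) (u : D.U) (x : D.U × Dual Λ D.U) :
    D.η₁ (dualHyp (dualHyp (φ, u), x)) = (-(ε • u), 0) := by
  change -(ε • (D.toU _, (0 : D.K))) = _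
  rw [toU_apply]
  exact Prod.ext rfl (by simp)

theorem cotranspose_η₁ (φ : Dual Λ D.U) (κ : Dual Λ D.K) :
    cotranspose D.η₁ (dualProd (φ, κ)) = ((0, -(ε • φ)), 0) := by
  refine eq_of_dual_eq (Λ := Λ) fun Φ => ?_
  obtain ⟨⟨f, x⟩, rfl⟩ := dualHyp.surjective Φ
  obtain ⟨⟨φ', u'⟩, rfl⟩ := dualHyp.surjective f
  rw [apply_cotranspose, η₁_apply, dualProd_apply, dualHyp_apply, dualHyp_apply]
  simp

theorem η₂_apply (φ : Dual Λ D.U) (u : D.U) (x : D.U × Dual Λ D.U) :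
    D.η₂ (dualHyp (dualHyp (φ, u), x)) = ((-u, 0), 0) := by
  change -((D.toU _, (0 : Dual Λ D.U)), (0 : Dual Λ (D.U × Dual Λ D.U))) = _
  rw [toU_apply]
  exact Prod.ext (Prod.ext rfl neg_zero) neg_zero

theorem cotranspose_η₂ (φ : Dual Λ D.U) (u : D.U) (x : D.U × Dual Λ D.U) :
    cotranspose D.η₂ (dualHyp (dualHyp (φ, u), x)) = ((0, -φ), 0) := by
  refine eq_of_dual_eq (Λ := Λ) fun Φ => ?_
  obtain ⟨⟨f, x'⟩, rfl⟩ := dualHyp.surjective Φ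
  obtain ⟨⟨φ', u'⟩, rfl⟩ := dualHyp.surjective f
  rw [apply_cotranspose, η₂_apply, dualHyp_apply, dualHyp_apply, dualHyp_apply, dualHyp_apply]
  simp

theorem η₂'_apply (u : D.U) (k : D.K) : D.η₂' (ev (D.U × D.K) (u, k)) = (-(u + D.d k), 0) := by
  change -(LinearMap.id.coprod D.d ((evEquiv (D.U × D.K)).symm (ev (D.U × D.K) (u, k))),
    (0 : D.K)) = _
  rw [evEquiv_symm_ev]
  exact Prod.ext rfl neg_zero

theorem cotranspose_η₂' (φ : Dual Λ D.U) (κ : Dual Λ D.K) :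
    cotranspose D.η₂' (dualProd (φ, κ)) = dualProd (-φ, -Dual.map D.d φ) := by
  refine eq_of_dual_eq (Λ := Λ) fun Φ => ?_
  obtain ⟨⟨u, k⟩, rfl⟩ := (ev_bijective (Λ := Λ) (D.U × D.K)).2 Φ
  rw [apply_cotranspose, η₂'_apply, dualProd_apply, ev_apply, dualProd_apply]
  simp [add_comm]

theorem η₃_apply (u : D.U) (k : D.K) :
    D.η₃ (ev (D.U × D.K) (u, k)) = (0, dualHyp (D.b k, 0)) := by
  change ((0 : D.U × Dual Λ D.U),
    dualHyp (D.b ((evEquiv (D.U × D.K)).symm (ev (D.U × D.K) (u, k))).2, (0 : D.U))) = _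
  rw [evEquiv_symm_ev]

theorem cotranspose_η₃ (f : Dual Λ (D.U × Dual Λ D.U)) (x : D.U) (ψ : Dual Λ D.U) :
    cotranspose D.η₃ (dualHyp (f, (x, ψ))) = dualProd (0, transpose D.b x) := by
  refine eq_of_dual_eq (Λ := Λ) fun Φ => ?_
  obtain ⟨⟨u, k⟩, rfl⟩ := (ev_bijective (Λ := Λ) (D.U × D.K)).2 Φ
  rw [apply_cotranspose, η₃_apply, dualHyp_apply, ev_apply, dualProd_apply, dualHyp_apply]
  simp

end DoubleData

end DoubleHomotopy

/-! ### Verification of the homotopy, component by component. -/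

section DoubleHomotopy

variable {Λ : Type u} [Ring Λ] [StarRing Λ]

namespace DoubleData

variable {q : ℕ} (D : DoubleData Λ (sgn q))

/-- The components of the chain homotopy `1 ≃ h_t`. -/
def deltaTerm : ∀ i j : Deg, D.toPreformation.term i →ₗ[Λ] D.toPreformation.term j
  | .middle, .upper => D.Δ₁
  | .lower, .middle => D.Δ₀
  | _, _ => 0

/-- The components of `η`. -/
def etaTerm : ∀ (_ : ℕ) (i j : Deg),
    Dual Λ (D.toPreformation.term i) →ₗ[Λ] D.toPreformation.term j
  | 1, .middle, .upper => D.η₁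
  | 2, .middle, .middle => D.η₂
  | 2, .lower, .upper => D.η₂'
  | 3, .lower, .middle => D.η₃
  | _, _, _ => 0

theorem hTerm_middle_apply (x : D.U) (ψ φ : Dual Λ D.U) (u : D.U) :
    D.flipIso.hTerm 0 .middle (show (D.U × Dual Λ D.U) × Dual Λ (D.U × Dual Λ D.U) from
      ((x, ψ), dualHyp (φ, u))) = (show (D.U × Dual Λ D.U) × Dual Λ (D.U × Dual Λ D.U) from
        ((-u, -(sgn q • φ)), dualHyp (-(sgn q • ψ), -x))) := by
  refine Prod.ext (D.cotranspose_α_symm φ u) ?_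
  have h : (cotranspose (0 : Dual Λ (D.U × Dual Λ D.U) →ₗ[Λ] D.U × Dual Λ D.U) -
      sgn q • (0 : Dual Λ (D.U × Dual Λ D.U) →ₗ[Λ] D.U × Dual Λ D.U)) (dualHyp (φ, u)) = 0 := by
    rw [cotranspose_zero]
    simp
  change sgn q • D.α (x, ψ) + sgn q • D.α ((cotranspose
    (0 : Dual Λ (D.U × Dual Λ D.U) →ₗ[Λ] D.U × Dual Λ D.U) - sgn q • 0) (dualHyp (φ, u))) = _
  rw [h, map_zero, smul_zero, add_zero, α_apply, ← map_units_smul]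
  congr 1
  refine Prod.ext (smul_neg _ _) ?_
  change sgn q • -(sgn q • x) = -x
  rw [smul_neg, units_smul_smul]

/-- The identity h_t - 1 = dΔ + Δd in degree q + 1; in the outer degrees q ± 1 only one of the two
summands is non-zero. -/
theorem hTerm_eq_upper : D.flipIso.hTerm 0 .upper =
    D.deltaTerm .middle .upper ∘ₗ D.toPreformation.diff .upper .middle + LinearMap.id := by
  refine LinearMap.ext fun (v : D.U × D.K) => ?_
  obtain ⟨u, k⟩ := v
  change D.β (u, k) = D.Δ₁ ((-sgn q) • (D.γ (u, k), D.μ (u, k))) + (u, k)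
  rw [map_units_smul, γ_apply, μ_apply, Δ₁_apply, β_apply]
  refine Prod.ext ?_ ?_
  · change -(u + D.d k) = (-sgn q) • sgn q • (u + (u + D.d k)) + u
    rw [neg_units_smul, units_smul_smul]
    abel
  · change k = (-sgn q) • (0 : D.K) + k
    rw [smul_zero, zero_add]

theorem hTerm_eq_middle : D.flipIso.hTerm 0 .middle =
    D.deltaTerm .lower .middle ∘ₗ D.toPreformation.diff .middle .lower +
      D.toPreformation.diff .upper .middle ∘ₗ D.deltaTerm .middle .upper + LinearMap.id := by
  refine LinearMap.ext fun (v : (D.U × Dual Λ D.U) × Dual Λ (D.U × Dual Λ D.U)) => ?_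
  obtain ⟨⟨x, ψ⟩, f⟩ := v
  obtain ⟨⟨φ, u⟩, rfl⟩ := dualHyp.surjective f
  refine (D.hTerm_middle_apply x ψ φ u).trans ?_
  change ((-u, -(sgn q • φ)), dualHyp (-(sgn q • ψ), -x)) =
    D.Δ₀ (transpose D.μ (x, ψ) + sgn q • Dual.map D.γ (dualHyp (φ, u))) +
      (-sgn q) • (D.γ (D.Δ₁ ((x, ψ), dualHyp (φ, u))), D.μ (D.Δ₁ ((x, ψ), dualHyp (φ, u)))) +
      ((x, ψ), dualHyp (φ, u))
  rw [map_add, map_units_smul, transpose_μ, map_γ, Δ₀_apply, Δ₀_apply, Δ₁_apply, γ_apply, μ_apply]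
  simp only [Prod.smul_mk, Prod.mk_add_mk, ← map_units_smul, ← map_add, map_zero, add_zero,
    smul_zero, neg_zero, smul_neg, neg_units_smul, units_smul_smul, zero_add, smul_add]
  refine Prod.ext (Prod.ext ?_ ?_) (congrArg dualHyp (Prod.ext ?_ ?_))
  · change -u = -x + -u + x
    abel
  · change -(sgn q • φ) = -ψ + -(sgn q • φ) + ψ
    abel
  · change -(sgn q • ψ) = -(sgn q • ψ) + -φ + φ
    abel
  · change -x = -x + -u + u
    abel

theorem hTerm_eq_lower : D.flipIso.hTerm 0 .lower =
    D.toPreformation.diff .middle .lower ∘ₗ D.deltaTerm .lower .middle + LinearMap.id := by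
  refine LinearMap.ext fun (a : Dual Λ (D.U × D.K)) => ?_
  obtain ⟨⟨φ, κ⟩, rfl⟩ := dualProd.surjective a
  refine (D.map_β φ κ).trans ?_
  change _ = (transpose D.μ (D.Δ₀ (dualProd (φ, κ))).1 +
    sgn q • Dual.map D.γ (D.Δ₀ (dualProd (φ, κ))).2) + dualProd (φ, κ)
  rw [Δ₀_apply, transpose_μ, map_γ, ← map_units_smul (dualProd (Λ := Λ) (M := D.U) (N := D.K)),
    ← map_add, ← map_add]
  congr 1
  refine Prod.ext ?_ ?_
  · change -φ = -φ + sgn q • -(sgn q • φ) + φ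
    rw [smul_neg, units_smul_smul]
    abel
  · change κ - Dual.map D.d φ = Dual.map D.d (-φ) - sgn q • transpose D.b 0 +
      sgn q • transpose D.b 0 + κ
    rw [map_neg]
    abel

/-- The right hand side of the structure equation of the homotopy. -/
def structureTerm (s : ℕ) (P R P' R' P'' R'' : Deg) (e e₁ e₂ e₃ e₄ : ℤˣ) :
    Dual Λ (D.toPreformation.term P) →ₗ[Λ] D.toPreformation.term R :=
  (-(D.deltaTerm R' R ∘ₗ D.toPreformation.psiTerm D.Θ s P R') +
    (-e) • ((D.flipIso.hTerm 0 R ∘ₗ D.toPreformation.psiTerm D.Θ s P' R +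
      D.deltaTerm R' R ∘ₗ (e₁ • cotranspose (D.toPreformation.psiTerm D.Θ (s + 1) R' P'))) ∘ₗ
      Dual.map (D.deltaTerm P' P))) +
  (D.toPreformation.diff R'' R ∘ₗ D.etaTerm s P R'' +
    e • (D.etaTerm s P'' R ∘ₗ Dual.map (D.toPreformation.diff P'' P)) +
    e₂ • (D.etaTerm (s + 1) P R + e₃ • e₄ • cotranspose (D.etaTerm (s + 1) R P)))

theorem _root_.AlgebraicSurgery.map_inl_dualHyp {M : Type u} [AddCommGroup M] [Module Λ M]
    [Module.Free Λ M] [Module.Finite Λ M] (φ : Dual Λ M) (x : M) :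
    Dual.map (LinearMap.inl Λ M (Dual Λ M)) (dualHyp (φ, x)) = φ := by
  refine Dual.ext fun y => ?_
  change φ y + star ((0 : Dual Λ M) x) = φ y
  simp

theorem _root_.AlgebraicSurgery.Dual.map_zero_left {M N : Type u} [AddCommGroup M] [Module Λ M]
    [AddCommGroup N] [Module Λ N] : Dual.map (0 : M →ₗ[Λ] N) = 0 :=
  LinearMap.ext fun φ => Dual.ext fun _ => map_zero φ

/-- The component `ψ₁ : C^q → C_{q-1}`. -/
def psiOne : Dual Λ ((D.U × Dual Λ D.U) × Dual Λ (D.U × Dual Λ D.U)) →ₗ[Λ] Dual Λ (D.U × D.K) :=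
  D.toPreformation.psiTerm D.Θ 1 .middle .lower

/-- The component `ψ₂ : C^{q-1} → C_{q-1}`. -/
def psiTwo : Dual Λ (Dual Λ (D.U × D.K)) →ₗ[Λ] Dual Λ (D.U × D.K) :=
  D.toPreformation.psiTerm D.Θ 2 .lower .lower

/-- The differential `C_{q+1} → C_q`. -/
def diffUpper : D.U × D.K →ₗ[Λ] (D.U × Dual Λ D.U) × Dual Λ (D.U × Dual Λ D.U) :=
  D.toPreformation.diff .upper .middle

/-- The differential `C_q → C_{q-1}`. -/
def diffMiddle : (D.U × Dual Λ D.U) × Dual Λ (D.U × Dual Λ D.U) →ₗ[Λ] Dual Λ (D.U × D.K) :=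
  D.toPreformation.diff .middle .lower

/-- The component of the chain map in degree `q`. -/
def hMiddle : (D.U × Dual Λ D.U) × Dual Λ (D.U × Dual Λ D.U) →ₗ[Λ]
    (D.U × Dual Λ D.U) × Dual Λ (D.U × Dual Λ D.U) :=
  D.flipIso.hTerm 0 .middle

/-- The identification `(U ⊕ K)^{**} ≅ U ⊕ K`. -/
def evInv : Dual Λ (Dual Λ (D.U × D.K)) →ₗ[Λ] D.U × D.K := (evEquiv (D.U × D.K)).symm.toLinearMap

theorem evInv_ev (v : D.U × D.K) : D.evInv (ev (D.U × D.K) v) = v := evEquiv_symm_ev v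

theorem hMiddle_apply (x : D.U) (ψ φ : Dual Λ D.U) (u : D.U) :
    D.hMiddle ((x, ψ), dualHyp (φ, u)) = ((-u, -(sgn q • φ)), dualHyp (-(sgn q • ψ), -x)) :=
  D.hTerm_middle_apply x ψ φ u

theorem psiOne_apply (φ ψ : Dual Λ D.U) (u x : D.U) :
    D.psiOne (dualHyp (dualHyp (φ, u), (x, ψ))) =
      dualProd (sgn q • φ, sgn q • transpose D.b u) := by
  change sgn q • Dual.map D.γ (Dual.map (LinearMap.inl Λ (D.U × Dual Λ D.U)
    (Dual Λ (D.U × Dual Λ D.U))) (dualHyp (dualHyp (φ, u), (x, ψ)))) = _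
  rw [map_inl_dualHyp, map_γ, ← map_units_smul]
  rfl

theorem cotranspose_psiOne (u : D.U) (k : D.K) :
    cotranspose D.psiOne (ev (D.U × D.K) (u, k)) = ((sgn q • u, sgn q • D.b k), 0) := by
  refine (D.toPreformation.cotranspose_psiTerm_one D.Θ _).trans ?_
  exact congrArg (fun v : D.U × D.K => (sgn q • D.γ v, (0 : Dual Λ (D.U × Dual Λ D.U))))
    (evEquiv_symm_ev (Λ := Λ) ((u, k) : D.U × D.K))

theorem psiTwo_apply (u : D.U) (k : D.K) : D.psiTwo (ev (D.U × D.K) (u, k)) =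
    dualProd (0, transpose D.b u - sgn q • transpose D.θ k) := by
  refine (congrArg (fun v : D.U × D.K => (-sgn q) • transpose D.Θ v)
    (evEquiv_symm_ev (Λ := Λ) ((u, k) : D.U × D.K))).trans ?_
  rw [transpose_Θ, ← map_units_smul]
  congr 1
  refine Prod.ext (smul_zero _) ?_
  change (-sgn q) • (-(sgn q • transpose D.b u) + transpose D.θ k) = _
  rw [neg_units_smul, smul_add, smul_neg, units_smul_smul, neg_add, neg_neg, ← sub_eq_add_neg]

/-- The image of the dual of Δ₀ lies in U ⊕ 0, where Θ vanishes; this removes the Tψ₂ term from the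
structure equation. -/
theorem cotranspose_psiTwo_left (u : D.U) : cotranspose D.psiTwo (ev (D.U × D.K) (u, 0)) = 0 := by
  have h : (-sgn q) • cotranspose D.psiTwo (ev (D.U × D.K) (u, 0)) = D.Θ (u, 0) :=
    D.toPreformation.cotranspose_psiTerm_two D.Θ (u, 0)
  rw [← units_smul_smul (-sgn q) (cotranspose D.psiTwo (ev (D.U × D.K) (u, 0))), h, Θ_apply,
    map_zero, map_zero, smul_zero, neg_zero]
  exact (congrArg (fun x => (-sgn q) • x) (map_zero dualProd)).trans (smul_zero _)

theorem diffUpper_apply (u : D.U) (k : D.K) : D.diffUpper (u, k) =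
    ((-(sgn q • u), -(sgn q • D.b k)), dualHyp (D.b k, -(sgn q • (u + D.d k)))) := by
  change (-sgn q) • (D.γ (u, k), D.μ (u, k)) = _
  rw [γ_apply, μ_apply, neg_units_smul]
  refine Prod.ext rfl ?_
  change -(sgn q • dualHyp (-(sgn q • D.b k), u + D.d k)) = _
  rw [← map_units_smul, ← map_neg]
  congr 1
  refine Prod.ext ?_ rfl
  change -(sgn q • -(sgn q • D.b k)) = D.b k
  rw [smul_neg, units_smul_smul, neg_neg]

theorem diffMiddle_apply (x u : D.U) (φ ψ : Dual Λ D.U) :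
    D.diffMiddle ((x, ψ), dualHyp (φ, u)) = dualProd (ψ + sgn q • φ,
      Dual.map D.d ψ - sgn q • transpose D.b x + sgn q • transpose D.b u) := by
  change transpose D.μ (x, ψ) + sgn q • Dual.map D.γ (dualHyp (φ, u)) = _
  rw [transpose_μ, map_γ, ← map_units_smul (dualProd (Λ := Λ) (M := D.U) (N := D.K)), ← map_add]
  rfl

theorem diffMiddle_apply_zero (x : D.U) (ψ : Dual Λ D.U) :
    D.diffMiddle ((x, ψ), 0) = dualProd (ψ, Dual.map D.d ψ - sgn q • transpose D.b x) := by
  have h := D.diffMiddle_apply x 0 0 ψ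
  rw [map_zero, smul_zero, smul_zero, add_zero, add_zero] at h
  rw [← h]
  exact congrArg (fun f => D.diffMiddle ((x, ψ), f)) (map_zero dualHyp).symm

theorem map_diffMiddle (u : D.U) (k : D.K) : Dual.map D.diffMiddle (ev (D.U × D.K) (u, k)) =
    dualHyp (dualHyp (-(sgn q • D.b k), u + D.d k), (sgn q • u, sgn q • D.b k)) := by
  refine Dual.ext fun ⟨⟨x, ψ⟩, f⟩ => ?_
  obtain ⟨⟨φ', u'⟩, rfl⟩ := dualHyp.surjective f
  rw [Dual.map_apply, diffMiddle_apply, ev_apply, dualProd_apply, dualHyp_apply, dualHyp_apply,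
    dualHyp_apply]
  simp
  abel

theorem Δ₁_apply_zero (x : D.U) (ψ : Dual Λ D.U) : D.Δ₁ ((x, ψ), 0) = (sgn q • x, 0) := by
  have h := D.Δ₁_apply x ψ 0 0
  rw [add_zero] at h
  rw [← h]
  exact congrArg (fun f => D.Δ₁ ((x, ψ), f)) (map_zero dualHyp).symm

/-- This and the following lemmas check the structure equation on the eight pairs (p, r) of degrees
among q + 1, q, q - 1 with s = 2q + 1 - p - r ≥ 0. The zero blocks are discarded first; the rest is
compared on generators. The explicit signs are e = (-1)^r, e₁ for Tψ_{s+1}, e₂ = (-1)^{n-s-1} with n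
= 2q + 2, e₃ = (-1)^{s+1} and e₄ = (-1)^{pr}. -/
theorem chiTerm_zero_middle_upper : D.flipIso.chiTerm D.Θ 0 D.κ 0 .middle .upper =
    D.structureTerm 0 .middle .upper .lower .middle .upper .other (-sgn q) (1) (-1) (-1) (1) := by
  simp only [structureTerm, show D.flipIso.chiTerm D.Θ 0 D.κ 0 .middle .upper = 0 from rfl,
    show D.etaTerm 0 .middle .other = 0 from rfl, show D.etaTerm 0 .upper .upper = 0 from rfl,
    show D.etaTerm 1 .upper .middle = 0 from rfl, LinearMap.zero_comp, LinearMap.comp_zero,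
    cotranspose_zero, smul_zero, add_zero, zero_add]
  refine LinearMap.ext fun (Φ : Dual Λ ((D.U × Dual Λ D.U) × Dual Λ (D.U × Dual Λ D.U))) => ?_
  obtain ⟨⟨f, x, ψ⟩, rfl⟩ := dualHyp.surjective Φ
  obtain ⟨⟨φ, u⟩, rfl⟩ := dualHyp.surjective f
  change (0 : D.U × D.K) = -(D.Δ₁ ((0, 0),
    Dual.map (LinearMap.inl Λ (D.U × Dual Λ D.U) (Dual Λ (D.U × Dual Λ D.U))) (dualHyp (dualHyp
    (φ, u), (x, ψ))))) +
    (- -sgn q) • (D.β (D.evInv (Dual.map D.Δ₀ (dualHyp (dualHyp (φ, u), (x, ψ))))) +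
      D.Δ₁ ((1 : ℤˣ) • cotranspose D.psiOne (Dual.map D.Δ₀ (dualHyp (dualHyp (φ, u), (x, ψ)))))) +
    (-1 : ℤˣ) • D.η₁ (dualHyp (dualHyp (φ, u), (x, ψ)))
  rw [map_inl_dualHyp, map_Δ₀, evInv_ev, β_apply, cotranspose_psiOne, one_smul, η₁_apply,
    Δ₁_apply, Δ₁_apply_zero]
  refine Prod.ext ?_ ?_
  · simp [units_smul_smul, smul_add, smul_sub, smul_neg, one_smul]
    abel
  · simp

theorem chiTerm_zero_upper_middle : D.flipIso.chiTerm D.Θ 0 D.κ 0 .upper .middle =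
    D.structureTerm 0 .upper .middle .middle .lower .other .upper (sgn q) (1) (-1) (-1) (1) := by
  simp only [structureTerm, show D.flipIso.chiTerm D.Θ 0 D.κ 0 .upper .middle = 0 from rfl,
    show D.toPreformation.psiTerm D.Θ 0 .upper .lower = 0 from rfl,
    show D.toPreformation.psiTerm D.Θ 1 .lower .middle = 0 from rfl,
    show D.etaTerm 0 .upper .upper = 0 from rfl, show D.etaTerm 0 .other .middle = 0 from rfl,
    show D.etaTerm 1 .upper .middle = 0 from rfl, LinearMap.zero_comp, LinearMap.comp_zero,
    cotranspose_zero, smul_zero, neg_zero, add_zero, zero_add]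
  refine LinearMap.ext fun (a : Dual Λ (D.U × D.K)) => ?_
  obtain ⟨⟨φ, κ⟩, rfl⟩ := dualProd.surjective a
  change (0 : ((D.U × Dual Λ D.U) × Dual Λ (D.U × Dual Λ D.U))) = (-sgn q) • D.hMiddle ((0, 0),
    Dual.map (LinearMap.inl Λ (D.U × Dual Λ D.U) (Dual Λ (D.U × Dual Λ D.U))) (Dual.map D.Δ₁
    (dualProd (φ, κ)))) +
    (-1 : ℤˣ) • (-1 : ℤˣ) • (1 : ℤˣ) • cotranspose D.η₁ (dualProd (φ, κ))
  rw [map_Δ₁, map_inl_dualHyp, hMiddle_apply, cotranspose_η₁]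
  refine Prod.ext (Prod.ext ?_ ?_) (Dual.ext fun ⟨x, ψ⟩ => ?_) <;>
    simp [units_smul_smul, smul_neg, one_smul]

theorem chiTerm_one_middle_middle : D.flipIso.chiTerm D.Θ 0 D.κ 1 .middle .middle =
    D.structureTerm 1 .middle .middle .lower .lower .upper .upper (sgn q) (-sgn q) (1) (1) (sgn q)
    := by
  simp only [structureTerm, show D.toPreformation.psiTerm D.Θ 1 .lower .middle = 0 from rfl,
    show D.etaTerm 1 .upper .middle = 0 from rfl, LinearMap.zero_comp, LinearMap.comp_zero,
    smul_zero, add_zero, zero_add]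
  refine LinearMap.ext fun (Φ : Dual Λ ((D.U × Dual Λ D.U) × Dual Λ (D.U × Dual Λ D.U))) => ?_
  obtain ⟨⟨f, x, ψ⟩, rfl⟩ := dualHyp.surjective Φ
  obtain ⟨⟨φ, u⟩, rfl⟩ := dualHyp.surjective f
  change (((0 : D.U), (0 : Dual Λ D.U)),
    Dual.map (LinearMap.inl Λ (D.U × Dual Λ D.U) (Dual Λ (D.U × Dual Λ D.U))) (dualHyp (dualHyp
    (φ, u), (x, ψ))) - D.α (cotranspose
      (0 : Dual Λ (D.U × Dual Λ D.U) →ₗ[Λ] D.U × Dual Λ D.U) (transpose D.α.toLinearMap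
        ((evEquiv (D.U × Dual Λ D.U)).symm (Dual.map (LinearMap.inr Λ (D.U × Dual Λ D.U)
          (Dual Λ (D.U × Dual Λ D.U))) (dualHyp (dualHyp (φ, u), (x, ψ)))))))) =
    -(D.Δ₀ (D.psiOne (dualHyp (dualHyp (φ, u), (x,
    ψ))))) + (-sgn q) • D.Δ₀ ((-sgn q) • cotranspose D.psiTwo (Dual.map D.Δ₀ (dualHyp (dualHyp (φ,
    u), (x, ψ))))) +
      (D.diffUpper (D.η₁ (dualHyp (dualHyp (φ, u), (x,
      ψ)))) + (1 : ℤˣ) • (D.η₂ (dualHyp (dualHyp (φ, u), (x,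
      ψ))) + (1 : ℤˣ) • sgn q • cotranspose D.η₂ (dualHyp (dualHyp (φ, u), (x, ψ)))))
  rw [map_inl_dualHyp, cotranspose_zero, LinearMap.zero_apply, map_zero, sub_zero, psiOne_apply,
    Δ₀_apply, map_Δ₀, cotranspose_psiTwo_left, η₁_apply, diffUpper_apply, η₂_apply, cotranspose_η₂]
  refine Prod.ext (Prod.ext ?_ ?_) (Dual.ext fun ⟨x, ψ⟩ => ?_) <;>
    simp [units_smul_smul, smul_neg, one_smul]

/-- The sign e₁ can be arbitrary: its term is composed with a component of Δ that is zero. The same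
holds in the later lemmas with a free e₁. -/
theorem chiTerm_one_upper_lower (e₁ : ℤˣ) : D.flipIso.chiTerm D.Θ 0 D.κ 1 .upper .lower =
    D.structureTerm 1 .upper .lower .middle .other .other .middle (-sgn q) (e₁) (1) (1) (-sgn q)
    := by
  simp only [structureTerm, show D.flipIso.chiTerm D.Θ 0 D.κ 1 .upper .lower = 0 from rfl,
    show D.deltaTerm .other .lower = 0 from rfl, show D.etaTerm 1 .upper .middle = 0 from rfl,
    show D.etaTerm 1 .other .lower = 0 from rfl, show D.etaTerm 2 .upper .lower = 0 from rfl,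
    LinearMap.zero_comp, LinearMap.comp_zero,
    smul_zero, neg_zero, add_zero, zero_add]
  refine LinearMap.ext fun (a : Dual Λ (D.U × D.K)) => ?_
  obtain ⟨⟨φ, κ⟩, rfl⟩ := dualProd.surjective a
  change 0 = (- -sgn q) • Dual.map D.β.symm.toLinearMap (D.psiOne (Dual.map D.Δ₁ (dualProd (φ,
    κ)))) +
    (1 : ℤˣ) • (1 : ℤˣ) • (-sgn q) • cotranspose D.η₂' (dualProd (φ, κ))
  rw [map_Δ₁, psiOne_apply, map_β, cotranspose_η₂']
  refine Dual.ext fun ⟨u, k⟩ => ?_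
  simp [units_smul_smul, smul_neg, one_smul]

theorem chiTerm_one_lower_upper (e₁ : ℤˣ) : D.flipIso.chiTerm D.Θ 0 D.κ 1 .lower .upper =
    D.structureTerm 1 .lower .upper .other .middle .middle .other (-sgn q) (e₁) (1) (1) (-sgn q)
    := by
  simp only [structureTerm, show D.flipIso.chiTerm D.Θ 0 D.κ 1 .lower .upper = 0 from rfl,
    show D.toPreformation.psiTerm D.Θ 1 .lower .middle = 0 from rfl,
    show D.deltaTerm .other .lower = 0 from rfl, show D.etaTerm 1 .lower .other = 0 from rfl,
    show D.etaTerm 2 .upper .lower = 0 from rfl, Dual.map_zero_left, LinearMap.comp_zero,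
    cotranspose_zero, smul_zero, neg_zero, add_zero, zero_add]
  refine LinearMap.ext fun (Ψ : Dual Λ (Dual Λ (D.U × D.K))) => ?_
  obtain ⟨⟨u, k⟩, rfl⟩ := (ev_bijective (Λ := Λ) (D.U × D.K)).2 Ψ
  change (0 : D.U × D.K) = (-sgn q) • D.η₁ (Dual.map D.diffMiddle (ev (D.U × D.K) (u,
    k))) + (1 : ℤˣ) • D.η₂' (ev (D.U × D.K) (u, k))
  rw [map_diffMiddle, η₁_apply, η₂'_apply]
  refine Prod.ext ?_ ?_
  · simp [units_smul_smul, smul_add, smul_neg, one_smul]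
    abel
  · simp

theorem chiTerm_two_lower_middle (e₁ : ℤˣ) : D.flipIso.chiTerm D.Θ 0 D.κ 2 .lower .middle =
    D.structureTerm 2 .lower .middle .other .lower .middle .upper (sgn q) (e₁) (-1) (-1) (1) := by
  simp only [structureTerm, show D.deltaTerm .other .lower = 0 from rfl,
    show D.etaTerm 3 .middle .lower = 0 from rfl, Dual.map_zero_left, LinearMap.comp_zero,
    cotranspose_zero, smul_zero, add_zero]
  refine LinearMap.ext fun (Ψ : Dual Λ (Dual Λ (D.U × D.K))) => ?_
  obtain ⟨⟨u, k⟩, rfl⟩ := (ev_bijective (Λ := Λ) (D.U × D.K)).2 Ψ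
  change (((0 : D.U), (0 : Dual Λ D.U)), sgn q • D.μ (D.evInv (ev (D.U × D.K) (u, k))) -
      D.α (cotranspose (0 : Dual Λ (D.U × Dual Λ D.U) →ₗ[Λ] D.U × Dual Λ D.U)
        (transpose D.α.toLinearMap (D.γ (D.evInv (ev (D.U × D.K) (u, k))))))) =
    -(D.Δ₀ (D.psiTwo (ev (D.U × D.K) (u, k)))) +
      (D.diffUpper (D.η₂' (ev (D.U × D.K) (u,
      k))) + sgn q • D.η₂ (Dual.map D.diffMiddle (ev (D.U × D.K) (u,
      k))) + (-1 : ℤˣ) • D.η₃ (ev (D.U × D.K) (u, k)))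
  rw [cotranspose_zero, LinearMap.zero_apply, map_zero, sub_zero, evInv_ev, μ_apply,
    psiTwo_apply, Δ₀_apply, η₂'_apply, diffUpper_apply, map_diffMiddle, η₂_apply, η₃_apply]
  refine Prod.ext (Prod.ext ?_ ?_) (Dual.ext fun ⟨x, ψ⟩ => ?_)
  · simp [smul_add, smul_neg, one_smul]
  · simp [smul_add, smul_neg, one_smul]
  · simp [units_smul_smul, smul_add, smul_neg, one_smul]
    abel

theorem chiTerm_two_middle_lower (e₁ : ℤˣ) : D.flipIso.chiTerm D.Θ 0 D.κ 2 .middle .lower =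
    D.structureTerm 2 .middle .lower .lower .other .upper .middle (-sgn q) (e₁) (-1) (-1) (1) := by
  simp only [structureTerm, show D.flipIso.chiTerm D.Θ 0 D.κ 2 .middle .lower = 0 from rfl,
    show D.deltaTerm .other .lower = 0 from rfl, show D.etaTerm 2 .upper .lower = 0 from rfl,
    show D.etaTerm 3 .middle .lower = 0 from rfl, LinearMap.zero_comp, smul_zero, neg_zero,
    add_zero, zero_add]
  refine LinearMap.ext fun (Φ : Dual Λ ((D.U × Dual Λ D.U) × Dual Λ (D.U × Dual Λ D.U))) => ?_
  obtain ⟨⟨f, x, ψ⟩, rfl⟩ := dualHyp.surjective Φ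
  obtain ⟨⟨φ, u⟩, rfl⟩ := dualHyp.surjective f
  change 0 = (- -sgn q) • Dual.map D.β.symm.toLinearMap (D.psiTwo (Dual.map D.Δ₀ (dualHyp (dualHyp
    (φ, u), (x, ψ))))) +
    (D.diffMiddle (D.η₂ (dualHyp (dualHyp (φ, u), (x,
    ψ)))) + (-1 : ℤˣ) • (-1 : ℤˣ) • (1 : ℤˣ) • cotranspose D.η₃ (dualHyp (dualHyp (φ, u), (x, ψ))))
  rw [map_Δ₀, psiTwo_apply, map_β, η₂_apply, cotranspose_η₃]
  rw [diffMiddle_apply_zero]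
  refine Dual.ext fun ⟨u, k⟩ => ?_
  simp [units_smul_smul, smul_sub, smul_neg, one_smul, dualProd_apply]

theorem chiTerm_three_lower_lower (e₁ : ℤˣ) : D.flipIso.chiTerm D.Θ 0 D.κ 3 .lower .lower =
    D.structureTerm 3 .lower .lower .other .other .middle .middle (-sgn q) (e₁) (1) (1) (-sgn q)
    := by
  simp only [structureTerm, show D.deltaTerm .other .lower = 0 from rfl,
    show D.etaTerm 3 .middle .lower = 0 from rfl, show D.etaTerm 4 .lower .lower = 0 from rfl,
    Dual.map_zero_left, LinearMap.zero_comp, LinearMap.comp_zero,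
    cotranspose_zero, smul_zero, neg_zero, add_zero, zero_add]
  refine LinearMap.ext fun (Ψ : Dual Λ (Dual Λ (D.U × D.K))) => ?_
  obtain ⟨⟨u, k⟩, rfl⟩ := (ev_bijective (Λ := Λ) (D.U × D.K)).2 Ψ
  change -D.Θ (D.evInv (ev (D.U × D.K) (u, k))) + Dual.map D.β.symm.toLinearMap
    (D.κ (D.β (D.evInv (ev (D.U × D.K) (u, k))))) = D.diffMiddle (D.η₃ (ev (D.U × D.K) (u, k)))
  rw [evInv_ev, Θ_apply, β_apply, κ_apply, map_β, η₃_apply]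
  refine Eq.trans ?_ (D.diffMiddle_apply 0 0 (D.b k) 0).symm
  refine Dual.ext fun ⟨u, k⟩ => ?_
  simp [dualProd_apply]

end DoubleData

end DoubleHomotopy

/-! ### Assembly of the choices rel ∂ for the normal form. -/

section DoubleChoices

variable {Λ : Type u} [Ring Λ] [StarRing Λ]

theorem deg_lower (q : ℕ) : deg q (q - 1) = .lower := by simp [deg]; omega

theorem deg_add_two (q : ℕ) : deg q (q + 2) = .other := by simp [deg]; omega

theorem deg_sub_two (q : ℕ) : deg q (q - 2) = .other := by simp [deg]; omega

theorem deg_cases (q : ℕ) (r : ℤ) : r = q + 1 ∨ r = q ∨ r = q - 1 ∨ deg q r = .other := by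
  unfold deg
  split_ifs <;> simp_all

namespace DoubleData

variable {q : ℕ} (D : DoubleData Λ (sgn q))

theorem deltaTerm_eq_zero {r r' : ℤ} (h : ¬ r + 1 = r') :
    D.deltaTerm (deg q r) (deg q r') = 0 := by
  have key : ∀ i j : Deg, ¬ (i = .middle ∧ j = .upper) → ¬ (i = .lower ∧ j = .middle) →
      D.deltaTerm i j = 0 := by
    intro i j h1 h2
    cases i <;> cases j <;> first | rfl | exact absurd ⟨rfl, rfl⟩ h1 | exact absurd ⟨rfl, rfl⟩ h2
  apply key <;> rintro ⟨h1, h2⟩ <;> unfold deg at h1 h2 <;> split_ifs at h1 h2 <;> omega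

theorem mk_flipIso_ν : QGroup.mk (-sgn q) (ev (D.toPreformation.F : Type u) ∘ₗ
    (0 : Dual Λ D.toPreformation.F →ₗ[Λ] D.toPreformation.F)) = D.flipIso.ν := by
  rw [LinearMap.comp_zero, map_zero]
  rfl

/-- The components of the chain homotopy `1 ≃ h_t` as morphisms. -/
def deltaHom (r r' : ℤ) : D.toPreformation.complex.X r ⟶ D.toPreformation.complex.X r' :=
  ModuleCat.ofHom (D.deltaTerm (deg q r) (deg q r'))

/-- The chain homotopy `1 ≃ h_t`. -/
def homotopy : Homotopy (D.flipIso.h 0 D.mk_flipIso_ν) (𝟙 D.toPreformation.complex) where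
  hom := D.deltaHom
  zero r r' h := ModuleCat.hom_ext (D.deltaTerm_eq_zero h)
  comm r := by
    rw [dNext_eq D.deltaHom (show (ComplexShape.down ℤ).Rel r (r - 1) from by
        change (r - 1 + 1 : ℤ) = r; ring),
      prevD_eq D.deltaHom (show (ComplexShape.down ℤ).Rel (r + 1) r from rfl)]
    refine ModuleCat.hom_ext ?_
    change D.flipIso.hTerm 0 (deg q r) =
      D.deltaTerm (deg q (r - 1)) (deg q r) ∘ₗ D.toPreformation.diff (deg q r) (deg q (r - 1)) +
        D.toPreformation.diff (deg q (r + 1)) (deg q r) ∘ₗ D.deltaTerm (deg q r) (deg q (r + 1)) +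
          LinearMap.id
    rcases deg_cases q r with rfl | rfl | rfl | h
    · rw [show (q + 1 - 1 : ℤ) = q by ring, show (q + 1 + 1 : ℤ) = q + 2 by ring, deg_upper,
        deg_middle, deg_add_two, hTerm_eq_upper]
      exact congrArg (· + LinearMap.id) (add_zero _).symm
    · rw [deg_upper, deg_middle, deg_lower, hTerm_eq_middle]
    · rw [show (q - 1 - 1 : ℤ) = q - 2 by ring, show (q - 1 + 1 : ℤ) = q by ring, deg_lower,
        deg_middle, deg_sub_two, hTerm_eq_lower]
      exact congrArg (· + LinearMap.id) (zero_add _).symm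
    · rw [h]
      exact LinearMap.ext fun x => Subsingleton.elim (α := PUnit) _ _

/-- The element `η` of the homotopy `(1, 0) ≃ (h_t, χ_t)`. -/
def η : W D.toPreformation.complex (2 * q + 2) := fun i => D.etaTerm i.s (deg q i.p) (deg q i.r)

/-- Degrees, signs and positions enter through equations, so that an identity proved for
constructors of `Deg` transports to the actual terms of the complex. -/
theorem structure_equation_of_deg {s : ℕ} {p r p' r' p'' r'' : ℤ} (h : p + r + s = 2 * q + 1)
    (hp : p - 1 = p') (hr : r - 1 = r') (hp' : p + 1 = p'') (hr' : r + 1 = r'')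
    {e e₁ e₂ e₃ e₄ : ℤˣ} (he : r.negOnePow = e) (h₁ : (p' * r').negOnePow = e₁)
    (h₂ : (2 * (q : ℤ) + 2 - s - 1).negOnePow = e₂) (h₃ : ((s : ℤ) + 1).negOnePow = e₃)
    (h₄ : (p * r).negOnePow = e₄) {P R P' R' P'' R'' : Deg} (dP : deg q p = P) (dR : deg q r = R)
    (dP' : deg q p' = P') (dR' : deg q r' = R') (dP'' : deg q p'' = P'') (dR'' : deg q r'' = R'')
    (k : D.flipIso.chiTerm D.Θ 0 D.κ s P R = D.structureTerm s P R P' R' P'' R'' e e₁ e₂ e₃ e₄) :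
    (D.flipIso.chi D.Θ 0 D.κ - 0) ⟨s, p, r, h⟩ =
      (W.homotopyOp D.homotopy (2 * q) (2 * q + 1) rfl (D.toPreformation.psi D.Θ) +
        W.d (2 * q + 2) (2 * q + 1) (by omega) D.η) ⟨s, p, r, h⟩ := by
  refine Eq.trans ?_ (congrArg₂ (· + ·) (W.homotopyOp_apply D.homotopy rfl _ h hp hr)
    (W.d_apply _ D.η h hp' hr')).symm
  rw [sub_zero, Int.negOnePow_succ, he, Int.negOnePow_even _ (even_two_mul _), h₁, h₂, h₃, h₄,
    one_smul]
  subst dP dR dP' dR' dP'' dR''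
  exact k

theorem structure_equation {s : ℕ} {p r : ℤ} (h : p + r + s = 2 * q + 1) :
    (D.flipIso.chi D.Θ 0 D.κ - 0) ⟨s, p, r, h⟩ =
      (W.homotopyOp D.homotopy (2 * q) (2 * q + 1) rfl (D.toPreformation.psi D.Θ) +
        W.d (2 * q + 2) (2 * q + 1) (by omega) D.η) ⟨s, p, r, h⟩ := by
  have e0 : (q : ℤ).negOnePow = sgn q := SplitPreformation.RelBoundaryChoices.negOnePow_q
  have e1 : ((q : ℤ) + 1).negOnePow = -sgn q := by rw [Int.negOnePow_succ, e0]
  have e2 : ((q : ℤ) - 1).negOnePow = -sgn q := by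
    rw [Int.negOnePow_sub, e0, Int.negOnePow_one, mul_neg_one]
  have f1 : ((q : ℤ) * (q + 1)).negOnePow = 1 := Int.negOnePow_even _ (Int.even_mul_succ_self _)
  have f2 : (((q : ℤ) + 1) * q).negOnePow = 1 := by rw [mul_comm, f1]
  have f3 : ((q : ℤ) * (q - 1)).negOnePow = 1 := Int.negOnePow_even _ (Int.even_mul_pred_self _)
  have f4 : (((q : ℤ) - 1) * q).negOnePow = 1 := by rw [mul_comm, f3]
  have g0 : ((q : ℤ) * q).negOnePow = sgn q := by rw [Int.negOnePow_mul_self, e0]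
  have g1 : (((q : ℤ) - 1) * (q - 1)).negOnePow = -sgn q := by rw [Int.negOnePow_mul_self, e2]
  have g2 : (((q : ℤ) + 1) * (q - 1)).negOnePow = -sgn q := by
    rw [show ((q : ℤ) + 1) * (q - 1) = q * (q - 1) + (q - 1) by ring, Int.negOnePow_add, f3, e2,
      one_mul]
  have g3 : (((q : ℤ) - 1) * (q + 1)).negOnePow = -sgn q := by rw [mul_comm, g2]
  have u0 := deg_upper q
  have u1 := deg_middle q
  have u2 := deg_lower q
  have u3 := deg_add_two q
  have u4 := deg_sub_two q
  have v0 : (q : ℤ) + 1 - 1 = q := by ring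
  have v1 : (q : ℤ) + 1 + 1 = q + 2 := by ring
  have v2 : (q : ℤ) - 1 + 1 = q := by ring
  have v3 : (q : ℤ) - 1 - 1 = q - 2 := by ring
  have w0 : (2 * (q : ℤ) + 2 - (0 : ℕ) - 1).negOnePow = -1 :=
    Int.negOnePow_odd _ ⟨q, by push_cast; ring⟩
  have w1 : (2 * (q : ℤ) + 2 - (1 : ℕ) - 1).negOnePow = 1 :=
    Int.negOnePow_even _ ⟨q, by push_cast; ring⟩
  have w2 : (2 * (q : ℤ) + 2 - (2 : ℕ) - 1).negOnePow = -1 :=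
    Int.negOnePow_odd _ ⟨q - 1, by push_cast; ring⟩
  have w3 : (2 * (q : ℤ) + 2 - (3 : ℕ) - 1).negOnePow = 1 :=
    Int.negOnePow_even _ ⟨q - 1, by push_cast; ring⟩
  have x0 : (((0 : ℕ) : ℤ) + 1).negOnePow = -1 := rfl
  have x1 : (((1 : ℕ) : ℤ) + 1).negOnePow = 1 := Int.negOnePow_even _ ⟨1, by norm_num⟩
  have x2 : (((2 : ℕ) : ℤ) + 1).negOnePow = -1 := Int.negOnePow_odd _ ⟨1, by norm_num⟩
  have x3 : (((3 : ℕ) : ℤ) + 1).negOnePow = 1 := Int.negOnePow_even _ ⟨2, by norm_num⟩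
  -- Outside the three degrees the source or the target is zero and both sides agree trivially.
  have source : ∀ p : ℤ, deg q p = .other → ∀ f : Dual Λ (D.toPreformation.complex.X p), f = 0 := by
    intro p hp
    change ∀ f : Dual Λ (D.toPreformation.term (deg q p)), f = 0
    rw [hp]
    exact fun f => Dual.ext fun x => by rw [show x = 0 from Subsingleton.elim (α := PUnit) _ _,
      map_zero, map_zero]
  have target : ∀ r : ℤ, deg q r = .other → ∀ x : D.toPreformation.complex.X r, x = 0 := by
    intro r hr
    change ∀ x : D.toPreformation.term (deg q r), x = 0
    rw [hr]
    exact fun x => Subsingleton.elim (α := PUnit) _ _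
  rcases deg_cases q p with rfl | rfl | rfl | hp
  · rcases deg_cases q r with rfl | rfl | rfl | hr
    -- For p = r = q + 1 the index s would be -1.
    · omega
    · obtain rfl : s = 0 := by omega
      exact D.structure_equation_of_deg h v0 rfl v1 rfl e0 f3 w0 x0 f2 u0 u1 u1 u2 u3 u0
        D.chiTerm_zero_upper_middle
    · obtain rfl : s = 1 := by omega
      exact D.structure_equation_of_deg h v0 v3 v1 v2 e2 rfl w1 x1 g2 u0 u2 u1 u4 u3 u1
        (D.chiTerm_one_upper_lower _)
    · exact LinearMap.ext fun f => (target r hr _).trans (target r hr _).symm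
  · rcases deg_cases q r with rfl | rfl | rfl | hr
    · obtain rfl : s = 0 := by omega
      exact D.structure_equation_of_deg h rfl v0 rfl v1 e1 f4 w0 x0 f1 u1 u0 u2 u1 u0 u3
        D.chiTerm_zero_middle_upper
    · obtain rfl : s = 1 := by omega
      exact D.structure_equation_of_deg h rfl rfl rfl rfl e0 g1 w1 x1 g0 u1 u1 u2 u2 u0 u0
        D.chiTerm_one_middle_middle
    · obtain rfl : s = 2 := by omega
      exact D.structure_equation_of_deg h rfl v3 rfl v2 e2 rfl w2 x2 f3 u1 u2 u2 u4 u0 u1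
        (D.chiTerm_two_middle_lower _)
    · exact LinearMap.ext fun f => (target r hr _).trans (target r hr _).symm
  · rcases deg_cases q r with rfl | rfl | rfl | hr
    · obtain rfl : s = 1 := by omega
      exact D.structure_equation_of_deg h v3 v0 v2 v1 e1 rfl w1 x1 g3 u2 u0 u4 u1 u1 u3
        (D.chiTerm_one_lower_upper _)
    · obtain rfl : s = 2 := by omega
      exact D.structure_equation_of_deg h v3 rfl v2 rfl e0 rfl w2 x2 f4 u2 u1 u4 u2 u1 u0
        (D.chiTerm_two_lower_middle _)
    · obtain rfl : s = 3 := by omega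
      exact D.structure_equation_of_deg h v3 v3 v2 v2 e2 rfl w3 x3 g1 u2 u2 u4 u4 u1 u1
        (D.chiTerm_three_lower_lower _)
    · exact LinearMap.ext fun f => (target r hr _).trans (target r hr _).symm
  · refine LinearMap.ext fun f => ?_
    rw [source p hp f, map_zero, map_zero]

/-- The homotopy `(Δ, η) : (1, 0) ≃ (h_t, χ_t)`. -/
def quadraticHomotopy : QuadraticHomotopy (2 * q) (D.toPreformation.psi D.Θ)
    (𝟙 D.toPreformation.complex) 0 (D.flipIso.h 0 D.mk_flipIso_ν) (D.flipIso.chi D.Θ 0 D.κ) where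
  Δ := D.homotopy
  η := D.η
  eq := funext fun ⟨_, _, _, h⟩ => D.structure_equation h

/-- The choices which show that the flip-isomorphism is a flip-isomorphism rel `∂`. -/
def choices : SplitPreformation.RelBoundaryChoices D.flipIso where
  θ := D.Θ
  mk_θ := rfl
  ν := 0
  mk_ν := D.mk_flipIso_ν
  κ := D.κ
  eq_κ := by
    refine LinearMap.ext fun v => Dual.ext fun w => ?_
    refine Eq.trans ?_ (D.map_β_Θ_β v w)
    change D.Θ (D.β v) (D.β w) + D.Θ v w + star (D.μ w
      ((0 : Dual Λ (D.U × Dual Λ D.U) →ₗ[Λ] D.U × Dual Λ D.U) (D.μ v))) = _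
    simp
  homotopy := D.quadraticHomotopy

/-- With the positions as variables, substitution removes the transports hidden in the definition of
R. -/
theorem castTerm_deltaTerm {i j : Deg} (hi : i = .middle) (hj : j = .upper) (x : D.U)
    (ψ : Dual Λ D.U) : (D.toPreformation.castTerm hj (D.deltaTerm i j
      ((D.toPreformation.castTerm hi).symm (show (D.U × Dual Λ D.U) × Dual Λ (D.U × Dual Λ D.U)
        from ((x, ψ), 0)))) : D.toPreformation.term .upper) =
      (show D.U × D.K from (sgn q • x, 0)) := by
  subst hi hj
  exact D.Δ₁_apply_zero x ψ

theorem R_apply (x : D.U) (ψ : Dual Λ D.U) :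
    D.choices.R (show D.U × Dual Λ D.U from (x, ψ)) = (show D.U × D.K from (sgn q • x, 0)) :=
  D.castTerm_deltaTerm (deg_middle q) (deg_upper q) x ψ

theorem etaTerm_eq_zero {i : Deg} (hi : i = .upper) : D.etaTerm 0 i i = 0 := by
  subst hi
  rfl

theorem η₀_eq_zero : D.choices.η₀ = 0 := by
  have h : D.choices.homotopy.η ⟨0, q + 1, q + 1, by push_cast; ring⟩ = 0 :=
    D.etaTerm_eq_zero (deg_upper q)
  unfold SplitPreformation.RelBoundaryChoices.η₀
  rw [h, LinearMap.zero_comp, LinearMap.comp_zero]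

end DoubleData

end DoubleChoices

/-! ### The quadratic signature of the normal form vanishes. -/

section DoubleSignature

variable {Λ : Type u} [Ring Λ] [StarRing Λ]

/-- Adding H(L) to both sides gives the shape of the vanishing criterion. -/
theorem LGroup.mk_eq_zero_of_isometric {ε : ℤˣ} {A : QuadForm Λ ε} (hA : A.NonSingular)
    {L : FreeModule Λ} (h : A.Isometric (QuadForm.hyperbolic ε L)) : LGroup.mk A hA = 0 :=
  (LGroup.mk_eq_zero_iff hA).2 ⟨L, ⟨L × L⟩,
    (h.sum (QuadForm.Isometric.refl _)).trans (QuadForm.hyperbolic_sum L L)⟩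

namespace DoubleData

variable {q : ℕ} (D : DoubleData Λ (sgn q))

/-- The splitting of `(U ⊕ K)^* ⊕ (U ⊕ K) ⊕ (U ⊕ U^*)` into the lagrangian `K^* ⊕ (U ⊕ U^*)` and
the complement `U^* ⊕ (U ⊕ K)`. -/
def lagrangianSplitting :
    ((Dual Λ D.K × (D.U × Dual Λ D.U)) × (Dual Λ D.U × (D.U × D.K))) ≃ₗ[Λ]
      (Dual Λ (D.U × D.K) × (D.U × D.K) × (D.U × Dual Λ D.U)) :=
  (LinearEquiv.prodProdProdComm Λ _ _ _ _ ≪≫ₗ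
    ((LinearEquiv.prodComm Λ _ _ ≪≫ₗ dualProd).prodCongr (LinearEquiv.prodComm Λ _ _)))

/-- The identification of the complement with the dual of the lagrangian. -/
def lagrangianDual : (Dual Λ D.U × (D.U × D.K)) ≃ₗ[Λ] Dual Λ (Dual Λ D.K × (D.U × Dual Λ D.U)) :=
  LinearEquiv.ofLinearMap
    ((LinearMap.snd Λ D.U D.K ∘ₗ LinearMap.snd Λ (Dual Λ D.U) (D.U × D.K)).prod
      ((sgn q • (LinearMap.fst Λ (Dual Λ D.U) (D.U × D.K) -
        D.b ∘ₗ LinearMap.snd Λ D.U D.K ∘ₗ LinearMap.snd Λ (Dual Λ D.U) (D.U × D.K))).prod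
        (LinearMap.id.coprod D.d ∘ₗ LinearMap.snd Λ (Dual Λ D.U) (D.U × D.K))))
    ((sgn q • (LinearMap.fst Λ (Dual Λ D.U) D.U ∘ₗ LinearMap.snd Λ D.K (Dual Λ D.U × D.U)) +
      D.b ∘ₗ LinearMap.fst Λ D.K (Dual Λ D.U × D.U)).prod
      ((LinearMap.snd Λ (Dual Λ D.U) D.U ∘ₗ LinearMap.snd Λ D.K (Dual Λ D.U × D.U) -
        D.d ∘ₗ LinearMap.fst Λ D.K (Dual Λ D.U × D.U)).prod
          (LinearMap.fst Λ D.K (Dual Λ D.U × D.U))))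
    (LinearMap.ext fun ⟨k, χ, v⟩ => Prod.ext rfl (Prod.ext (by
      change sgn q • (sgn q • χ + D.b k - D.b k) = χ
      rw [add_sub_cancel_right, units_smul_smul]) (sub_add_cancel v (D.d k))))
    (LinearMap.ext fun ⟨φ, v, k⟩ => Prod.ext (by
      change sgn q • sgn q • (φ - D.b k) + D.b k = φ
      rw [units_smul_smul, sub_add_cancel]) (Prod.ext (add_sub_cancel_right v (D.d k)) rfl)) ≪≫ₗ
  (evEquiv (D.K : Type u)).prodCongr dualHyp ≪≫ₗ dualProd

theorem lagrangianDual_apply (φ : Dual Λ D.U) (u : D.U) (k : D.K) (lam : Dual Λ D.K) (x : D.U)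
    (ψ : Dual Λ D.U) : D.lagrangianDual (φ, (u, k)) (lam, (x, ψ)) =
      star (lam k) + (sgn q • (φ x - D.b k x) + star (ψ (u + D.d k))) := rfl

/-- With η₀ = 0, the form ξ vanishes on K^* ⊕ (U ⊕ U^*): its G-component is zero and K^* annihilates
the image of R, which lies in U. The complement U^* ⊕ (U ⊕ K) pairs with it through k, ε(φ - bk) and
u + dk, a triangular and hence invertible system. -/
theorem form_isometric : ∃ L : FreeModule Λ,
    D.choices.form.Isometric (QuadForm.hyperbolic (-sgn q) L) := by
  let X : (Dual Λ (D.U × D.K) × (D.U × D.K) × (D.U × Dual Λ D.U)) →ₗ[Λ]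
      Dual Λ (Dual Λ (D.U × D.K) × (D.U × D.K) × (D.U × Dual Λ D.U)) :=
    D.toPreformation.xi D.Θ D.flipIso.β.toLinearMap D.choices.R D.choices.η₀
  have hX : ∀ (a a' : Dual Λ (D.U × D.K)) (g g' : D.U × D.K) (x x' : D.U) (ψ ψ' : Dual Λ D.U),
      X (a, g, (x, ψ)) (a', g', (x', ψ')) = star (a' (D.β g)) - sgn q • star (D.Θ g' g) +
        (a (sgn q • x', 0) + D.μ g (x', ψ')) := by
    intro a a' g g' x x' ψ ψ'
    refine (SplitPreformation.xi_apply _ _ _ _ _ _ _ _ _ _).trans ?_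
    have h : ∀ v : D.U × D.K, v = 0 → star (a' (-v + D.β g)) = star (a' (D.β g)) := by
      rintro _ rfl
      rw [neg_zero, zero_add]
    exact congrArg₂ (fun r s => r - sgn q • star (D.Θ g' g) + (s + D.μ g (x', ψ')))
      (h _ (LinearMap.congr_fun D.η₀_eq_zero a)) (congrArg a (D.R_apply x' ψ'))
  let X' : ((Dual Λ D.K × (D.U × Dual Λ D.U)) × (Dual Λ D.U × (D.U × D.K))) →ₗ[Λ]
    Dual Λ ((Dual Λ D.K × (D.U × Dual Λ D.U)) × (Dual Λ D.U × (D.U × D.K))) :=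
    Dual.map D.lagrangianSplitting.toLinearMap ∘ₗ X ∘ₗ D.lagrangianSplitting.toLinearMap
  -- The representative itself, not merely its class, vanishes on the lagrangian, as the lemma
  -- demands.
  obtain ⟨f, hf⟩ := QGroup.exists_pullback_hyp_of_lagrangian (ε := -sgn q) X'
    (by
      rintro ⟨lam, x, ψ⟩ ⟨lam', x', ψ'⟩
      change X (dualProd (0, lam), 0, (x, ψ)) (dualProd (0, lam'), 0, (x', ψ')) = 0
      rw [hX]
      simp [dualProd_apply])
    D.lagrangianDual
    (by
      rintro ⟨lam, x, ψ⟩ ⟨φ, u, k⟩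
      change _ = X (dualProd (φ, 0), (u, k), (0, 0)) (dualProd (0, lam), 0, (x, ψ)) +
        (-sgn q) • star (X (dualProd (0, lam), 0, (x, ψ)) (dualProd (φ, 0), (u, k), (0, 0)))
      rw [hX, hX, lagrangianDual_apply, β_apply, μ_apply, dualProd_apply, dualHyp_apply]
      simp [dualProd_apply, smul_sub]
      abel)
  refine ⟨⟨Dual Λ D.K × (D.U × Dual Λ D.U)⟩, D.lagrangianSplitting.symm ≪≫ₗ f, ?_⟩
  have h : QGroup.pullback (D.lagrangianSplitting.symm ≪≫ₗ f).toLinearMap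
      (QGroup.hyp Λ (Dual Λ D.K × (D.U × Dual Λ D.U)) (-sgn q)) = QGroup.mk (-sgn q) X := by
    rw [LinearEquiv.coe_trans, ← QGroup.pullback_pullback, hf, QGroup.pullback_mk]
    congr 1
    refine LinearMap.ext fun v => Dual.ext fun w => ?_
    change X (D.lagrangianSplitting (D.lagrangianSplitting.symm v))
      (D.lagrangianSplitting (D.lagrangianSplitting.symm w)) = X v w
    rw [LinearEquiv.apply_symm_apply, LinearEquiv.apply_symm_apply]
  exact h

theorem quadraticSignature_eq_zero :
    SplitPreformation.quadraticSignature D.flipIso D.choices = 0 := by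
  obtain ⟨L, h⟩ := D.form_isometric
  exact LGroup.mk_eq_zero_of_isometric _ h

end DoubleData

end DoubleSignature

/-! ### Reduction of elementary preformations to the normal form. -/

section NormalForm

variable {Λ : Type u} [Ring Λ] [StarRing Λ]

/-- F.g. free modules are reflexive: functionals separate points, and a preimage is found in the
double dual. -/
theorem bijective_of_bijective_map {M N : Type u} [AddCommGroup M] [Module Λ M] [AddCommGroup N]
    [Module Λ N] [Module.Free Λ M] [Module.Finite Λ M] [Module.Free Λ N] [Module.Finite Λ N]
    {f : M →ₗ[Λ] N} (h : Function.Bijective (Dual.map f)) : Function.Bijective f := by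
  let e := LinearEquiv.ofBijective (Dual.map f) h
  constructor
  · intro x y hxy
    refine eq_of_dual_eq (Λ := Λ) fun φ => ?_
    obtain ⟨ψ, rfl⟩ := h.2 φ
    exact congrArg ψ hxy
  · intro y
    obtain ⟨x, hx⟩ := (ev_bijective (Λ := Λ) M).2 (Dual.map e.symm.toLinearMap (ev N y))
    refine ⟨x, eq_of_dual_eq (Λ := Λ) fun ψ => ?_⟩
    have k := congrArg (fun Φ : Dual Λ (Dual Λ M) => star (Φ (e ψ))) hx
    simpa [e] using k

namespace SplitPreformation

variable {q : ℕ} (y : SplitPreformation Λ (sgn q))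

/-- A preformation whose `h`-lagrangian has a free complement is strongly isomorphic to one in
normal form. -/
theorem exists_strongIso_toPreformation (P K : FreeModule Λ) (E : (P × K) ≃ₗ[Λ] y.G)
    (r : y.F →ₗ[Λ] P) (hr : ∀ v, r (y.γ (E v)) = v.1)
    (hθ : QGroup.pullback (E.toLinearMap ∘ₗ LinearMap.inl Λ P K) y.θ = 0)
    (hμ : ∀ u : P, y.μ (E (u, 0)) = 0 → u = 0)
    (hex : ∀ f : Dual Λ y.F, (∀ u : P, f (y.γ (E (u, 0))) = 0) → ∃ u : P, y.μ (E (u, 0)) = f) :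
    ∃ D : DoubleData Λ (sgn q), Nonempty (StrongIso D.toPreformation y) := by
  obtain ⟨θ, hθy⟩ := QGroup.mk_surjective y.θ
  have symm_θ := fun g g' => y.symm_θ_apply hθy g g'
  let i : P →ₗ[Λ] y.G := E.toLinearMap ∘ₗ LinearMap.inl Λ P K
  let j : K →ₗ[Λ] y.G := E.toLinearMap ∘ₗ LinearMap.inr Λ P K
  have hE : ∀ u k, E (u, k) = i u + j k := fun u k => by
    change E (u, k) = E (u, 0) + E (0, k)
    rw [← map_add, Prod.mk_add_mk, add_zero, zero_add]
  have hri : ∀ u, r (y.γ (i u)) = u := fun u => hr (u, 0)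
  have hrj : ∀ k, r (y.γ (j k)) = 0 := fun k => hr (0, k)
  have hiso : ∀ u u', y.μ (i u) (y.γ (i u')) = 0 := by
    intro u u'
    have h := congrArg QGroup.symm hθ
    rw [QGroup.symm_pullback, map_zero, y.symm_θ] at h
    exact congrArg (fun φ : Dual Λ P => φ u') (LinearMap.congr_fun h u)
  -- F^* ≅ P^* ⊕ P: restriction along γi reads off the P^*-coordinate, and a functional vanishing on
  -- the image of γi comes from a unique element of P through μi.
  let e₀ : Dual Λ P × P →ₗ[Λ] Dual Λ y.F := (Dual.map r).coprod (y.μ ∘ₗ i)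
  have he₀ : Function.Bijective e₀ := by
    have key : ∀ φ u u', e₀ (φ, u) (y.γ (i u')) = φ u' := by
      intro φ u u'
      change φ (r (y.γ (i u'))) + y.μ (i u) (y.γ (i u')) = φ u'
      rw [hri, hiso, add_zero]
    constructor
    · rw [injective_iff_map_eq_zero]
      rintro ⟨φ, u⟩ h
      have hφ : φ = 0 := Dual.ext fun u' => by rw [← key φ u u', h]; rfl
      subst hφ
      have hu : Dual.map r 0 + y.μ (i u) = 0 := h
      rw [map_zero, zero_add] at hu
      rw [hμ u hu]
      rfl
    · intro f
      obtain ⟨u, hu⟩ := hex (f - Dual.map (r : y.F →ₗ[Λ] P) (Dual.map (y.γ ∘ₗ i) f)) (fun u => by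
        change f (y.γ (i u)) - f (y.γ (i (r (y.γ (i u))))) = 0
        rw [hri, sub_self])
      refine ⟨(Dual.map (y.γ ∘ₗ i) f, u), ?_⟩
      change Dual.map r (Dual.map (y.γ ∘ₗ i) f) + y.μ (E (u, 0)) = f
      rw [hu, add_sub_cancel]
  let e := LinearEquiv.ofBijective e₀ he₀
  -- The dual of A₀ is e₀ under (P ⊕ P^*)^* = P^* ⊕ P, so A₀ is an isomorphism by reflexivity. It
  -- gives the coordinates in which γ and μ have normal form.
  let A₀ : y.F →ₗ[Λ] P × Dual Λ P := r.prod (transpose (y.μ ∘ₗ i))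
  have hA₀ : ∀ φ u, Dual.map A₀ (dualHyp (φ, u)) = e (φ, u) := by
    intro φ u
    refine Dual.ext fun x => ?_
    change φ (r x) + star (star (y.μ (i u) x)) = φ (r x) + y.μ (i u) x
    rw [star_star]
  let A : y.F ≃ₗ[Λ] P × Dual Λ P := LinearEquiv.ofBijective A₀ <| bijective_of_bijective_map <| by
    have h : ⇑(Dual.map A₀) = e ∘ dualHyp.symm := funext fun f => by
      obtain ⟨⟨φ, u⟩, rfl⟩ := dualHyp.surjective f
      rw [hA₀, Function.comp_apply, LinearEquiv.symm_apply_apply]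
    rw [h]
    exact e.bijective.comp dualHyp.symm.bijective
  let b : K →ₗ[Λ] Dual Λ P := transpose (y.μ ∘ₗ i) ∘ₗ y.γ ∘ₗ j
  let d : K →ₗ[Λ] P := LinearMap.snd Λ (Dual Λ P) P ∘ₗ e.symm.toLinearMap ∘ₗ y.μ ∘ₗ j
  have hb : ∀ k u, b k u = star (y.μ (i u) (y.γ (j k))) := fun k u => rfl
  have hAγ : ∀ u k, A (y.γ (E (u, k))) = (u, b k) := by
    intro u k
    refine Prod.ext (hr (u, k)) (Dual.ext fun u' => ?_)
    change star (y.μ (i u') (y.γ (E (u, k)))) = star (y.μ (i u') (y.γ (j k)))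
    rw [hE, map_add, map_add, hiso, zero_add]
  have hμE : ∀ u k, Dual.map A.toLinearMap (dualHyp (-(sgn q • b k), u + d k)) =
      y.μ (E (u, k)) := by
    intro u k
    -- The P^*-coordinate of μj is forced: evaluation on γi and the (-ε)-symmetry of γ^*μ give -εb.
    have h1 : e.symm (y.μ (j k)) = (-(sgn q • b k), d k) := by
      refine Prod.ext (Dual.ext fun u' => ?_) rfl
      have h2 : e (e.symm (y.μ (j k))) (y.γ (i u')) = (e.symm (y.μ (j k))).1 u' := by
        change (e.symm (y.μ (j k))).1 (r (y.γ (i u'))) +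
          y.μ (i (e.symm (y.μ (j k))).2) (y.γ (i u')) = _
        rw [hri, hiso, add_zero]
      rw [LinearEquiv.apply_symm_apply, y.μ_apply_γ] at h2
      rw [← h2, neg_units_smul]
      rfl
    have h3 : ((-(sgn q • b k), u + d k) : Dual Λ P × P) = (0, u) + (-(sgn q • b k), d k) := by
      rw [Prod.mk_add_mk, zero_add]
    have h4 : e (0, u) = y.μ (i u) := by
      change Dual.map r 0 + y.μ (i u) = _
      rw [map_zero, zero_add]
    rw [hE, map_add, ← h4, ← LinearEquiv.apply_symm_apply e (y.μ (j k)), h1, ← map_add, ← h3]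
    exact hA₀ _ _
  let D : DoubleData Λ (sgn q) :=
    { U := P
      K := K
      b := b
      d := d
      θ := Dual.map j ∘ₗ θ ∘ₗ j
      symm_θ := by
        intro k k'
        change θ (j k) (j k') - sgn q • star (θ (j k') (j k)) = _
        rw [← symm_θ]
        have h := congrArg (fun f : Dual Λ y.F => f (y.γ (E (0, k')))) (hμE 0 k)
        simp only [Dual.map_apply, LinearEquiv.coe_coe] at h
        rw [hAγ, dualHyp_apply, map_zero, zero_add, zero_add] at h
        exact h.symm }
  refine ⟨D, ⟨⟨A.symm, E, ?_, ?_, ?_⟩⟩⟩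
  · refine LinearMap.ext fun (v : P × K) => ?_
    exact (LinearEquiv.symm_apply_eq A).2 (hAγ v.1 v.2).symm
  · exact LinearMap.ext fun (v : P × K) => hμE v.1 v.2
  · change QGroup.mk (-sgn q) D.Θ = QGroup.pullback E.toLinearMap y.θ
    rw [← hθy, QGroup.pullback_mk] at hθ
    -- θ vanishes on P only as a class, with witness χ₀. The extra block θ(i, j) in χ moves the P–K
    -- part of the representative to the K–P corner, where it becomes -εb.
    obtain ⟨χ₀, hχ₀⟩ := (QuotientAddGroup.eq_zero_iff _).1 hθ
    have hχ : ∀ u u', χ₀ u u' + sgn q • star (χ₀ u' u) = θ (i u) (i u') := fun u u' => by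
      rw [← sub_neg_eq_add, ← neg_units_smul]
      exact congrArg (fun φ : Dual Λ P => φ u') (LinearMap.congr_fun hχ₀ u)
    let χ : (P × K) →ₗ[Λ] Dual Λ (P × K) :=
      dualProd.toLinearMap ∘ₗ (χ₀.prod (Dual.map j ∘ₗ θ ∘ₗ i)) ∘ₗ LinearMap.fst Λ P K
    have hχ' : ∀ u u' k k', χ (u, k) (u', k') = χ₀ u u' + θ (i u) (j k') := fun u u' k k' => rfl
    rw [← hθy, QGroup.pullback_mk, eq_comm, ← sub_eq_zero, ← map_sub, ← QGroup.mk_sub_eq_zero χ]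
    congr 1
    refine LinearMap.ext fun ⟨u, k⟩ => Dual.ext fun ⟨u', k'⟩ => ?_
    change θ (E (u, k)) (E (u', k')) - D.Θ (u, k) (u', k') =
      χ (u, k) (u', k') - (-sgn q) • star (χ (u', k') (u, k))
    rw [hχ', hχ', hE, hE, DoubleData.Θ_apply, dualProd_apply, neg_units_smul, sub_neg_eq_add]
    change _ - ((-(sgn q • b k)) u' + θ (j k) (j k')) = _
    rw [Dual.neg_apply, Dual.units_smul_apply, hb, symm_θ]
    simp only [map_add, Dual.add_apply, ← hχ, star_sub, star_add, star_units_smul, star_star,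
      smul_sub, smul_add, units_smul_smul]
    abel

/-- An elementary preformation is stably strongly isomorphic to one in normal form. -/
theorem Elementary.exists_toPreformation {z : SplitPreformation Λ (sgn q)} (hz : z.Elementary) :
    ∃ D : DoubleData Λ (sgn q), LMonoid.mk D.toPreformation = LMonoid.mk z := by
  obtain ⟨U, hfree, hfin, -, hθ, hγ, hμ, ⟨V, hV⟩, -, e, he⟩ := hz
  let P : FreeModule Λ := ⟨U⟩
  let i : P →ₗ[Λ] z.G := U.subtype
  let r : z.F →ₗ[Λ] P := (LinearEquiv.ofInjective (z.γ ∘ₗ i) hγ).symm.toLinearMap ∘ₗ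
    Submodule.projectionOnto _ V hV
  have hr : ∀ u, r (z.γ (i u)) = u := fun u => by
    refine (LinearEquiv.symm_apply_eq _).2 ?_
    exact Submodule.projectionOnto_apply_of_mem_left hV (LinearMap.mem_range_self (z.γ ∘ₗ i) u)
  have hex : ∀ f : Dual Λ z.F, (∀ u, f (z.γ (i u)) = 0) → ∃ u, z.μ (i u) = f := by
    intro f hf
    have h : e (Submodule.Quotient.mk f) = 0 := by
      rw [he]
      refine Dual.ext ?_
      rintro ⟨_, u, rfl⟩
      exact hf u
    rw [LinearEquiv.map_eq_zero_iff, Submodule.Quotient.mk_eq_zero] at h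
    exact h
  obtain ⟨d⟩ := nonempty_equiv_dual Λ P
  let s : z.G →ₗ[Λ] P := r ∘ₗ z.γ
  have hs : ∀ u, s (i u) = u := hr
  let y := z.sum (boundary (QuadForm.hyperbolic (-sgn q) P))
  -- s splits i, but ker s need not be free. The summand P^* ≅ P of ∂H(P) replaces the part is(g)
  -- removed from g, so ker s ⊕ P^* ≅ G is a free complement of the enlarged lagrangian P ⊕ P.
  let E : ((P × P) × z.G) ≃ₗ[Λ] (z.G × (P × Dual Λ P)) :=
    LinearEquiv.ofLinearMap
      ((i ∘ₗ LinearMap.fst Λ P P).coprod (LinearMap.id - i ∘ₗ s) |>.prod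
        ((LinearMap.snd Λ P P).prodMap (d.toLinearMap ∘ₗ s)))
      (((s ∘ₗ LinearMap.fst Λ z.G (P × Dual Λ P)).prod
          (LinearMap.fst Λ P (Dual Λ P) ∘ₗ LinearMap.snd Λ z.G (P × Dual Λ P))).prod
        ((LinearMap.id - i ∘ₗ s).coprod
          (i ∘ₗ d.symm.toLinearMap ∘ₗ LinearMap.snd Λ P (Dual Λ P))))
      (by
        refine LinearMap.ext fun ⟨g, l, φ⟩ => Prod.ext ?_ (Prod.ext rfl ?_)
        · change i (s g) + (g - i (s g) + i (d.symm φ) - i (s (g - i (s g) + i (d.symm φ)))) = g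
          rw [map_add, map_sub, hs, hs, sub_self, zero_add]
          abel
        · change d (s (g - i (s g) + i (d.symm φ))) = φ
          rw [map_add, map_sub, hs, hs, sub_self, zero_add, LinearEquiv.apply_symm_apply])
      (by
        refine LinearMap.ext fun ⟨⟨p, l⟩, g⟩ => Prod.ext (Prod.ext ?_ rfl) ?_
        · change s (i p + (g - i (s g))) = p
          rw [map_add, map_sub, hs, hs, sub_self, add_zero]
        · change i p + (g - i (s g)) - i (s (i p + (g - i (s g)))) + i (d.symm (d (s g))) = g
          rw [map_add, map_sub, hs, hs, sub_self, add_zero, LinearEquiv.symm_apply_apply]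
          abel)
  have hE : ∀ p l : P, E ((p, l), 0) = (i p, (l, 0)) := fun p l => by
    refine Prod.ext ?_ (Prod.ext rfl ?_)
    · change i p + ((0 : z.G) - i (s 0)) = i p
      simp
    · change d (s 0) = 0
      simp
  have hμy : ∀ (p l : P) (x : z.F) (x' : P) (ψ : Dual Λ P),
      y.μ (show z.G × (P × Dual Λ P) from (i p, (l, 0)))
        (show z.F × (P × Dual Λ P) from (x, (x', ψ))) =
      z.μ (i p) x + (-sgn q) • star (ψ l) := by
    intro p l x x' ψ
    change z.μ (i p) x + ((0 : Dual Λ P) x' + (-sgn q) • star (ψ l)) = _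
    rw [Dual.zero_apply, zero_add]
  obtain ⟨D, ⟨f⟩⟩ := y.exists_strongIso_toPreformation ⟨P × P⟩ z.G E
    (r.prodMap (LinearMap.fst Λ P (Dual Λ P)))
    (by
      rintro ⟨⟨p, l⟩, g⟩
      refine Prod.ext ?_ rfl
      change s (i p + (g - i (s g))) = p
      rw [map_add, map_sub, hs, hs, sub_self, add_zero])
    (by
      have h : E.toLinearMap ∘ₗ LinearMap.inl Λ (P × P) z.G =
          i.prodMap (LinearMap.inl Λ P (Dual Λ P)) := LinearMap.ext fun v => hE v.1 v.2
      have h' : QGroup.pullback (i.prodMap (LinearMap.inl Λ P (Dual Λ P)))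
          (QGroup.sum z.θ (QGroup.hyp Λ P (-sgn q))) = 0 := by
        rw [QGroup.pullback_sum, QGroup.pullback_inl_hyp, hθ, QGroup.sum, map_zero, map_zero,
          add_zero]
      rw [← h] at h'
      exact h')
    (by
      rintro ⟨p, l⟩ h
      have h' := fun x x' ψ => (hμy p l x x' ψ).symm.trans (congrArg (fun φ : Dual Λ y.F =>
        φ (show z.F × (P × Dual Λ P) from (x, (x', ψ)))) ((congrArg y.μ (hE p l).symm).trans h))
      refine Prod.ext ?_ ?_
      · refine hμ (a₁ := p) (a₂ := 0) (Dual.ext fun x => ?_)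
        have k : z.μ (i p) x + (-sgn q) • star ((0 : Dual Λ P) l) = 0 := h' x 0 0
        change z.μ (i p) x = z.μ (i 0) x
        simpa using k
      · refine eq_of_dual_eq (Λ := Λ) fun ψ => ?_
        have k : z.μ (i p) 0 + (-sgn q) • star (ψ l) = 0 := h' 0 0 ψ
        rw [map_zero, zero_add] at k
        have k' : star (ψ l) = 0 := by rw [← units_smul_smul (-sgn q) (star (ψ l)), k, smul_zero]
        change ψ l = ψ 0
        rw [map_zero, ← star_star (ψ l), k', star_zero])
    (by
      intro f hf
      obtain ⟨⟨f₁, f₂⟩, rfl⟩ := dualProd.surjective (show Dual Λ (z.F × (P × Dual Λ P)) from f)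
      obtain ⟨⟨φ, v⟩, rfl⟩ := dualHyp.surjective f₂
      have hf' : ∀ p l : P, f₁ (z.γ (i p)) + (φ l + star ((0 : Dual Λ P) v)) = 0 := fun p l => by
        refine Eq.trans ?_ (hf (p, l))
        exact congrArg (fun w : z.G × (P × Dual Λ P) =>
          dualProd (f₁, dualHyp (φ, v)) (z.γ w.1, w.2)) (hE p l).symm
      obtain ⟨p, hp⟩ := hex f₁ (fun p => by simpa using hf' p 0)
      have hφ : ∀ l, φ l = 0 := fun l => by simpa using hf' 0 l
      -- The map μ of ∂H(P) sends (l, 0) to the functional ψ ↦ -ε·conj ψ(l) on P^*; the sign in the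
      -- witness compensates for this factor.
      refine ⟨(p, -(sgn q • v)), (congrArg y.μ (hE _ _)).trans (Dual.ext fun w => ?_)⟩
      obtain ⟨x, x', ψ⟩ : z.F × (P × Dual Λ P) := w
      refine (hμy _ _ x x' ψ).trans ?_
      change _ = f₁ x + (φ x' + star (ψ v))
      rw [hp, hφ, zero_add]
      simp only [map_neg, map_units_smul, star_neg, star_units_smul, neg_units_smul, smul_neg,
        units_smul_smul, neg_neg])
  exact ⟨D, (LMonoid.mk_eq_mk_of_strongIso f).trans (LMonoid.mk_sum_boundary_hyperbolic z P)⟩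

end SplitPreformation

end NormalForm

end
end AlgebraicSurgery

theorem mainTheorem10 {Λ : Type u} [Ring Λ] [StarRing Λ] [IsStablyFiniteRing Λ]
    (q : ℕ) (hq : 2 ≤ q) (z' : AlgebraicSurgery.SplitPreformation Λ (AlgebraicSurgery.sgn q)) :
    (AlgebraicSurgery.LMonoid.mk z').Elementary ↔
      ∃ z : AlgebraicSurgery.SplitPreformation Λ (AlgebraicSurgery.sgn q),
        AlgebraicSurgery.LMonoid.mk z = AlgebraicSurgery.LMonoid.mk z' ∧
        ∃ (t : z.FlipIso) (c : AlgebraicSurgery.SplitPreformation.RelBoundaryChoices t),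
          AlgebraicSurgery.SplitPreformation.quadraticSignature t c = 0 := by
  constructor
  · rintro ⟨y, hy, hel⟩
    -- The normal form lies in the given class and serves as the representative z.
    obtain ⟨D, hD⟩ := hel.exists_toPreformation
    exact ⟨D.toPreformation, hD.trans hy, D.flipIso, D.choices, D.quadraticSignature_eq_zero⟩
  · rintro ⟨z, hz, t, c, hc⟩
    rw [← hz]
    exact AlgebraicSurgery.SplitPreformation.elementary_of_quadraticSignature_eq_zero t c hc
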